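/- Let $\alpha\in(0,2)$, $p>0$ with $\alpha=2/(1+p)$, and put $c(\theta)=\cos\theta|\cos\theta|^p$, $s(\theta)=\sin\theta|\sin\theta|^p$. Let $\mu_0$ be a probability measure on $\mathbb R$ with distribution function $F_0$ and characteristic function $\phi_0$, and let $F(\cdot,t)$ ($t\ge 0$) be the distribution functions of probability measures whose characteristic functions $\phi(\cdot,t)$ solve $$\partial_t\phi(\xi,t)=\frac1{2\pi}\int_0^{2\pi}\phi(\xi s(\theta),t)\,\phi(\xi c(\theta),t)\,d\theta-\phi(\xi,t)\quad(t>0,\ \xi\in\mathbb R),\qquad \phi(\cdot,0)=\phi_0 .$$ *Random weights.* Let $\nu_t$ be a random variable with $P_t\{\nu_t=n\}=e^{-t}(1-e^{-t})^{n-1}$, $n\ge1$. Given $\nu_t=n$, let $\gamma_t$ be a random binary tree with $n$ leaves of law $p_n$, where $p_1=1$ and, for $n\ge2$, the number $k$ of leaves of the left subtree is uniform on $\{1,\dots,n-1\}$ and, given $k$, the left and right subtrees are independent with laws $p_k$ and $p_{n-k}$. Attach to the $n-1$ internal nodes i.i.d. angles, uniform on $[0,2\pi)$ and independent of the tree. Let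 $\beta_{j,t}$ be the product, along the path from the root to leaf $j$, of the factors $c(\theta)$ (step to a left child) or $s(\theta)$ (step to a right child), $\theta$ being the angle of the parent ($\beta_{1,t}=1$ if $\nu_t=1$). Put $\beta_{(\nu_t)}=\max_j|\beta_{j,t}|$; $E_t$ is expectation under $P_t$. *Initial datum.* Let $F_0^*$ be the distribution function of the even part of $\mu_0$ (the probability measure with characteristic function $\mathrm{Re}\,\phi_0$). Assume $\lim_{x\to+\infty}x^\alpha(1-F_0^*(x))=c_0$ for some $c_0>0$. Put $a_0=2c_0\int_0^{\infty}x^{-\alpha}\sin x\,dx$ (improper integral), define $v_0^*$ by $1-\mathrm{Re}\,\phi_0(\xi)=(a_0+v_0^*(\xi))|\xi|^\alpha$, $v_0^*(0)=0$, and let $\|v_0^*\|=\sup_{\xi\ge0}|v_0^*(\xi)|$, $M=a_0+\|v_0^*\|$. Let $\eta\in(0,a_0)$ and let $d\in(0,1)$ be such that $\frac45M^2|x|^\alpha+\sup_{0\le y\le|x|}|v_0^*(y)|\le\eta$ whenever $|x|\le\tilde d:=(3d/(8M))^{1/\alpha}$. For $x>0$ put $S^*(x)=1-F_0^*(x)-c_0x^{-\alpha}$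 and $h^*(x)=x^\alpha S^*(x)$. Let $D>0$ be such that $S^*$ is monotonic on $[D,\infty)$. *Constants.* $$N_l=\int_0^\infty e^{-(a_0-\eta)\xi^\alpha}\xi^{l-1}d\xi,\quad A_m=\frac1{2\pi}\int_0^{2\pi}|\sin\theta|^md\theta,\quad n_r(x)=e^{-(a_0-\eta)x^\alpha}x^r,$$ $$z_r=\max\Big\{\int_0^\infty|n_r'(x)|dx,\ \tfrac12\int_0^\infty x^2|n_r'(x)|dx\Big\},\quad b_2^*(x)=-2\int_D^\infty(1-\cos(xy))\,dS^*(y),$$ $$\bar k_1=\int_0^Dx|S^*(x)|dx+\tfrac12D^2|S^*(D)|,\qquad \bar k_2=\sup_{x>0}x^{-\alpha}|b_2^*(x)|,$$ $$\bar B_1=2\bar k_1N_2+8\bar k_1\bar k_2N_{2+\alpha}+|S^*(D)|D^2N_2+2\bar k_2|S^*(D)|D^2N_{2+\alpha},\quad \bar B_2=8\bar k_1^2N_4,\quad \bar B_3=2z_0+4z_\alpha\bar k_2,$$ $$B_5=\tfrac45M^2N_{2\alpha},\quad B_6=\tfrac{32}{25}M^4N_{4\alpha},$$ $$H_1^*(q)=\int_0^1y^{1-\alpha}|h^*(y/q)|dy,\qquad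 H_3^*(q)=\int_1^\infty y^{-(1+\alpha)}|h^*(y/q)|dy .$$ Let $G_\alpha$ be the stable distribution function with characteristic function $e^{-a_0|\xi|^\alpha}$, let $\|g_\alpha\|$ be the supremum of its continuous density, and let $K(F,G)=\sup_x|F(x)-G(x)|$. There is an absolute constant $\mathbf c$, the constant of a Berry–Esseen inequality (i.e. $K(F,G)\le\frac1\pi\int_{-T}^T|(\hat f(\xi)-\hat g(\xi))/\xi|\,d\xi+\mathbf c\,m/T$ for all $T>0$ and all distribution functions $F,G$, with characteristic functions $\hat f,\hat g$, such that $G$ is differentiable with $|G'|\le m$), such that in the above situation, for every $t\ge0$, $$\begin{aligned}K(F(\cdot,t),G_\alpha)\le{}&\frac2\pi\bar B_3\,E_t\Big[\sum_{j=1}^{\nu_t}|\beta_{j,t}|^\alpha\{H_1^*(|\beta_{j,t}|)+H_3^*(|\beta_{j,t}|)\}\Big]+\frac{\mathbf c\|g_\alpha\|}{\tilde d}E_t(\beta_{(\nu_t)})\\&+\frac2\pi\Big\{\bar B_1e^{-t(1-2A_{4/\alpha})}+\bar B_2e^{-t(1-2A_{(8-2\alpha)/\alpha})}+B_5e^{-t(1-2A_4)}+B_6e^{-t(1-2A_6)}\Big\}\\&+\frac{e^{-t}}2\sup_{x\in\mathbb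 R}|F_0(x)+F_0(-x-0)-1| .\end{aligned}$$ -/

import Mathlib

open MeasureTheory ProbabilityTheory Set Filter Topology

namespace KacStable

noncomputable section

/-! ### The kinetic equation -/

/-- `c(θ) = cos θ |cos θ|^p`. -/
def cosP (p θ : ℝ) : ℝ := Real.cos θ * |Real.cos θ| ^ p

/-- `s(θ) = sin θ |sin θ|^p`. -/
def sinP (p θ : ℝ) : ℝ := Real.sin θ * |Real.sin θ| ^ p

/-- `μ t`, `t ≥ 0`, is a family of probability measures on `ℝ` whose characteristic functions
`φ(ξ,t)` solve
`∂φ/∂t (ξ,t) = (1/2π) ∫₀^{2π} φ(ξ s(θ),t) φ(ξ c(θ),t) dθ - φ(ξ,t)` for `t > 0`,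
with initial datum `μ₀`. -/
structure IsKineticSolution (p : ℝ) (μ₀ : Measure ℝ) (μ : ℝ → Measure ℝ) : Prop where
  prob : ∀ t, 0 ≤ t → IsProbabilityMeasure (μ t)
  init : μ 0 = μ₀
  cont_zero : ∀ ξ : ℝ, ContinuousWithinAt (fun t => charFun (μ t) ξ) (Ici 0) 0
  eqn : ∀ ξ t : ℝ, 0 < t → HasDerivAt (fun t' => charFun (μ t') ξ)
    ((1 / (2 * Real.pi) : ℝ) *
        (∫ θ in (0 : ℝ)..(2 * Real.pi),
          charFun (μ t) (ξ * sinP p θ) * charFun (μ t) (ξ * cosP p θ))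
      - charFun (μ t) ξ) t

/-! ### McKean's random tree and its weights -/

/-- Binary trees in which each node has zero or two (ordered) children. -/
inductive BinTree : Type
  | leaf : BinTree
  | node : BinTree → BinTree → BinTree

namespace BinTree

/-- Number of leaves. -/
def leaves : BinTree → ℕ
  | leaf => 1
  | node l r => leaves l + leaves r

/-- The probability `p_n` on the trees with `n` leaves associated with the Wild convolution
`q̂_n = (n-1)⁻¹ ∑_j q̂_{n-j} ∘ q̂_j`: the number of leaves of the left subtree is uniform on
`{1, …, n-1}`, and given it the two subtrees are independent. -/
def prob : BinTree → ℝ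
  | leaf => 1
  | node l r => prob l * prob r / ((leaves l : ℝ) + (leaves r : ℝ) - 1)

/-- The list `β_1, …, β_n` of the products attached to the leaves (from left to right): a left
child contributes the factor `c(θ_k)`, a right child the factor `s(θ_k)`, where `θ_k` is the
angle of its parent. The `n - 1` internal nodes are ordered so that the root comes first, then
those of the left subtree, then those of the right subtree. -/
def weights (p : ℝ) : BinTree → (ℕ → ℝ) → List ℝ
  | leaf, _ => [1]
  | node l r, θ =>
      (weights p l (fun k => θ (k + 1))).map (fun b => cosP p (θ 0) * b) ++
      (weights p r (fun k => θ (k + leaves l))).map (fun b => sinP p (θ 0) * b)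

/-- `β_(n) = max_j |β_j|`. -/
def maxWeight (p : ℝ) (g : BinTree) (θ : ℕ → ℝ) : ℝ :=
  ((weights p g θ).map (fun b => |b|)).foldr max 0

end BinTree

instance : MeasurableSpace BinTree := ⊤

/-- The uniform distribution on `[0, 2π)`. -/
def uniformAngle : Measure ℝ := cond volume (Ico 0 (2 * Real.pi))

instance : IsProbabilityMeasure uniformAngle := by
  unfold uniformAngle
  apply cond_isProbabilityMeasure_of_finite
  · simp [Real.pi_pos]
  · rw [Real.volume_Ico]
    exact ENNReal.ofReal_ne_top

/-- The joint law under `P_t` of the random tree `γ_t` (whose number of leaves is `ν_t`, with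
`P_t{ν_t = n} = e^{-t}(1-e^{-t})^{n-1}`) and of the sequence of angles `θ_t`, which is
independent of the tree and i.i.d. uniform on `[0, 2π)`. -/
def treeLaw (t : ℝ) : Measure (BinTree × (ℕ → ℝ)) :=
  Measure.sum fun g : BinTree =>
    ENNReal.ofReal (Real.exp (-t) * (1 - Real.exp (-t)) ^ (g.leaves - 1) * g.prob) •
      (Measure.dirac g).prod (Measure.infinitePi fun _ : ℕ => uniformAngle)

/-- `E_t[∑_j f(|β_{j,t}|)]`. -/
def expSumWeights (p t : ℝ) (f : ℝ → ℝ) : ℝ :=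
  ∫ ω, ((BinTree.weights p ω.1 ω.2).map (fun b => f |b|)).sum ∂(treeLaw t)

/-- `E_t[β_(ν_t)]`. -/
def expMaxWeight (p t : ℝ) : ℝ :=
  ∫ ω, BinTree.maxWeight p ω.1 ω.2 ∂(treeLaw t)

/-! ### Distances, stable laws, the Berry--Esseen inequality -/

/-- Kolmogorov's distance `sup_x |F(x) - G(x)|` of the distribution functions. -/
def kolmogorov (μ ν : Measure ℝ) : ℝ := ⨆ x : ℝ, |μ.real (Iic x) - ν.real (Iic x)|

/-- `G` is a probability measure with characteristic function `exp(-a |ξ|^α)`. -/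
def IsStableLaw (a α : ℝ) (G : Measure ℝ) : Prop :=
  IsProbabilityMeasure G ∧
    ∀ ξ : ℝ, charFun G ξ = ((Real.exp (-(a * |ξ| ^ α)) : ℝ) : ℂ)

open Classical in
/-- The (unique) symmetric stable law with characteristic function `exp(-a |ξ|^α)`. -/
def stableLaw (a α : ℝ) : Measure ℝ :=
  if h : ∃ G : Measure ℝ, IsStableLaw a α G then h.choose else 0

/-- The continuous density of the symmetric stable law (Fourier inversion):
`g(x) = (1/2π) ∫ e^{-iξx} e^{-a|ξ|^α} dξ`. -/
def stableDensity (a α x : ℝ) : ℝ :=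
  (1 / Real.pi) * ∫ ξ in Ioi (0 : ℝ), Real.cos (ξ * x) * Real.exp (-(a * ξ ^ α))

/-- Supremum norm of the density of the symmetric stable law. -/
def stableDensityNorm (a α : ℝ) : ℝ := ⨆ x : ℝ, |stableDensity a α x|

/-- `c` is an admissible constant in the Berry--Esseen smoothing inequality
`sup_x |F(x)-G(x)| ≤ (1/π) ∫_{-T}^{T} |(f(ξ)-g(ξ))/ξ| dξ + c m / T`,
valid for all `T > 0`, all distribution functions `F`, `G` (with characteristic functions `f`,
`g`) such that `G` is differentiable with `|G'| ≤ m`. (If the integral diverges the inequality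
says nothing.) -/
def IsBerryEsseenConstant (c : ℝ) : Prop :=
  ∀ (P G : Measure ℝ), IsProbabilityMeasure P → IsProbabilityMeasure G →
    ∀ (G' : ℝ → ℝ) (m T : ℝ), 0 < T →
      (∀ x, HasDerivAt (fun y => G.real (Iic y)) (G' x) x) → (∀ x, |G' x| ≤ m) →
      IntegrableOn (fun ξ : ℝ => ‖charFun P ξ - charFun G ξ‖ / |ξ|) (Icc (-T) T) →
      kolmogorov P G ≤
        (1 / Real.pi) * (∫ ξ in Icc (-T) T, ‖charFun P ξ - charFun G ξ‖ / |ξ|) + c * m / T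

/-- `A_m = (1/2π) ∫₀^{2π} |sin θ|^m dθ`. -/
def sinMoment (m : ℝ) : ℝ :=
  (1 / (2 * Real.pi)) * ∫ θ in (0 : ℝ)..(2 * Real.pi), |Real.sin θ| ^ m

/-! ### Quantities attached to the initial datum

Below `μ₀` is the initial law, `α` the stable exponent, and `c₀ = lim x^α (1 - F₀*(x))`. -/

/-- The even part `μ₀*` of `μ₀`, with characteristic function `Re φ₀`. -/
def evenPart (μ₀ : Measure ℝ) : Measure ℝ :=
  (2⁻¹ : ENNReal) • (μ₀ + μ₀.map (fun x => -x))

/-- `F₀*`, the distribution function of the even part. -/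
def evenCdf (μ₀ : Measure ℝ) (x : ℝ) : ℝ := (evenPart μ₀).real (Iic x)

/-- `a₀ = 2 c₀ ∫₀^∞ sin x / x^α dx` (improper integral). -/
def scaleA (c₀ α : ℝ) : ℝ :=
  2 * c₀ * limUnder atTop (fun R : ℝ => ∫ x in (0 : ℝ)..R, Real.sin x / x ^ α)

/-- `v₀*`, defined by `1 - Re φ₀(ξ) = (a₀ + v₀*(ξ)) |ξ|^α`, with `v₀*(0) = 0`. -/
def vStar (μ₀ : Measure ℝ) (c₀ α ξ : ℝ) : ℝ :=
  if ξ = 0 then 0 else (1 - (charFun μ₀ ξ).re) / |ξ| ^ α - scaleA c₀ α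

/-- `‖v₀*‖ = sup_{ξ ≥ 0} |v₀*(ξ)|`. -/
def vNorm (μ₀ : Measure ℝ) (c₀ α : ℝ) : ℝ :=
  sSup ((fun ξ => |vStar μ₀ c₀ α ξ|) '' Ici 0)

/-- `sup_{0 ≤ x ≤ ξ} |v₀*(x)|`. -/
def vBar (μ₀ : Measure ℝ) (c₀ α ξ : ℝ) : ℝ :=
  sSup ((fun x => |vStar μ₀ c₀ α x|) '' Icc 0 ξ)

/-- `M = a₀ + ‖v₀*‖`. -/
def bigM (μ₀ : Measure ℝ) (c₀ α : ℝ) : ℝ := scaleA c₀ α + vNorm μ₀ c₀ α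

/-- `d̃ = (3d/(8M))^{1/α}`. -/
def dTilde (μ₀ : Measure ℝ) (c₀ α d : ℝ) : ℝ :=
  (3 * d / (8 * bigM μ₀ c₀ α)) ^ (1 / α)

/-- `N_l = ∫₀^∞ exp(-(a₀-η) ξ^α) ξ^{l-1} dξ`. -/
def constN (c₀ α η l : ℝ) : ℝ :=
  ∫ ξ in Ioi (0 : ℝ), Real.exp (-((scaleA c₀ α - η) * ξ ^ α)) * ξ ^ (l - 1)

/-- `S*(x) = 1 - F₀*(x) - c₀ x^{-α}` for `x > 0`. -/
def sStar (μ₀ : Measure ℝ) (c₀ α x : ℝ) : ℝ := 1 - evenCdf μ₀ x - c₀ / x ^ α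

/-- `h*(x) = x^α S*(x)` for `x > 0`. -/
def hStar (μ₀ : Measure ℝ) (c₀ α x : ℝ) : ℝ := x ^ α * sStar μ₀ c₀ α x

/-- `H₁*(q) = ∫₀¹ y^{1-α} |h*(y/q)| dy`. -/
def hOne (μ₀ : Measure ℝ) (c₀ α q : ℝ) : ℝ :=
  ∫ y in Ioo (0 : ℝ) 1, y ^ (1 - α) * |hStar μ₀ c₀ α (y / q)|

/-- `H₃*(q) = ∫₁^∞ y^{-(1+α)} |h*(y/q)| dy`. -/
def hThree (μ₀ : Measure ℝ) (c₀ α q : ℝ) : ℝ :=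
  ∫ y in Ioi (1 : ℝ), y ^ (-(1 + α)) * |hStar μ₀ c₀ α (y / q)|

/-- `∫_{(D,∞)} f dS*` for `D > 0`: on `(0,∞)` the Stieltjes measure of `S*` is
`dS* = -dF₀* + α c₀ y^{-α-1} dy` (see `sStar_sub_sStar`). -/
def stieltjesSStar (μ₀ : Measure ℝ) (c₀ α D : ℝ) (f : ℝ → ℝ) : ℝ :=
  -(∫ y in Ioi D, f y ∂(evenPart μ₀)) + ∫ y in Ioi D, f y * (α * c₀ * y ^ (-α - 1))

/-- `b₂*(x) = -2 ∫_D^∞ (1 - cos(xy)) dS*(y)`. -/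
def bTwo (μ₀ : Measure ℝ) (c₀ α D x : ℝ) : ℝ :=
  -2 * stieltjesSStar μ₀ c₀ α D (fun y => 1 - Real.cos (x * y))

/-- `k̄₁ = ∫₀^D x |S*(x)| dx + D² |S*(D)| / 2`. -/
def kBarOne (μ₀ : Measure ℝ) (c₀ α D : ℝ) : ℝ :=
  (∫ x in Ioo (0 : ℝ) D, x * |sStar μ₀ c₀ α x|) + D ^ 2 * |sStar μ₀ c₀ α D| / 2

/-- `k̄₂ = sup_{x > 0} |b₂*(x)| / x^α`. -/
def kBarTwo (μ₀ : Measure ℝ) (c₀ α D : ℝ) : ℝ :=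
  sSup ((fun x => |bTwo μ₀ c₀ α D x| / x ^ α) '' Ioi 0)

/-- `n_r(x) = exp(-(a₀-η) x^α) x^r`. -/
def nFun (c₀ α η r x : ℝ) : ℝ := Real.exp (-((scaleA c₀ α - η) * x ^ α)) * x ^ r

/-- `z_r = max {∫₀^∞ |n_r'(x)| dx, (1/2) ∫₀^∞ x² |n_r'(x)| dx}`. -/
def zConst (c₀ α η r : ℝ) : ℝ :=
  max (∫ x in Ioi (0 : ℝ), |deriv (nFun c₀ α η r) x|)
    ((1 / 2) * ∫ x in Ioi (0 : ℝ), x ^ 2 * |deriv (nFun c₀ α η r) x|)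

/-- `B̄₁ = 2 k̄₁ N₂ + 8 k̄₁ k̄₂ N_{2+α} + |S*(D)| D² N₂ + 2 k̄₂ |S*(D)| D² N_{2+α}`. -/
def bBarOne (μ₀ : Measure ℝ) (c₀ α η D : ℝ) : ℝ :=
  2 * kBarOne μ₀ c₀ α D * constN c₀ α η 2
    + 8 * kBarOne μ₀ c₀ α D * kBarTwo μ₀ c₀ α D * constN c₀ α η (2 + α)
    + |sStar μ₀ c₀ α D| * D ^ 2 * constN c₀ α η 2
    + 2 * kBarTwo μ₀ c₀ α D * |sStar μ₀ c₀ α D| * D ^ 2 * constN c₀ α η (2 + α)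

/-- `B̄₂ = 8 k̄₁² N₄`. -/
def bBarTwo (μ₀ : Measure ℝ) (c₀ α η D : ℝ) : ℝ :=
  8 * kBarOne μ₀ c₀ α D ^ 2 * constN c₀ α η 4

/-- `B̄₃ = 2 z₀ + 4 z_α k̄₂`. -/
def bBarThree (μ₀ : Measure ℝ) (c₀ α η D : ℝ) : ℝ :=
  2 * zConst c₀ α η 0 + 4 * zConst c₀ α η α * kBarTwo μ₀ c₀ α D

/-- `B₅ = (4/5) M² N_{2α}`. -/
def bFive (μ₀ : Measure ℝ) (c₀ α η : ℝ) : ℝ :=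
  4 / 5 * bigM μ₀ c₀ α ^ 2 * constN c₀ α η (2 * α)

/-- `B₆ = (32/25) M⁴ N_{4α}`. -/
def bSix (μ₀ : Measure ℝ) (c₀ α η : ℝ) : ℝ :=
  32 / 25 * bigM μ₀ c₀ α ^ 4 * constN c₀ α η (4 * α)

/-- `sup_x |F₀(x) + F₀(-x-0) - 1|`, where `F₀(y-0)` is the left limit of `F₀` at `y`. -/
def asymmetry (μ₀ : Measure ℝ) : ℝ :=
  ⨆ x : ℝ, |μ₀.real (Iic x) + μ₀.real (Iio (-x)) - 1|

/-- The increments of `S*` on `(0,∞)` are those of the measure used in `stieltjesSStar`. -/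
theorem sStar_sub_sStar (μ₀ : Measure ℝ) [IsProbabilityMeasure μ₀] (c₀ : ℝ) {α a b : ℝ}
    (hα : 0 < α) (ha : 0 < a) (hab : a ≤ b) :
    sStar μ₀ c₀ α b - sStar μ₀ c₀ α a =
      -(evenPart μ₀).real (Ioc a b) + ∫ y in Ioc a b, α * c₀ * y ^ (-α - 1) := by
  have : IsFiniteMeasure (evenPart μ₀) := by
    constructor
    simp only [evenPart, Measure.smul_apply, Measure.add_apply, smul_eq_mul]
    exact ENNReal.mul_lt_top (by simp) (by simp [measure_lt_top])
  have h1 : evenCdf μ₀ b = evenCdf μ₀ a + (evenPart μ₀).real (Ioc a b) := by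
    unfold evenCdf
    rw [← Iic_union_Ioc_eq_Iic hab, measureReal_union _ measurableSet_Ioc]
    exact Set.disjoint_left.2 fun x hx hx' => not_lt.2 hx hx'.1
  have h2 : ∫ y in Ioc a b, α * c₀ * y ^ (-α - 1) = c₀ / a ^ α - c₀ / b ^ α := by
    rw [← intervalIntegral.integral_of_le hab, intervalIntegral.integral_const_mul,
      integral_rpow (Or.inr ⟨by linarith, fun h => by
        rw [uIcc_of_le hab] at h; exact absurd h.1 (not_le.2 ha)⟩)]
    rw [show -α - 1 + 1 = -α by ring, Real.rpow_neg ha.le, Real.rpow_neg (ha.le.trans hab)]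
    field_simp
    ring
  rw [h2]
  simp only [sStar, h1]
  ring

end

end KacStable

open KacStable

/-! The equation separates real and imaginary parts. The reflections θ ↦ -θ and θ ↦ π - θ annihilate
every part of the gain term that contains an imaginary part (`gain_charFun_eq`). Hence Im φ decays
exactly like e^{-t}, which produces the asymmetry term, while Re φ solves the same equation. By
uniqueness of bounded solutions Re φ is the Wild sum E_t[∏ Re φ₀(β_j ξ)]: `hasDerivAt_treeWeight` is
the forward equation for the tree law, and `charProd_node` splits a tree at its root. So, up to the
asymmetry term, F(·,t) is a mixture over trees and angles of the laws of ∑ β_j X_j, with X_j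
independent of law μ₀* (`IsKineticSolution.real_Iic_eq`).

It remains to bound the distance to the stable law for fixed weights (`kolmogorov_prod_le`) and to
average. Since cos² + sin² = 1 and α(1+p) = 2, the weights satisfy ∑|β_j|^α = 1, so e^{-a₀ξ^α}
factors along the leaves. For |β_j|ξ ≤ d̃, expanding the logarithms and using |e^z - 1| ≤ |z|e^{|z|}
bounds the difference of characteristic functions by e^{-(a₀-η)ξ^α} times a sum over leaves of
|v₀*|(|β_j|ξ)^α and of quadratic terms. Esseen's inequality with T = d̃/β_(n) turns this into
integrals over ξ. The power sums average to exponentials because they satisfy a linear equation in t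
(`tsum_treeWeight_mul_treeMoment`).

The delicate term is v₀*. Integration by parts on (0,D] replaces v₀*(ξ)ξ^α by b₂*(ξ) at the cost of
2k̄₁ξ² (`abs_vStar_mul_sub_bTwo_le`). Beyond D the Stieltjes measure dS* has a constant sign, so
|b₂*| is twice the integral of 1 - cos against a positive measure m. Tonelli then reduces the matter
to ∫ n(ξ)(1 - cos bξ)/ξ dξ, which is compared with a primitive of min(u,1/u); a layer-cake formula
converts that primitive into q^α(H₁*+H₃*) (`lintegral_bTwo_le`).

The comparison costs a factor 19/10. It is paid for by the freedom in Esseen's inequality: the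
leading constant can be any κ/(2π) with κ > 1 if 𝐜 is enlarged. With κ = 20/19 the product of the
two factors is exactly 2, and 𝐜 is taken large enough to serve the classical κ = 2 as well. The
first-order estimates already suffice, so the terms with B̄₂, B₆ and k̄₂ enter only as nonnegative
additions. -/

namespace KacStable

/-! ### The Fejér kernel -/

/-- The triangle function `max (1 - |ξ|) 0`. -/
noncomputable def triangle (ξ : ℝ) : ℝ := max (1 - |ξ|) 0

lemma continuous_triangle : Continuous triangle := by unfold triangle; fun_prop

lemma triangle_nonneg (ξ : ℝ) : 0 ≤ triangle ξ := le_max_right _ _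

lemma triangle_le_one (ξ : ℝ) : triangle ξ ≤ 1 :=
  max_le (by linarith [abs_nonneg ξ]) zero_le_one

lemma triangle_eq_zero {ξ : ℝ} (h : 1 ≤ |ξ|) : triangle ξ = 0 := max_eq_right (by linarith)

lemma hasCompactSupport_triangle : HasCompactSupport triangle :=
  HasCompactSupport.intro (K := Icc (-1) 1) isCompact_Icc fun x hx =>
    triangle_eq_zero (le_of_lt (by rw [mem_Icc, ← abs_le, not_le] at hx; exact hx))

lemma integrable_triangle : Integrable triangle :=
  continuous_triangle.integrable_of_hasCompactSupport hasCompactSupport_triangle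

lemma integrable_triangle_mul {f : ℝ → ℂ} (hf : Continuous f) :
    Integrable (fun ξ => (triangle ξ : ℂ) * f ξ) :=
  ((Complex.continuous_ofReal.comp continuous_triangle).mul hf).integrable_of_hasCompactSupport
    ((hasCompactSupport_triangle.comp_left (g := fun x : ℝ => (x : ℂ)) (by simp)).mul_right)

/-- The Fejér density, the inverse Fourier transform of the triangle function. -/
noncomputable def fejer (v : ℝ) : ℝ := (1 / (2 * Real.pi)) * ∫ ξ, triangle ξ * Real.cos (ξ * v)

/-- The closed form exhibits both properties needed of the kernel: nonnegativity and decay like v⁻².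
By evenness the integral is twice the one over (0,1), where an explicit antiderivative is available.
-/
lemma integral_triangle_cos {v : ℝ} (hv : v ≠ 0) :
    ∫ ξ, triangle ξ * Real.cos (ξ * v) = 2 * (1 - Real.cos v) / v ^ 2 := by
  have h1 : ∫ ξ, triangle ξ * Real.cos (ξ * v) = 2 * ∫ ξ in Ioi (0 : ℝ), triangle ξ * Real.cos (ξ * v) := by
    rw [← integral_comp_abs (f := fun ξ => triangle ξ * Real.cos (ξ * v))]
    congr 1 with x
    rcases abs_choice x with h | h <;> simp [h, triangle]
  have h2 : ∫ ξ in Ioi (0 : ℝ), triangle ξ * Real.cos (ξ * v)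
      = ∫ ξ in (0 : ℝ)..1, (1 - ξ) * Real.cos (ξ * v) := by
    rw [intervalIntegral.integral_of_le zero_le_one,
      ← integral_indicator measurableSet_Ioi, ← integral_indicator measurableSet_Ioc]
    congr 1 with x
    by_cases hx : x ∈ Ioc (0 : ℝ) 1
    · rw [indicator_of_mem hx, indicator_of_mem (show x ∈ Ioi (0 : ℝ) from hx.1), triangle,
        abs_of_pos hx.1, max_eq_left (by linarith [hx.2])]
    · rw [indicator_of_notMem hx]
      by_cases hx0 : x ∈ Ioi (0 : ℝ)
      · rw [indicator_of_mem hx0, triangle_eq_zero, zero_mul]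
        rw [abs_of_pos hx0]
        by_contra! h
        exact hx ⟨hx0, h.le⟩
      · rw [indicator_of_notMem hx0]
  have h3 : ∫ ξ in (0 : ℝ)..1, (1 - ξ) * Real.cos (ξ * v) = (1 - Real.cos v) / v ^ 2 := by
    have hd : ∀ x ∈ uIcc (0 : ℝ) 1, HasDerivAt
        (fun ξ => (1 - ξ) * (Real.sin (ξ * v) / v) - Real.cos (ξ * v) / v ^ 2)
        ((1 - x) * Real.cos (x * v)) x := by
      intro x _
      have e := (((hasDerivAt_id x).const_sub 1).mul
        (((hasDerivAt_id x).mul_const v).sin.div_const v)).sub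
        ((((hasDerivAt_id x).mul_const v).cos).div_const (v ^ 2))
      refine e.congr_deriv ?_
      simp only [id]
      field_simp
      ring
    rw [intervalIntegral.integral_eq_sub_of_hasDerivAt hd
      (Continuous.intervalIntegrable (by fun_prop) _ _)]
    simp
    field_simp
    ring
  rw [h1, h2, h3]; ring

lemma fejer_eq {v : ℝ} (hv : v ≠ 0) : fejer v = (1 - Real.cos v) / (Real.pi * v ^ 2) := by
  rw [fejer, integral_triangle_cos hv]
  field_simp

lemma ofReal_fejer (v : ℝ) :
    (fejer v : ℂ) = (1 / (2 * Real.pi) : ℝ) *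
      ∫ ξ, (triangle ξ : ℂ) * Complex.exp (-(ξ * v : ℝ) * Complex.I) := by
  have hi := integrable_triangle_mul (f := fun ξ => Complex.exp (-(ξ * v : ℝ) * Complex.I))
    (by fun_prop)
  have him : (∫ ξ, triangle ξ * -Real.sin (ξ * v)) = 0 := by
    have := integral_neg_eq_self (fun ξ => triangle ξ * -Real.sin (ξ * v)) volume
    have h2 : (fun ξ => triangle (-ξ) * -Real.sin (-ξ * v))
      = fun ξ => -(triangle ξ * -Real.sin (ξ * v)) := by
      ext ξ; simp [triangle]
    rw [h2, integral_neg] at this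
    linarith
  have e : (∫ ξ, (triangle ξ : ℂ) * Complex.exp (-(ξ * v : ℝ) * Complex.I))
      = ((∫ ξ, triangle ξ * Real.cos (ξ * v) : ℝ) : ℂ) := by
    rw [← integral_re_add_im hi]
    have hre : ∀ ξ : ℝ, RCLike.re ((triangle ξ : ℂ) * Complex.exp (-(ξ * v : ℝ) * Complex.I))
        = triangle ξ * Real.cos (ξ * v) := by
      intro ξ
      rw [← Complex.ofReal_neg, RCLike.re_eq_complex_re, Complex.re_ofReal_mul,
        Complex.exp_ofReal_mul_I_re, Real.cos_neg]
    have hi' : ∀ ξ : ℝ, RCLike.im ((triangle ξ : ℂ) * Complex.exp (-(ξ * v : ℝ) * Complex.I))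
        = triangle ξ * -Real.sin (ξ * v) := by
      intro ξ
      rw [← Complex.ofReal_neg, RCLike.im_eq_complex_im, Complex.im_ofReal_mul,
        Complex.exp_ofReal_mul_I_im, Real.sin_neg]
    simp_rw [hre, hi', him]
    simp
  rw [e, fejer, Complex.ofReal_mul]

lemma fejer_nonneg (v : ℝ) : 0 ≤ fejer v := by
  rcases eq_or_ne v 0 with rfl | hv
  · simp only [fejer, mul_zero, Real.cos_zero, mul_one]
    exact mul_nonneg (by positivity) (integral_nonneg triangle_nonneg)
  · rw [fejer_eq hv]
    exact div_nonneg (by linarith [Real.cos_le_one v]) (by positivity)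

lemma continuous_fejer : Continuous fejer := by
  unfold fejer
  refine continuous_const.mul ?_
  refine continuous_of_dominated (bound := triangle) (fun v => ?_) (fun v => ?_)
    integrable_triangle ?_
  · exact (continuous_triangle.mul (by fun_prop)).aestronglyMeasurable
  · refine Eventually.of_forall fun ξ => ?_
    rw [Real.norm_eq_abs, abs_mul, abs_of_nonneg (triangle_nonneg ξ)]
    exact mul_le_of_le_one_right (triangle_nonneg ξ) (Real.abs_cos_le_one _)
  · exact Eventually.of_forall fun ξ => by fun_prop

lemma fejer_le (v : ℝ) : fejer v ≤ fejer 0 := by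
  unfold fejer
  gcongr ?_ * ?_
  refine integral_mono ?_ ?_ fun ξ => ?_
  · refine integrable_triangle.mono' ?_ (Eventually.of_forall fun ξ => ?_)
    · exact (continuous_triangle.mul (by fun_prop)).aestronglyMeasurable
    · rw [Real.norm_eq_abs, abs_mul, abs_of_nonneg (triangle_nonneg ξ)]
      exact mul_le_of_le_one_right (triangle_nonneg ξ) (Real.abs_cos_le_one _)
  · simpa using integrable_triangle
  · simp only [mul_zero, Real.cos_zero, mul_one]
    exact mul_le_of_le_one_right (triangle_nonneg ξ) (Real.cos_le_one _)

lemma integrable_fejer : Integrable fejer := by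
  -- Away from 0 the two bounds 1 - cos v ≤ v²/2 and 1 - cos v ≤ 2 give the decay. The closed form
  -- is not available at v = 0, where the crude bound ∫ triangle ≤ 2 is used.
  have hb : ∀ v, fejer v ≤ 4 * (1 + v ^ 2)⁻¹ := by
    intro v
    have hpi := Real.pi_gt_three
    rcases eq_or_ne v 0 with rfl | hv
    · have h1 : (∫ ξ, triangle ξ) ≤ 2 := by
        have : (∫ ξ, triangle ξ) ≤ ∫ ξ, (Icc (-1 : ℝ) 1).indicator (fun _ => 1) ξ := by
          refine integral_mono integrable_triangle
            ((integrable_indicator_iff measurableSet_Icc).2 (by simp)) fun ξ => ?_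
          by_cases h : ξ ∈ Icc (-1 : ℝ) 1
          · rw [indicator_of_mem h]; exact triangle_le_one ξ
          · rw [indicator_of_notMem h, triangle_eq_zero]
            rw [mem_Icc, ← abs_le, not_le] at h; exact h.le
        refine this.trans (le_of_eq ?_)
        rw [integral_indicator measurableSet_Icc]
        norm_num
      simp only [fejer, mul_zero, Real.cos_zero, mul_one]
      have : (1 / (2 * Real.pi)) ≤ 1 := by rw [div_le_one (by positivity)]; linarith
      have h0 : 0 ≤ ∫ ξ, triangle ξ := integral_nonneg triangle_nonneg
      calc _ ≤ 1 * (2 : ℝ) := by gcongr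
        _ ≤ _ := by norm_num
    · rw [fejer_eq hv, ← div_eq_mul_inv, div_le_div_iff₀ (by positivity) (by positivity)]
      have hc := Real.one_sub_sq_div_two_le_cos (x := v)
      have hc2 := Real.neg_one_le_cos v
      have : 0 ≤ v ^ 2 := sq_nonneg v
      nlinarith
  refine Integrable.mono' (integrable_inv_one_add_sq.const_mul 4)
    continuous_fejer.aestronglyMeasurable (Eventually.of_forall fun v => ?_)
  rw [Real.norm_eq_abs, abs_of_nonneg (fejer_nonneg v)]
  exact hb v

-- Fourier inversion at the origin, where the triangle function equals 1.
open FourierTransform in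
lemma integral_fejer : ∫ v, fejer v = 1 := by
  have hw : Continuous (fun ξ => (triangle ξ : ℂ)) := Complex.continuous_ofReal.comp continuous_triangle
  have hwi : Integrable (fun ξ => (triangle ξ : ℂ)) := integrable_triangle.ofReal
  -- The transform `𝓕` uses the kernel e^{-2πivξ}, hence the dilation by 2π.
  have hF : 𝓕 (fun ξ => (triangle ξ : ℂ)) = fun v => ((2 * Real.pi * fejer (v * (2 * Real.pi)) : ℝ) : ℂ) := by
    ext v
    rw [Real.fourier_eq', Complex.ofReal_mul, ofReal_fejer, ← mul_assoc, ← Complex.ofReal_mul]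
    rw [show 2 * Real.pi * (1 / (2 * Real.pi)) = 1 by field_simp]
    rw [Complex.ofReal_one, one_mul]
    congr 1 with ξ
    simp
    rw [mul_comm]
    congr 2
    ring_nf
  have hFi : Integrable (𝓕 (fun ξ => (triangle ξ : ℂ))) := by
    rw [hF]
    exact ((integrable_fejer.comp_mul_right' (by positivity)).const_mul _).ofReal
  have h := congrFun (Continuous.fourierInv_fourier_eq hw hwi hFi) 0
  rw [Real.fourierInv_eq', hF] at h
  simp [triangle] at h
  have h2 : (∫ v, 2 * Real.pi * fejer (v * (2 * Real.pi))) = 1 := by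
    have : ((∫ v, 2 * Real.pi * fejer (v * (2 * Real.pi)) : ℝ) : ℂ) = 1 := by
      rw [← integral_complex_ofReal, ← h]
      congr 1 with v
      push_cast; ring
    exact_mod_cast this
  rw [integral_const_mul, Measure.integral_comp_mul_right, abs_of_pos (by positivity)] at h2
  rw [← h2, smul_eq_mul]
  field_simp

/-! ### Smoothed distribution functions and Esseen's inequality -/

/-- The rescaled Fejér density `T k(T v)`. -/
noncomputable def fejerScaled (T v : ℝ) : ℝ := T * fejer (v * T)

lemma fejerScaled_nonneg {T : ℝ} (hT : 0 < T) (v : ℝ) : 0 ≤ fejerScaled T v :=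
  mul_nonneg hT.le (fejer_nonneg _)

lemma continuous_fejerScaled (T : ℝ) : Continuous (fejerScaled T) :=
  continuous_const.mul (continuous_fejer.comp (by fun_prop))

lemma integrable_fejerScaled {T : ℝ} (hT : 0 < T) : Integrable (fejerScaled T) :=
  (integrable_fejer.comp_mul_right' hT.ne').const_mul _

lemma integral_fejerScaled {T : ℝ} (hT : 0 < T) : ∫ v, fejerScaled T v = 1 := by
  simp only [fejerScaled]
  rw [integral_const_mul, Measure.integral_comp_mul_right, integral_fejer,
    abs_of_pos (by positivity)]
  simp [hT.ne']

lemma ofReal_fejerScaled {T : ℝ} (hT : 0 < T) (v : ℝ) :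
    (fejerScaled T v : ℂ) = (1 / (2 * Real.pi) : ℝ) *
      ∫ ξ, (triangle (ξ / T) : ℂ) * Complex.exp (-(ξ * v : ℝ) * Complex.I) := by
  have := Measure.integral_comp_div
    (fun ξ : ℝ => (triangle ξ : ℂ) * Complex.exp (-(ξ * (v * T) : ℝ) * Complex.I)) T
  rw [abs_of_pos hT] at this
  rw [fejerScaled, Complex.ofReal_mul, ofReal_fejer, mul_left_comm]
  congr 1
  rw [← Complex.real_smul, ← this]
  congr 1 with ξ
  congr 4
  field_simp

lemma integrable_triangle_div_mul {T : ℝ} (hT : 0 < T) {f : ℝ → ℂ} (hf : Continuous f) :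
    Integrable (fun ξ => (triangle (ξ / T) : ℂ) * f ξ) := by
  have := (integrable_triangle_mul (f := fun ξ => f (ξ * T)) (by fun_prop)).comp_div hT.ne'
  refine this.congr (Eventually.of_forall fun ξ => ?_)
  simp [hT.ne']

/-- The density of the smoothed law in Fourier form. The transform of the kernel vanishes outside
[-T,T], so the integrals converge absolutely without any integrability of `charFun P`. -/
lemma integral_fejerScaled_sub {T : ℝ} (hT : 0 < T) (P : Measure ℝ) [IsProbabilityMeasure P]
    (u : ℝ) : ((∫ y, fejerScaled T (u - y) ∂P : ℝ) : ℂ) = (1 / (2 * Real.pi) : ℝ) *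
      ∫ ξ, (triangle (ξ / T) : ℂ) * (Complex.exp (-(ξ * u : ℝ) * Complex.I) * charFun P ξ) := by
  rw [← integral_complex_ofReal]
  simp_rw [ofReal_fejerScaled hT]
  rw [integral_const_mul]
  congr 1
  have hint : Integrable (Function.uncurry fun (y ξ : ℝ) =>
      (triangle (ξ / T) : ℂ) * Complex.exp (-(ξ * (u - y) : ℝ) * Complex.I)) (P.prod volume) := by
    have h1 := integrable_triangle_div_mul hT (f := fun _ => 1) continuous_const
    have h2 := (integrable_const (1 : ℂ) (μ := P)).mul_prod h1
    refine Integrable.mono h2 ?_ (Eventually.of_forall fun z => ?_)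
    · refine Continuous.aestronglyMeasurable ?_
      have := continuous_triangle
      simp only [Function.uncurry_def]
      fun_prop
    · simp only [Function.uncurry_def, norm_mul, ← Complex.ofReal_neg,
        Complex.norm_exp_ofReal_mul_I, norm_one]
      simp
  rw [integral_integral_swap hint]
  congr 1 with ξ
  rw [integral_const_mul, charFun_apply_real]
  congr 1
  rw [← integral_const_mul]
  congr 1 with y
  rw [← Complex.exp_add]
  congr 1
  push_cast; ring

/-- The distribution function of `P` smoothed by the Fejér density. -/
noncomputable def smoothCdf (T : ℝ) (P : Measure ℝ) (x : ℝ) : ℝ :=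
  ∫ v, P.real (Iic (x - v)) * fejerScaled T v

lemma measurable_cdf_sub (P : Measure ℝ) [IsProbabilityMeasure P] (x : ℝ) :
    Measurable fun v => P.real (Iic (x - v)) := by
  have : Monotone fun v => P.real (Iic v) := fun a b h => measureReal_mono (Iic_subset_Iic.2 h)
  exact this.measurable.comp (by fun_prop)

lemma integrable_smoothCdf {T : ℝ} (hT : 0 < T) (P : Measure ℝ) [IsProbabilityMeasure P] (x : ℝ) :
    Integrable fun v => P.real (Iic (x - v)) * fejerScaled T v :=
  (integrable_fejerScaled hT).bdd_mul (measurable_cdf_sub P x).aestronglyMeasurable (c := 1)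
    (Eventually.of_forall fun v => by
      rw [Real.norm_eq_abs, abs_of_nonneg measureReal_nonneg]; exact measureReal_le_one)

/-- Fixes the additive constant that is lost when only increments of the smoothed distribution
functions are expressed by Fourier integrals. -/
lemma tendsto_smoothCdf_atBot {T : ℝ} (hT : 0 < T) (P : Measure ℝ) [IsProbabilityMeasure P] :
    Tendsto (smoothCdf T P) atBot (𝓝 0) := by
  have : (0 : ℝ) = ∫ v, 0 * fejerScaled T v := by simp
  rw [this]
  refine tendsto_integral_filter_of_dominated_convergence (fejerScaled T) ?_ ?_
    (integrable_fejerScaled hT) ?_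
  · exact Eventually.of_forall fun x => (integrable_smoothCdf hT P x).aestronglyMeasurable
  · refine Eventually.of_forall fun x => Eventually.of_forall fun v => ?_
    rw [Real.norm_eq_abs, abs_mul, abs_of_nonneg measureReal_nonneg,
      abs_of_nonneg (fejerScaled_nonneg hT v)]
    exact mul_le_of_le_one_left (fejerScaled_nonneg hT v) measureReal_le_one
  · refine Eventually.of_forall fun v => ?_
    refine Tendsto.mul_const _ ?_
    have h := (tendsto_cdf_atBot P).comp (tendsto_atBot_add_const_right atBot (-v) tendsto_id)
    refine h.congr fun x => ?_
    simp [cdf_eq_real, sub_eq_add_neg]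

/-- Both sides integrate the kernel over {v + y ≤ x} against dv ⊗ P(dy), in opposite orders. This
shows that `smoothCdf` is the distribution function of a convolution with a density. -/
lemma smoothCdf_eq {T : ℝ} (hT : 0 < T) (P : Measure ℝ) [IsProbabilityMeasure P] (x : ℝ) :
    smoothCdf T P x = ∫ y, (∫ u in Iic x, fejerScaled T (u - y)) ∂P := by
  have hk := integrable_fejerScaled hT
  have e1 : ∀ v, P.real (Iic (x - v)) * fejerScaled T v
      = ∫ y, (Iic x).indicator (fun _ => fejerScaled T v) (v + y) ∂P := by
    intro v
    rw [show (fun y => (Iic x).indicator (fun _ => fejerScaled T v) (v + y))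
      = (Iic (x - v)).indicator (fun _ => fejerScaled T v) from ?_,
      integral_indicator measurableSet_Iic]
    · simp
    · ext y
      simp only [indicator, mem_Iic, le_sub_iff_add_le']
  have e2 : ∀ y, ∫ u in Iic x, fejerScaled T (u - y)
      = ∫ v, (Iic x).indicator (fun _ => fejerScaled T v) (v + y) := by
    intro y
    rw [← integral_indicator measurableSet_Iic, ← integral_add_right_eq_self _ y]
    congr 1 with v
    simp only [indicator, add_sub_cancel_right]
  rw [smoothCdf]
  simp_rw [e1, e2]
  rw [integral_integral_swap]
  have h2 := hk.mul_prod (integrable_const (1 : ℝ) (μ := P))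
  refine Integrable.mono h2 ?_ (Eventually.of_forall fun z => ?_)
  · refine Measurable.aestronglyMeasurable ?_
    have hm : Measurable fun z : ℝ × ℝ => fejerScaled T z.1 :=
      (continuous_fejerScaled T).measurable.comp measurable_fst
    have : (Function.uncurry fun v y => (Iic x).indicator (fun _ => fejerScaled T v) (v + y))
        = {z : ℝ × ℝ | z.1 + z.2 ≤ x}.indicator (fun z => fejerScaled T z.1) := by
      ext z
      simp [Function.uncurry_def, indicator]
    rw [this]
    exact hm.indicator (measurableSet_le (by fun_prop) (by fun_prop))
  · simp only [Function.uncurry_def, mul_one]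
    exact norm_indicator_le_norm_self _ _

lemma smoothCdf_sub {T : ℝ} (hT : 0 < T) (P : Measure ℝ) [IsProbabilityMeasure P] {x' x : ℝ}
    (h : x' ≤ x) : smoothCdf T P x - smoothCdf T P x' =
      ∫ u in x'..x, ∫ y, fejerScaled T (u - y) ∂P := by
  have hk := integrable_fejerScaled hT
  have hb : ∀ x y, ‖∫ u in Iic x, fejerScaled T (u - y)‖ ≤ 1 := by
    intro x y
    rw [Real.norm_eq_abs, abs_of_nonneg (integral_nonneg fun u => fejerScaled_nonneg hT _)]
    refine (setIntegral_le_integral (hk.comp_sub_right y)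
      (Eventually.of_forall fun u => fejerScaled_nonneg hT _)).trans ?_
    rw [integral_sub_right_eq_self (fejerScaled T) y, integral_fejerScaled hT]
  have hjoint : Integrable (Function.uncurry fun (y u : ℝ) => fejerScaled T (u - y))
      (P.prod (volume.restrict (uIoc x' x))) := by
    have : IsFiniteMeasure (volume.restrict (uIoc x' x)) := by
      rw [uIoc_of_le h]; infer_instance
    refine Integrable.of_bound (C := T * fejer 0) ?_ (Eventually.of_forall fun z => ?_)
    · refine Continuous.aestronglyMeasurable ?_
      exact (continuous_fejerScaled T).comp (by fun_prop : Continuous fun z : ℝ × ℝ => z.2 - z.1)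
    · simp only [Function.uncurry_def]
      rw [Real.norm_eq_abs, abs_of_nonneg (fejerScaled_nonneg hT _)]
      exact mul_le_mul_of_nonneg_left (fejer_le _) hT.le
  have hmeas : ∀ x, AEStronglyMeasurable (fun y => ∫ u in Iic x, fejerScaled T (u - y)) P := by
    intro x
    refine StronglyMeasurable.aestronglyMeasurable ?_
    refine StronglyMeasurable.integral_prod_right' (f := fun z : ℝ × ℝ => fejerScaled T (z.2 - z.1)) ?_
    exact ((continuous_fejerScaled T).comp (by fun_prop)).stronglyMeasurable
  rw [smoothCdf_eq hT, smoothCdf_eq hT, ← integral_sub]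
  · rw [intervalIntegral_integral_swap (f := fun u y => fejerScaled T (u - y)) hjoint.swap]
    congr 1 with y
    exact intervalIntegral.integral_Iic_sub_Iic (hk.comp_sub_right y).integrableOn
      (hk.comp_sub_right y).integrableOn
  · exact Integrable.of_bound (hmeas x) 1 (Eventually.of_forall (hb x))
  · exact Integrable.of_bound (hmeas x') 1 (Eventually.of_forall (hb x'))

/-- Increments are used because the inner integral of the exponential over [x',x] supplies the
factor 1/ξ; the individual values have no such absolutely convergent representation. -/
lemma smoothCdf_sub_sub {T : ℝ} (hT : 0 < T) (P G : Measure ℝ) [IsProbabilityMeasure P]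
    [IsProbabilityMeasure G] {x' x : ℝ} (h : x' ≤ x) :
    (((smoothCdf T P x - smoothCdf T G x) - (smoothCdf T P x' - smoothCdf T G x') : ℝ) : ℂ)
      = (1 / (2 * Real.pi) : ℝ) * ∫ ξ, ((triangle (ξ / T) : ℂ) * (charFun P ξ - charFun G ξ)) *
          ∫ u in x'..x, Complex.exp (-(ξ * u : ℝ) * Complex.I) := by
  have hcont : ∀ Q : Measure ℝ, IsProbabilityMeasure Q →
      Continuous fun u => ∫ y, fejerScaled T (u - y) ∂Q := by
    intro Q _
    refine continuous_of_dominated (bound := fun _ => T * fejer 0) (fun v => ?_) (fun v => ?_)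
      (integrable_const _) ?_
    · exact ((continuous_fejerScaled T).comp (by fun_prop)).aestronglyMeasurable
    · refine Eventually.of_forall fun y => ?_
      rw [Real.norm_eq_abs, abs_of_nonneg (fejerScaled_nonneg hT _)]
      exact mul_le_mul_of_nonneg_left (fejer_le _) hT.le
    · exact Eventually.of_forall fun y => (continuous_fejerScaled T).comp (by fun_prop)
  have e : (smoothCdf T P x - smoothCdf T G x) - (smoothCdf T P x' - smoothCdf T G x')
      = ∫ u in x'..x, ((∫ y, fejerScaled T (u - y) ∂P) - ∫ y, fejerScaled T (u - y) ∂G) := by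
    rw [intervalIntegral.integral_sub ((hcont P inferInstance).intervalIntegrable _ _)
      ((hcont G inferInstance).intervalIntegrable _ _), ← smoothCdf_sub hT P h,
      ← smoothCdf_sub hT G h]
    ring
  have hi : ∀ (Q : Measure ℝ) (u : ℝ), IsProbabilityMeasure Q → Integrable fun ξ : ℝ =>
      (triangle (ξ / T) : ℂ) * (Complex.exp (-(ξ * u : ℝ) * Complex.I) * charFun Q ξ) :=
    fun Q u _ => integrable_triangle_div_mul hT (by fun_prop)
  rw [e, ← intervalIntegral.integral_ofReal]
  simp_rw [Complex.ofReal_sub, integral_fejerScaled_sub hT, ← mul_sub]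
  rw [intervalIntegral.integral_const_mul]
  congr 1
  have e2 : ∀ u : ℝ, ((∫ ξ, (triangle (ξ / T) : ℂ) *
        (Complex.exp (-(ξ * u : ℝ) * Complex.I) * charFun P ξ)) -
      ∫ ξ, (triangle (ξ / T) : ℂ) * (Complex.exp (-(ξ * u : ℝ) * Complex.I) * charFun G ξ))
      = ∫ ξ, ((triangle (ξ / T) : ℂ) * (charFun P ξ - charFun G ξ)) *
          Complex.exp (-(ξ * u : ℝ) * Complex.I) := by
    intro u
    rw [← integral_sub (hi P u inferInstance) (hi G u inferInstance)]
    congr 1 with ξ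
    ring
  simp_rw [e2]
  rw [intervalIntegral_integral_swap]
  · simp_rw [intervalIntegral.integral_const_mul]
  · have : IsFiniteMeasure (volume.restrict (uIoc x' x)) := by
      rw [uIoc_of_le h]; infer_instance
    have h1 := integrable_triangle_div_mul hT (f := fun ξ => charFun P ξ - charFun G ξ)
      (by fun_prop)
    have h2 := (integrable_const (1 : ℂ) (μ := volume.restrict (uIoc x' x))).mul_prod h1
    refine Integrable.mono h2 ?_ (Eventually.of_forall fun z => ?_)
    · refine Continuous.aestronglyMeasurable ?_
      have := continuous_triangle
      have h3 : Continuous (charFun P) := by fun_prop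
      have h4 : Continuous (charFun G) := by fun_prop
      simp only [Function.uncurry_def]
      fun_prop
    · simp only [Function.uncurry_def, norm_mul, ← Complex.ofReal_neg,
        Complex.norm_exp_ofReal_mul_I, norm_one]
      simp

/-- The Riemann–Lebesgue lemma with the frequency rescaled by 2π. It needs no integrability: if f is
not integrable, all the integrals have the default value 0. -/
lemma tendsto_integral_exp_mul_atBot (f : ℝ → ℂ) :
    Tendsto (fun x : ℝ => ∫ ξ : ℝ, f ξ * Complex.exp (-(ξ * x : ℝ) * Complex.I)) atBot (𝓝 0) := by
  have h := (Real.tendsto_integral_exp_smul_cocompact f).mono_left atBot_le_cocompact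
  have h2 : Tendsto (fun x : ℝ => x / (2 * Real.pi)) atBot atBot :=
    tendsto_id.atBot_div_const (by positivity)
  refine (h.comp h2).congr fun x => ?_
  simp only [Function.comp]
  congr 1 with ξ
  rw [Circle.smul_def, Real.fourierChar_apply, smul_eq_mul, mul_comm]
  congr 2
  push_cast
  field_simp

/-- The Fourier bound for the difference of smoothed distribution functions. -/
lemma abs_smoothCdf_sub_le {T : ℝ} (hT : 0 < T) (P G : Measure ℝ) [IsProbabilityMeasure P]
    [IsProbabilityMeasure G]
    (hint : IntegrableOn (fun ξ : ℝ => ‖charFun P ξ - charFun G ξ‖ / |ξ|) (Icc (-T) T)) (x : ℝ) :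
    |smoothCdf T P x - smoothCdf T G x| ≤
      1 / (2 * Real.pi) * ∫ ξ in Icc (-T) T, ‖charFun P ξ - charFun G ξ‖ / |ξ| := by
  -- The factor I/ξ comes from integrating e^{-iξu} in u. At ξ = 0 it has the default value 0, which
  -- is harmless on a null set.
  set ψ : ℝ → ℂ := fun ξ => ((triangle (ξ / T) : ℂ) * (charFun P ξ - charFun G ξ)) *
    (Complex.I / ξ) with hψ
  have hbound : ∀ ξ, ‖ψ ξ‖ ≤
      (Icc (-T) T).indicator (fun ξ => ‖charFun P ξ - charFun G ξ‖ / |ξ|) ξ := by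
    intro ξ
    by_cases hξ : ξ ∈ Icc (-T) T
    · rw [indicator_of_mem hξ]
      simp only [hψ, norm_mul, norm_div, Complex.norm_I, Complex.norm_real, Real.norm_eq_abs]
      rw [abs_of_nonneg (triangle_nonneg _), mul_one_div]
      gcongr
      exact mul_le_of_le_one_left (norm_nonneg _) (triangle_le_one _)
    · rw [indicator_of_notMem hξ]
      rw [mem_Icc, ← abs_le, not_le] at hξ
      have : triangle (ξ / T) = 0 := triangle_eq_zero (by
        rw [abs_div, abs_of_pos hT, le_div_iff₀ hT]; linarith)
      simp [hψ, this]
  have hind := (integrable_indicator_iff measurableSet_Icc).2 hint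
  have hψi : Integrable ψ := by
    refine hind.mono' ?_ (Eventually.of_forall hbound)
    refine Measurable.aestronglyMeasurable ?_
    have h1 := continuous_triangle.measurable
    have h3 : Measurable (charFun P) := measurable_charFun
    have h4 : Measurable (charFun G) := measurable_charFun
    fun_prop
  have hexp : ∀ y, ‖∫ ξ, ψ ξ * Complex.exp (-(ξ * y : ℝ) * Complex.I)‖ ≤
      ∫ ξ in Icc (-T) T, ‖charFun P ξ - charFun G ξ‖ / |ξ| := by
    intro y
    rw [← integral_indicator measurableSet_Icc]
    refine norm_integral_le_of_norm_le hind (Eventually.of_forall fun ξ => ?_)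
    rw [norm_mul, ← Complex.ofReal_neg, Complex.norm_exp_ofReal_mul_I, mul_one]
    exact hbound ξ
  have hexpi : ∀ y : ℝ, Integrable fun ξ => ψ ξ * Complex.exp (-(ξ * y : ℝ) * Complex.I) := by
    intro y
    refine hψi.mono ?_ (Eventually.of_forall fun ξ => ?_)
    · exact hψi.aestronglyMeasurable.mul (Continuous.aestronglyMeasurable (by fun_prop))
    · rw [norm_mul, ← Complex.ofReal_neg, Complex.norm_exp_ofReal_mul_I, mul_one]
  have hmain : ∀ x' ≤ x, (((smoothCdf T P x - smoothCdf T G x) -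
      (smoothCdf T P x' - smoothCdf T G x') : ℝ) : ℂ) = (1 / (2 * Real.pi) : ℝ) *
      ((∫ ξ, ψ ξ * Complex.exp (-(ξ * x : ℝ) * Complex.I)) -
        ∫ ξ, ψ ξ * Complex.exp (-(ξ * x' : ℝ) * Complex.I)) := by
    intro x' hx'
    rw [smoothCdf_sub_sub hT P G hx', ← integral_sub (hexpi x) (hexpi x')]
    congr 1
    refine integral_congr_ae ?_
    filter_upwards [compl_mem_ae_iff.2 (measure_singleton (0 : ℝ))] with ξ hξ
    have hξ : (ξ : ℂ) ≠ 0 := by simpa using hξ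
    have e : ∫ u in x'..x, Complex.exp (-(ξ * u : ℝ) * Complex.I)
        = (Complex.exp (-(ξ * x : ℝ) * Complex.I) - Complex.exp (-(ξ * x' : ℝ) * Complex.I))
          / (-ξ * Complex.I) := by
      have e0 : ∀ u : ℝ, -((ξ * u : ℝ) : ℂ) * Complex.I = -ξ * Complex.I * u := by
        intro u; push_cast; ring
      simp_rw [e0]
      exact integral_exp_mul_complex (mul_ne_zero (neg_ne_zero.2 hξ) Complex.I_ne_zero)
    rw [e]
    simp only [hψ]
    field_simp
    rw [Complex.I_sq]
    ring
  -- Let x' → -∞ in the identity for increments: the left side loses its value at x', and the right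
  -- side loses its second integral by Riemann–Lebesgue.
  have hlim : Tendsto (fun x' => (((smoothCdf T P x - smoothCdf T G x) -
      (smoothCdf T P x' - smoothCdf T G x') : ℝ) : ℂ)) atBot
      (𝓝 (((smoothCdf T P x - smoothCdf T G x) - (0 - 0) : ℝ) : ℂ)) :=
    (Complex.continuous_ofReal.tendsto _).comp (tendsto_const_nhds.sub
      ((tendsto_smoothCdf_atBot hT P).sub (tendsto_smoothCdf_atBot hT G)))
  have hlim2 := ((tendsto_const_nhds (x := ∫ ξ, ψ ξ * Complex.exp (-(ξ * x : ℝ) * Complex.I))).sub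
    (tendsto_integral_exp_mul_atBot ψ)).const_mul ((1 / (2 * Real.pi) : ℝ) : ℂ)
  have heq := tendsto_nhds_unique (hlim.congr' ((eventually_le_atBot x).mono hmain)) hlim2
  have hn := congrArg norm heq
  rw [Complex.norm_real, Real.norm_eq_abs, norm_mul, Complex.norm_real, sub_zero, sub_zero,
    sub_zero, Real.norm_of_nonneg (by positivity)] at hn
  rw [hn]
  gcongr
  exact hexp x

lemma abs_cdf_sub_le_one (P G : Measure ℝ) [IsProbabilityMeasure P] [IsProbabilityMeasure G]
    (x : ℝ) : |P.real (Iic x) - G.real (Iic x)| ≤ 1 := by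
  have h1 : P.real (Iic x) ≤ 1 := measureReal_le_one
  have h2 : G.real (Iic x) ≤ 1 := measureReal_le_one
  have h3 : 0 ≤ P.real (Iic x) := measureReal_nonneg
  have h4 : 0 ≤ G.real (Iic x) := measureReal_nonneg
  rw [abs_le]; constructor <;> linarith

lemma abs_cdf_sub_le_kolmogorov (P G : Measure ℝ) [IsProbabilityMeasure P]
    [IsProbabilityMeasure G] (x : ℝ) :
    |P.real (Iic x) - G.real (Iic x)| ≤ kolmogorov P G :=
  le_ciSup (f := fun x => |P.real (Iic x) - G.real (Iic x)|)
    ⟨1, by rintro _ ⟨y, rfl⟩; exact abs_cdf_sub_le_one P G y⟩ x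

/-- The signed difference is at least c on the window [-a,a] and at least -Δ elsewhere, with Δ the
Kolmogorov distance. Averaging against a kernel of mass J on the window gives cJ - Δ(1 - J). -/
lemma le_mul_smoothCdf_sub {T a s c z : ℝ} (hT : 0 < T) (hs : |s| = 1) (P G : Measure ℝ)
    [IsProbabilityMeasure P] [IsProbabilityMeasure G]
    (h : ∀ v ∈ Icc (-a) a, c ≤ s * (P.real (Iic (z - v)) - G.real (Iic (z - v)))) :
    (c + kolmogorov P G) * (∫ v in Icc (-a) a, fejerScaled T v) - kolmogorov P G ≤
      s * (smoothCdf T P z - smoothCdf T G z) := by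
  set Δ := kolmogorov P G
  have hk := integrable_fejerScaled hT
  have e1 : (c + Δ) * (∫ v in Icc (-a) a, fejerScaled T v) - Δ
      = ∫ v, ((c + Δ) * (Icc (-a) a).indicator (fejerScaled T) v - Δ * fejerScaled T v) := by
    rw [integral_sub ((hk.indicator measurableSet_Icc).const_mul _) (hk.const_mul _),
      integral_const_mul, integral_const_mul, integral_fejerScaled hT,
      integral_indicator measurableSet_Icc, mul_one]
  have e2 : s * (smoothCdf T P z - smoothCdf T G z)
      = ∫ v, s * (P.real (Iic (z - v)) * fejerScaled T v - G.real (Iic (z - v)) * fejerScaled T v) := by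
    rw [integral_const_mul, integral_sub (integrable_smoothCdf hT P z) (integrable_smoothCdf hT G z)]
    rfl
  rw [e1, e2]
  refine integral_mono (((hk.indicator measurableSet_Icc).const_mul _).sub (hk.const_mul _))
    (((integrable_smoothCdf hT P z).sub (integrable_smoothCdf hT G z)).const_mul _) fun v => ?_
  have hk0 := fejerScaled_nonneg hT v
  have e3 : s * (P.real (Iic (z - v)) * fejerScaled T v - G.real (Iic (z - v)) * fejerScaled T v)
      = s * (P.real (Iic (z - v)) - G.real (Iic (z - v))) * fejerScaled T v := by ring
  simp only [e3]
  by_cases hv : v ∈ Icc (-a) a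
  · rw [indicator_of_mem hv, ← sub_mul]
    have := h v hv
    gcongr
    linarith
  · rw [indicator_of_notMem hv, mul_zero, zero_sub, ← neg_mul]
    gcongr
    have h1 := abs_cdf_sub_le_kolmogorov P G (z - v)
    have h2 : |s * (P.real (Iic (z - v)) - G.real (Iic (z - v)))| ≤ Δ := by
      rw [abs_mul, hs, one_mul]; exact h1
    exact (abs_le.1 h2).1

/-- Esseen's smoothing inequality with leading constant `κ / (2π)` for an arbitrary `κ > 1`. -/
theorem exists_smoothing_constant {κ : ℝ} (hκ : 1 < κ) :
    ∃ C : ℝ, 0 ≤ C ∧ ∀ (P G : Measure ℝ) (m T : ℝ), IsProbabilityMeasure P →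
      IsProbabilityMeasure G → 0 ≤ m → 0 < T →
      (∀ x y, x ≤ y → G.real (Ioc x y) ≤ m * (y - x)) →
      IntegrableOn (fun ξ : ℝ => ‖charFun P ξ - charFun G ξ‖ / |ξ|) (Icc (-T) T) →
      kolmogorov P G ≤
        κ / (2 * Real.pi) * (∫ ξ in Icc (-T) T, ‖charFun P ξ - charFun G ξ‖ / |ξ|)
          + C * m / T := by
  -- The kernel mass allowed outside the window. The final inequality has Δ(1 - 2τ) on its left, and
  -- 1 - 2τ = κ⁻¹.
  set τ := (1 - κ⁻¹) / 2 with hτ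
  have hκ0 : 0 < κ := by linarith
  have hκi : κ⁻¹ < 1 := inv_lt_one_of_one_lt₀ hκ
  have hκi0 : 0 < κ⁻¹ := by positivity
  have hτ0 : 0 < τ := by rw [hτ]; linarith
  obtain ⟨A, hA0, hA⟩ : ∃ A : ℝ, 0 < A ∧ 1 - τ ≤ ∫ v in (-A)..A, fejer v := by
    have h := intervalIntegral_tendsto_integral integrable_fejer tendsto_neg_atTop_atBot tendsto_id
    rw [integral_fejer] at h
    obtain ⟨A, h1, h2⟩ := ((h.eventually (lt_mem_nhds (show 1 - τ < 1 by linarith))).and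
      (eventually_gt_atTop 0)).exists
    exact ⟨A, h2, le_of_lt h1⟩
  refine ⟨2 * κ * A, by positivity, fun P G m T _ _ hm hT hG hint => ?_⟩
  set I := 1 / (2 * Real.pi) * ∫ ξ in Icc (-T) T, ‖charFun P ξ - charFun G ξ‖ / |ξ| with hI
  set Δ := kolmogorov P G with hΔ
  set a := A / T with ha
  have ha0 : 0 < a := by positivity
  set J := ∫ v in Icc (-a) a, fejerScaled T v with hJ
  have hJ1 : 1 - τ ≤ J := by
    have : J = ∫ v in (-A)..A, fejer v := by
      rw [hJ, integral_Icc_eq_integral_Ioc, ← intervalIntegral.integral_of_le (by linarith)]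
      simp only [fejerScaled]
      rw [intervalIntegral.integral_const_mul, intervalIntegral.integral_comp_mul_right _ hT.ne',
        smul_eq_mul, ← mul_assoc, mul_inv_cancel₀ hT.ne', one_mul, ha]
      congr 1 <;> field_simp
    rw [this]; exact hA
  have hΔ0 : 0 ≤ Δ := (abs_nonneg _).trans (abs_cdf_sub_le_kolmogorov P G 0)
  have hI0 : 0 ≤ I := by
    rw [hI]
    exact mul_nonneg (by positivity) (integral_nonneg fun ξ => by positivity)
  have hdiff : ∀ (Q : Measure ℝ), IsProbabilityMeasure Q → ∀ x y : ℝ, x ≤ y →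
      Q.real (Iic y) = Q.real (Iic x) + Q.real (Ioc x y) := by
    intro Q _ x y hxy
    rw [← Iic_union_Ioc_eq_Iic hxy, measureReal_union _ measurableSet_Ioc]
    exact Set.disjoint_left.2 fun x hx hx' => not_lt.2 hx hx'.1
  have key : ∀ x, |P.real (Iic x) - G.real (Iic x)| * (1 - τ) ≤ I + 2 * m * a + Δ * τ := by
    intro x
    set q := |P.real (Iic x) - G.real (Iic x)| with hq
    -- Shifting the centre by a to the appropriate side keeps the whole window on one side of x.
    -- There monotonicity of P preserves the sign of the deviation, and G moves by at most 2ma.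
    obtain ⟨s, hs, z, hz⟩ : ∃ s : ℝ, |s| = 1 ∧ ∃ z, ∀ v ∈ Icc (-a) a,
        q - 2 * m * a ≤ s * (P.real (Iic (z - v)) - G.real (Iic (z - v))) := by
      rcases le_total 0 (P.real (Iic x) - G.real (Iic x)) with h0 | h0
      · refine ⟨1, abs_one, x + a, fun v hv => ?_⟩
        have hx : x ≤ x + a - v := by linarith [hv.2]
        have h1 := hdiff P inferInstance x _ hx
        have h2 := hdiff G inferInstance x _ hx
        have h3 := hG x _ hx
        have h4 : 0 ≤ P.real (Ioc x (x + a - v)) := measureReal_nonneg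
        have h5 : m * (x + a - v - x) ≤ m * (2 * a) := by gcongr; linarith [hv.1]
        rw [hq, abs_of_nonneg h0]
        linarith
      · refine ⟨-1, by simp, x - a, fun v hv => ?_⟩
        have hx : x - a - v ≤ x := by linarith [hv.1]
        have h1 := hdiff P inferInstance _ _ hx
        have h2 := hdiff G inferInstance _ _ hx
        have h3 := hG _ _ hx
        have h4 : 0 ≤ P.real (Ioc (x - a - v) x) := measureReal_nonneg
        have h5 : m * (x - (x - a - v)) ≤ m * (2 * a) := by gcongr; linarith [hv.2]
        rw [hq, abs_of_nonpos h0]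
        linarith
    have h1 := le_mul_smoothCdf_sub hT hs P G hz
    have h2 : s * (smoothCdf T P z - smoothCdf T G z) ≤ I := by
      refine (le_abs_self _).trans ?_
      rw [abs_mul, hs, one_mul]
      exact abs_smoothCdf_sub_le hT P G hint z
    have hma : 0 ≤ m * a := by positivity
    have hτ1 : τ < 1 := by rw [hτ]; linarith
    -- The lower bound on J may only be multiplied by a nonnegative factor. If the factor is
    -- negative, then q ≤ 2ma and nothing remains to be proved.
    rcases le_or_gt 0 (q - 2 * m * a + Δ) with h3 | h3
    · have h4 := mul_le_mul_of_nonneg_left hJ1 h3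
      nlinarith
    · have h4 : q ≤ 2 * m * a := by linarith
      have h5 : 0 ≤ q := abs_nonneg _
      nlinarith
  have h1τ : 0 < 1 - τ := by rw [hτ]; linarith
  have hΔle : Δ ≤ (I + 2 * m * a + Δ * τ) / (1 - τ) :=
    ciSup_le fun x => (le_div_iff₀ h1τ).2 (key x)
  rw [le_div_iff₀ h1τ] at hΔle
  have h2 : Δ * κ⁻¹ ≤ I + 2 * m * a := by
    have : κ⁻¹ = 1 - 2 * τ := by rw [hτ]; ring
    rw [this]; linarith
  rw [← div_eq_mul_inv, div_le_iff₀ hκ0] at h2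
  refine h2.trans (le_of_eq ?_)
  rw [hI, ha]; field_simp

/-- A smoothing constant for `κ = 2` is admissible in the classical inequality. -/
lemma isBerryEsseenConstant_of_smoothing {C c : ℝ} (hCc : C ≤ c)
    (hC : ∀ (P G : Measure ℝ) (m T : ℝ), IsProbabilityMeasure P →
      IsProbabilityMeasure G → 0 ≤ m → 0 < T →
      (∀ x y, x ≤ y → G.real (Ioc x y) ≤ m * (y - x)) →
      IntegrableOn (fun ξ : ℝ => ‖charFun P ξ - charFun G ξ‖ / |ξ|) (Icc (-T) T) →
      kolmogorov P G ≤
        2 / (2 * Real.pi) * (∫ ξ in Icc (-T) T, ‖charFun P ξ - charFun G ξ‖ / |ξ|)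
          + C * m / T) : IsBerryEsseenConstant c := by
  intro P G _ _ G' m T hT hG hm hint
  have hm0 : 0 ≤ m := (abs_nonneg _).trans (hm 0)
  refine (hC P G m T inferInstance inferInstance hm0 hT (fun x y hxy => ?_) hint).trans ?_
  · have h1 : G.real (Ioc x y) = G.real (Iic y) - G.real (Iic x) := by
      rw [← Iic_union_Ioc_eq_Iic hxy, measureReal_union _ measurableSet_Ioc, add_sub_cancel_left]
      exact Set.disjoint_left.2 fun x hx hx' => not_lt.2 hx hx'.1
    rw [h1]
    have h2 := Convex.norm_image_sub_le_of_norm_hasDerivWithin_le (s := univ)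
      (f := fun y => G.real (Iic y)) (f' := G') (C := m)
      (fun x _ => (hG x).hasDerivWithinAt) (fun x _ => hm x) convex_univ (mem_univ x) (mem_univ y)
    rw [Real.norm_eq_abs, Real.norm_eq_abs, abs_of_nonneg (sub_nonneg.2 hxy)] at h2
    exact (le_abs_self _).trans h2
  · have : (2 : ℝ) / (2 * Real.pi) = 1 / Real.pi := by field_simp
    rw [this]
    gcongr

/-! ### The even part of a law -/

instance isProbabilityMeasure_evenPart (μ : Measure ℝ) [IsProbabilityMeasure μ] :
    IsProbabilityMeasure (evenPart μ) := by
  have := Measure.isProbabilityMeasure_map (μ := μ) (f := fun x : ℝ => -x) (by fun_prop)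
  constructor
  simp only [evenPart, Measure.smul_apply, Measure.add_apply, measure_univ, smul_eq_mul]
  rw [one_add_one_eq_two]
  exact ENNReal.inv_mul_cancel (by simp) (by simp)

lemma charFun_map_neg (μ : Measure ℝ) (ξ : ℝ) :
    charFun (μ.map (fun x => -x)) ξ = (starRingEnd ℂ) (charFun μ ξ) := by
  have := charFun_map_mul (μ := μ) (-1) ξ
  simp only [neg_mul, one_mul] at this
  rw [this, charFun_neg]

lemma integral_evenPart {μ : Measure ℝ} [IsProbabilityMeasure μ] {E : Type*}
    [NormedAddCommGroup E] [NormedSpace ℝ E] {f : ℝ → E} (hf : Continuous f) {C : ℝ}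
    (hC : ∀ x, ‖f x‖ ≤ C) :
    ∫ x, f x ∂(evenPart μ) = (2⁻¹ : ℝ) • ((∫ x, f x ∂μ) + ∫ x, f (-x) ∂μ) := by
  have := Measure.isProbabilityMeasure_map (μ := μ) (f := fun x : ℝ => -x) (by fun_prop)
  have hi : ∀ ν : Measure ℝ, IsProbabilityMeasure ν → Integrable f ν := fun ν _ =>
    Integrable.of_bound hf.aestronglyMeasurable C (Eventually.of_forall hC)
  rw [evenPart, integral_smul_measure, integral_add_measure (hi _ inferInstance) (hi _ inferInstance),
    integral_map (by fun_prop) hf.aestronglyMeasurable]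
  simp

lemma charFun_evenPart (μ : Measure ℝ) [IsProbabilityMeasure μ] (ξ : ℝ) :
    charFun (evenPart μ) ξ = ((charFun μ ξ).re : ℂ) := by
  have h1 : ∀ ν : Measure ℝ, charFun ν ξ = ∫ x, Complex.exp ((ξ * x : ℝ) * Complex.I) ∂ν := by
    intro ν; rw [charFun_apply_real]; simp
  have h2 := charFun_map_neg μ ξ
  rw [h1, integral_map (by fun_prop) (Continuous.aestronglyMeasurable (by fun_prop))] at h2
  rw [h1, integral_evenPart (C := 1) (by fun_prop)
    (fun x => by rw [Complex.norm_exp_ofReal_mul_I]), h2, ← h1 μ, Complex.add_conj]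
  simp

/-- A real characteristic function is invariant under conjugation, and characteristic functions
determine laws. -/
lemma evenPart_map_neg (μ : Measure ℝ) [IsProbabilityMeasure μ] :
    (evenPart μ).map (fun x => -x) = evenPart μ := by
  have := Measure.isProbabilityMeasure_map (μ := evenPart μ) (f := fun x : ℝ => -x) (by fun_prop)
  refine Measure.ext_of_charFun (funext fun ξ => ?_)
  rw [charFun_map_neg, charFun_evenPart, Complex.conj_ofReal]

lemma re_charFun (μ : Measure ℝ) [IsProbabilityMeasure μ] (ξ : ℝ) :
    (charFun μ ξ).re = ∫ x, Real.cos (ξ * x) ∂μ := by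
  rw [charFun_apply_real, ← RCLike.re_eq_complex_re, ← integral_re]
  · congr 1 with x
    rw [← Complex.ofReal_mul, RCLike.re_eq_complex_re, Complex.exp_ofReal_mul_I_re]
  · refine Integrable.of_bound (Continuous.aestronglyMeasurable (by fun_prop)) 1
      (Eventually.of_forall fun x => ?_)
    rw [← Complex.ofReal_mul, Complex.norm_exp_ofReal_mul_I]

lemma integrable_one_sub_cos (μ : Measure ℝ) [IsFiniteMeasure μ] (ξ : ℝ) :
    Integrable (fun x => 1 - Real.cos (ξ * x)) μ := by
  refine Integrable.of_bound (Continuous.aestronglyMeasurable (by fun_prop)) 2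
    (Eventually.of_forall fun x => ?_)
  rw [Real.norm_eq_abs, abs_le]
  constructor <;> linarith [Real.cos_le_one (ξ * x), Real.neg_one_le_cos (ξ * x)]

lemma one_sub_re_charFun (μ : Measure ℝ) [IsProbabilityMeasure μ] (ξ : ℝ) :
    1 - (charFun μ ξ).re = ∫ x, (1 - Real.cos (ξ * x)) ∂μ := by
  rw [re_charFun, integral_sub (integrable_const _)]
  · simp
  · refine Integrable.of_bound (Continuous.aestronglyMeasurable (by fun_prop)) 1
      (Eventually.of_forall fun x => Real.abs_cos_le_one _)

/-- The integrand and the even part are symmetric, and a possible atom at 0 contributes nothing.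
Only the tail on (0,∞), which is what S* describes, then matters. -/
lemma one_sub_re_charFun_evenPart (μ : Measure ℝ) [IsProbabilityMeasure μ] (ξ : ℝ) :
    1 - (charFun μ ξ).re = 2 * ∫ x in Ioi 0, (1 - Real.cos (ξ * x)) ∂(evenPart μ) := by
  have h1 : 1 - (charFun μ ξ).re = ∫ x, (1 - Real.cos (ξ * x)) ∂(evenPart μ) := by
    rw [← one_sub_re_charFun, charFun_evenPart, Complex.ofReal_re]
  have hi := integrable_one_sub_cos (evenPart μ) ξ
  have h2 : ∫ x in Iio 0, (1 - Real.cos (ξ * x)) ∂(evenPart μ)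
      = ∫ x in Ioi 0, (1 - Real.cos (ξ * x)) ∂(evenPart μ) := by
    conv_lhs => rw [← evenPart_map_neg μ]
    rw [setIntegral_map measurableSet_Iio (Continuous.aestronglyMeasurable (by fun_prop))
      (by fun_prop)]
    simp
  have h3 : ∫ x in Iic 0, (1 - Real.cos (ξ * x)) ∂(evenPart μ)
      = ∫ x in Iio 0, (1 - Real.cos (ξ * x)) ∂(evenPart μ) := by
    refine setIntegral_eq_of_subset_of_forall_sdiff_eq_zero measurableSet_Iic
      Iio_subset_Iic_self fun x hx => ?_
    have : x = 0 := le_antisymm hx.1 (not_lt.1 hx.2)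
    simp [this]
  rw [h1, ← setIntegral_univ, ← Iic_union_Ioi (a := (0 : ℝ)),
    setIntegral_union (Iic_disjoint_Ioi le_rfl) measurableSet_Ioi hi.integrableOn hi.integrableOn,
    h3, h2]
  ring

/-! ### The Lévy integral -/

lemma one_sub_cos_le_sq (x : ℝ) : 1 - Real.cos x ≤ x ^ 2 / 2 := by
  linarith [Real.one_sub_sq_div_two_le_cos (x := x)]

/-- Near 0 the bound 1 - cos(ξy) ≤ (ξy)²/2 requires α < 2; at infinity the bound 2 requires α > 0.
-/
lemma integrableOn_one_sub_cos_rpow {α : ℝ} (h0 : 0 < α) (h2 : α < 2) (ξ : ℝ) :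
    IntegrableOn (fun y : ℝ => (1 - Real.cos (ξ * y)) * (α * y ^ (-α - 1))) (Ioi 0) := by
  have hm : ∀ s, AEStronglyMeasurable (fun y : ℝ => (1 - Real.cos (ξ * y)) * (α * y ^ (-α - 1)))
      (volume.restrict s) := fun s => Measurable.aestronglyMeasurable (by fun_prop)
  have hpos : ∀ y : ℝ, 0 < y → 0 ≤ (1 - Real.cos (ξ * y)) * (α * y ^ (-α - 1)) := fun y hy =>
    mul_nonneg (by linarith [Real.cos_le_one (ξ * y)]) (by positivity)
  rw [← Ioc_union_Ioi_eq_Ioi zero_le_one]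
  refine IntegrableOn.union ?_ ?_
  · have hi : IntegrableOn (fun y : ℝ => ξ ^ 2 / 2 * α * y ^ (1 - α)) (Ioc 0 1) := by
      refine Integrable.const_mul ?_ _
      exact (intervalIntegrable_iff_integrableOn_Ioc_of_le zero_le_one).1
        (intervalIntegral.intervalIntegrable_rpow' (by linarith))
    refine hi.mono' (hm _) ?_
    refine (ae_restrict_iff' measurableSet_Ioc).2 (Eventually.of_forall fun y hy => ?_)
    rw [Real.norm_eq_abs, abs_of_nonneg (hpos y hy.1)]
    have e : y ^ (1 - α) = y ^ 2 * y ^ (-α - 1) := by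
      rw [← Real.rpow_natCast, ← Real.rpow_add hy.1]; congr 1; push_cast; ring
    have : 0 ≤ α * y ^ (-α - 1) := by have := hy.1; positivity
    calc (1 - Real.cos (ξ * y)) * (α * y ^ (-α - 1))
        ≤ ((ξ * y) ^ 2 / 2) * (α * y ^ (-α - 1)) := by
          gcongr; exact one_sub_cos_le_sq _
      _ = _ := by rw [e]; ring
  · have hi : IntegrableOn (fun y : ℝ => 2 * α * y ^ (-α - 1)) (Ioi 1) :=
      (integrableOn_Ioi_rpow_of_lt (by linarith) one_pos).const_mul _
    refine hi.mono' (hm _) ?_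
    refine (ae_restrict_iff' measurableSet_Ioi).2 (Eventually.of_forall fun y hy => ?_)
    have hy0 : 0 < y := one_pos.trans hy
    rw [Real.norm_eq_abs, abs_of_nonneg (hpos y hy0), mul_assoc]
    gcongr
    linarith [Real.neg_one_le_cos (ξ * y)]

/-- The constant `∫₀^∞ (1 - cos y) α y^{-α-1} dy`. -/
noncomputable def levyConst (α : ℝ) : ℝ :=
  ∫ y in Ioi (0 : ℝ), (1 - Real.cos y) * (α * y ^ (-α - 1))

lemma integral_levy {α ξ : ℝ} (hξ : 0 < ξ) :
    ∫ y in Ioi (0 : ℝ), (1 - Real.cos (ξ * y)) * (α * y ^ (-α - 1)) = ξ ^ α * levyConst α := by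
  have h := integral_comp_mul_left_Ioi' (fun y => (1 - Real.cos y) * (α * y ^ (-α - 1))) 0 hξ
  rw [mul_zero] at h
  rw [levyConst, ← h, smul_eq_mul, ← integral_const_mul, ← integral_const_mul]
  refine setIntegral_congr_fun measurableSet_Ioi fun y hy => ?_
  have hy : 0 < y := hy
  rw [Real.mul_rpow hξ.le hy.le]
  have : ξ ^ α * ξ * ξ ^ (-α - 1) = 1 := by
    rw [← Real.rpow_add_one hξ.ne', ← Real.rpow_add hξ]; simp
  linear_combination (-(1 - Real.cos (ξ * y)) * α * y ^ (-α - 1)) * this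

lemma levyConst_pos {α : ℝ} (h0 : 0 < α) (h2 : α < 2) : 0 < levyConst α := by
  have hint := integrableOn_one_sub_cos_rpow h0 h2 1
  simp only [one_mul] at hint
  rw [levyConst, setIntegral_pos_iff_support_of_nonneg_ae _ hint]
  · refine lt_of_lt_of_le ?_ (measure_mono (show Ioo (0 : ℝ) 1 ⊆ _ from ?_))
    · simp
    · intro y hy
      refine ⟨?_, hy.1⟩
      have h1 : Real.cos y < 1 := by
        have := Real.cos_lt_cos_of_nonneg_of_le_pi le_rfl (by linarith [Real.pi_gt_three, hy.2]) hy.1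
        simpa using this
      have := hy.1
      exact (mul_pos (by linarith) (by positivity)).ne'
  · refine (ae_restrict_iff' measurableSet_Ioi).2 (Eventually.of_forall fun y hy => ?_)
    have hy : 0 < y := hy
    exact mul_nonneg (by linarith [Real.cos_le_one y]) (by positivity)

/-- Integration by parts with boundary term (1 - cos x)x^{-α}, which vanishes at 0 since α < 2 and
at infinity since α > 0. It identifies the improper integral in `scaleA` with an absolutely
convergent one. -/
lemma tendsto_integral_sin_div_rpow {α : ℝ} (h0 : 0 < α) (h2 : α < 2) :
    Tendsto (fun R : ℝ => ∫ x in (0 : ℝ)..R, Real.sin x / x ^ α) atTop (𝓝 (levyConst α)) := by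
  have hint := integrableOn_one_sub_cos_rpow h0 h2 1
  simp only [one_mul] at hint
  have hsin : ∀ R : ℝ, 0 < R → IntervalIntegrable (fun x : ℝ => Real.sin x / x ^ α) volume 0 R := by
    intro R hR
    have hi : IntegrableOn (fun y : ℝ => y ^ (1 - α)) (Ioc 0 R) :=
      (intervalIntegrable_iff_integrableOn_Ioc_of_le hR.le).1
        (intervalIntegral.intervalIntegrable_rpow' (by linarith))
    rw [intervalIntegrable_iff_integrableOn_Ioc_of_le hR.le]
    refine hi.mono' (Measurable.aestronglyMeasurable (by fun_prop)) ?_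
    refine (ae_restrict_iff' measurableSet_Ioc).2 (Eventually.of_forall fun y hy => ?_)
    have hy0 := hy.1
    rw [norm_div, Real.norm_eq_abs, Real.norm_of_nonneg (by positivity), Real.rpow_sub hy0,
      Real.rpow_one]
    gcongr
    simpa [abs_of_pos hy0] using Real.abs_sin_le_abs (x := y)
  set H : ℝ → ℝ := fun x => (1 - Real.cos x) * x ^ (-α) with hH
  have hHb : ∀ x : ℝ, 0 ≤ x → |H x| ≤ x ^ (2 - α) := by
    intro x hx
    rcases hx.eq_or_lt with rfl | hx
    · simp [hH, Real.zero_rpow (by linarith : (2 : ℝ) - α ≠ 0)]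
    · have : x ^ (2 - α) = x ^ 2 * x ^ (-α) := by
        rw [← Real.rpow_natCast, ← Real.rpow_add hx]; congr 1
      simp only [hH]
      rw [this, abs_of_nonneg (mul_nonneg (by linarith [Real.cos_le_one x]) (by positivity))]
      gcongr
      nlinarith [one_sub_cos_le_sq x]
  have hparts : ∀ R : ℝ, 0 < R → ∫ x in (0 : ℝ)..R, Real.sin x / x ^ α
      = H R + ∫ y in (0 : ℝ)..R, (1 - Real.cos y) * (α * y ^ (-α - 1)) := by
    intro R hR
    have hi2 : IntervalIntegrable (fun y : ℝ => (1 - Real.cos y) * (α * y ^ (-α - 1))) volume 0 R := by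
      rw [intervalIntegrable_iff_integrableOn_Ioc_of_le hR.le]
      exact hint.mono_set Ioc_subset_Ioi_self
    have hcont : ContinuousOn H (Icc 0 R) := by
      intro x hx
      rcases hx.1.eq_or_lt with rfl | hx0
      · have hH0 : H 0 = 0 := by simp [hH]
        rw [ContinuousWithinAt, hH0]
        have ht : Tendsto (fun x : ℝ => x ^ (2 - α)) (𝓝[Icc 0 R] 0) (𝓝 0) := by
          have := (Real.continuousAt_rpow_const 0 (2 - α) (Or.inr (by linarith))).tendsto
          rw [Real.zero_rpow (by linarith)] at this
          exact this.mono_left nhdsWithin_le_nhds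
        refine squeeze_zero_norm' ?_ ht
        filter_upwards [self_mem_nhdsWithin] with x hx using hHb x hx.1
      · refine ContinuousAt.continuousWithinAt ?_
        exact (by fun_prop : ContinuousAt (fun x => 1 - Real.cos x) x).mul
          (Real.continuousAt_rpow_const x _ (Or.inl hx0.ne'))
    have hd : ∀ x ∈ Ioo 0 R, HasDerivAt H
        (Real.sin x / x ^ α - (1 - Real.cos x) * (α * x ^ (-α - 1))) x := by
      intro x hx
      have e := ((Real.hasDerivAt_cos x).const_sub 1).mul
        (Real.hasDerivAt_rpow_const (x := x) (p := -α) (Or.inl hx.1.ne'))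
      refine e.congr_deriv ?_
      rw [Real.rpow_neg hx.1.le]
      field_simp
      ring
    have := intervalIntegral.integral_eq_sub_of_hasDerivAt_of_le hR.le hcont hd
      ((hsin R hR).sub hi2)
    rw [intervalIntegral.integral_sub (hsin R hR) hi2] at this
    have hH0 : H 0 = 0 := by simp [hH]
    linarith
  have hlim := intervalIntegral_tendsto_integral_Ioi 0 hint tendsto_id
  have hH : Tendsto H atTop (𝓝 0) := by
    have ht : Tendsto (fun x : ℝ => 2 * x ^ (-α)) atTop (𝓝 (2 * 0)) :=
      (tendsto_rpow_neg_atTop h0).const_mul 2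
    rw [mul_zero] at ht
    refine squeeze_zero_norm' ?_ ht
    filter_upwards [eventually_gt_atTop 0] with x hx
    simp only [hH]
    rw [Real.norm_eq_abs, abs_of_nonneg (mul_nonneg (by linarith [Real.cos_le_one x]) (by positivity))]
    gcongr
    linarith [Real.neg_one_le_cos x]
  have := hH.add hlim
  rw [zero_add] at this
  refine this.congr' ?_
  filter_upwards [eventually_gt_atTop 0] with R hR using (hparts R hR).symm

lemma scaleA_eq {α : ℝ} (h0 : 0 < α) (h2 : α < 2) (c₀ : ℝ) :
    scaleA c₀ α = 2 * c₀ * levyConst α := by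
  rw [scaleA, (tendsto_integral_sin_div_rpow h0 h2).limUnder_eq]

/-! ### Existence of the symmetric stable law -/

lemma exists_charFun_pow (ν : Measure ℝ) [IsProbabilityMeasure ν] (n : ℕ) :
    ∃ Q : ProbabilityMeasure ℝ, ∀ ξ, charFun (Q : Measure ℝ) ξ = charFun ν ξ ^ n := by
  induction n with
  | zero => exact ⟨⟨Measure.dirac 0, inferInstance⟩, fun ξ => by simp⟩
  | succ n ih =>
    obtain ⟨Q, hQ⟩ := ih
    exact ⟨⟨(Q : Measure ℝ) ∗ ν, inferInstance⟩, fun ξ => by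
      rw [ProbabilityMeasure.coe_mk, charFun_conv, hQ, pow_succ]⟩

/-- A pointwise limit of characteristic functions that is continuous at `0` is a characteristic
function. -/
lemma exists_charFun_eq_of_tendsto (Q : ℕ → ProbabilityMeasure ℝ) {f : ℝ → ℂ}
    (hf : ContinuousAt f 0)
    (h : ∀ ξ, Tendsto (fun n => charFun (Q n : Measure ℝ) ξ) atTop (𝓝 (f ξ))) :
    ∃ G : ProbabilityMeasure ℝ, ∀ ξ, charFun (G : Measure ℝ) ξ = f ξ := by
  have ht : IsTightMeasureSet (range fun n => (Q n : Measure ℝ)) :=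
    isTightMeasureSet_of_tendsto_charFun hf h
  have hc : IsCompact (closure (range Q)) := by
    refine isCompact_closure_of_isTightMeasureSet ?_
    convert ht using 1
    ext μ
    simp
  -- Any cluster point will do. A nonprincipal ultrafilter selects one without extracting a
  -- subsequence, and the pointwise limit of the characteristic functions survives along it.
  obtain ⟨G, -, hG⟩ := isCompact_iff_ultrafilter_le_nhds.1 hc ((hyperfilter ℕ).map Q) (by
    rw [le_principal_iff]
    exact mem_of_superset (Filter.range_mem_map) subset_closure)
  refine ⟨G, fun ξ => ?_⟩
  have hG' : Tendsto Q (hyperfilter ℕ : Filter ℕ) (𝓝 G) := hG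
  rw [ProbabilityMeasure.tendsto_iff_forall_integral_rclike_tendsto ℂ] at hG'
  have h1 := hG' (BoundedContinuousFunction.innerProbChar ξ)
  simp_rw [← charFun_eq_integral_innerProbChar] at h1
  exact tendsto_nhds_unique h1 ((h ξ).mono_left Nat.hyperfilter_le_atTop)

lemma integral_paretoMeasure {α : ℝ} (h0 : 0 < α) (f : ℝ → ℝ) :
    ∫ x, f x ∂(paretoMeasure 1 α) = ∫ y in Ioi (1 : ℝ), f y * (α * y ^ (-α - 1)) := by
  have h1 : ∫ x, f x ∂(paretoMeasure 1 α) = ∫ x, paretoPDFReal 1 α x • f x := by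
    rw [paretoMeasure]
    have : paretoPDF 1 α = fun x => ((Real.toNNReal (paretoPDFReal 1 α x) : NNReal) : ENNReal) := rfl
    rw [this, integral_withDensity_eq_integral_smul
      (measurable_paretoPDFReal 1 α).real_toNNReal]
    congr 1 with x
    rw [NNReal.smul_def, Real.coe_toNNReal _ (paretoPDFReal_nonneg zero_le_one h0.le x)]
  rw [h1, ← integral_Ici_eq_integral_Ioi, ← integral_indicator measurableSet_Ici]
  congr 1 with x
  by_cases hx : (1 : ℝ) ≤ x
  · rw [indicator_of_mem (show x ∈ Ici (1 : ℝ) from hx), paretoPDFReal, if_pos hx, smul_eq_mul,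
      Real.one_rpow, neg_add']
    ring
  · rw [indicator_of_notMem (show x ∉ Ici (1 : ℝ) from hx), paretoPDFReal, if_neg hx, zero_smul]

/-- The Pareto law is the Lévy measure αy^{-α-1}dy cut off below 1. The missing piece on (0,1] costs
only O(ξ²), negligible against ξ^α because α < 2. -/
lemma abs_one_sub_re_charFun_pareto_sub_le {α : ℝ} (h0 : 0 < α) (h2 : α < 2) {ξ : ℝ} (hξ : 0 < ξ) :
    |1 - (charFun (paretoMeasure 1 α) ξ).re - ξ ^ α * levyConst α| ≤
      ξ ^ 2 * (α / (2 * (2 - α))) := by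
  have := isProbabilityMeasure_paretoMeasure one_pos h0
  have hint := integrableOn_one_sub_cos_rpow h0 h2 ξ
  have hint1 := hint.mono_set (show Ioc (0 : ℝ) 1 ⊆ Ioi 0 from Ioc_subset_Ioi_self)
  rw [one_sub_re_charFun, integral_paretoMeasure h0, ← integral_levy hξ,
    ← Ioc_union_Ioi_eq_Ioi (zero_le_one (α := ℝ)), setIntegral_union (Ioc_disjoint_Ioi le_rfl) measurableSet_Ioi
      hint1 (hint.mono_set (Ioi_subset_Ioi zero_le_one))]
  have hnn : 0 ≤ ∫ y in Ioc (0 : ℝ) 1, (1 - Real.cos (ξ * y)) * (α * y ^ (-α - 1)) := by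
    refine setIntegral_nonneg measurableSet_Ioc fun y hy => ?_
    have := hy.1
    exact mul_nonneg (by linarith [Real.cos_le_one (ξ * y)]) (by positivity)
  rw [sub_add_cancel_right, abs_neg, abs_of_nonneg hnn]
  have hi : IntegrableOn (fun y : ℝ => ξ ^ 2 * (α / 2 * y ^ (1 - α))) (Ioc 0 1) := by
    refine (Integrable.const_mul ?_ _).const_mul _
    exact (intervalIntegrable_iff_integrableOn_Ioc_of_le zero_le_one).1
      (intervalIntegral.intervalIntegrable_rpow' (by linarith))
  refine (setIntegral_mono_on hint1 hi measurableSet_Ioc fun y hy => ?_).trans (le_of_eq ?_)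
  · have hy0 := hy.1
    have e : y ^ (1 - α) = y ^ 2 * y ^ (-α - 1) := by
      rw [← Real.rpow_natCast, ← Real.rpow_add hy.1]; congr 1; push_cast; ring
    calc (1 - Real.cos (ξ * y)) * (α * y ^ (-α - 1))
        ≤ ((ξ * y) ^ 2 / 2) * (α * y ^ (-α - 1)) := by
          gcongr; exact one_sub_cos_le_sq _
      _ = _ := by rw [e]; ring
  · rw [integral_const_mul, integral_const_mul, ← intervalIntegral.integral_of_le zero_le_one,
      integral_rpow (Or.inl (by linarith))]
    rw [Real.one_rpow, Real.zero_rpow (by linarith)]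
    have : 2 - α ≠ 0 := by linarith
    rw [show 1 - α + 1 = 2 - α by ring]
    field_simp
    ring

/-- The symmetric stable law of index `α ∈ (0,2)` exists. -/
theorem exists_isStableLaw {a α : ℝ} (ha : 0 < a) (h0 : 0 < α) (h2 : α < 2) :
    ∃ G : Measure ℝ, IsStableLaw a α G := by
  have := isProbabilityMeasure_paretoMeasure one_pos h0
  set C := levyConst α
  have hC : 0 < C := levyConst_pos h0 h2
  set r : ℝ → ℝ := fun ξ => (charFun (paretoMeasure 1 α) ξ).re with hr
  -- The scale is fixed by n c_n^α C = a, so the n-fold convolution of the scaled symmetrized Pareto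
  -- law has exponent tending to -a|ξ|^α.
  set c : ℕ → ℝ := fun n => (a / (C * n)) ^ (1 / α) with hc
  have hQ : ∀ n : ℕ, ∃ Q : ProbabilityMeasure ℝ, ∀ ξ, charFun (Q : Measure ℝ) ξ
      = ((r (c n * ξ) ^ n : ℝ) : ℂ) := by
    intro n
    have := Measure.isProbabilityMeasure_map (μ := evenPart (paretoMeasure 1 α))
      (f := fun x : ℝ => c n * x) (by fun_prop)
    obtain ⟨Q, hQ⟩ := exists_charFun_pow ((evenPart (paretoMeasure 1 α)).map (fun x => c n * x)) n
    refine ⟨Q, fun ξ => ?_⟩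
    rw [hQ, charFun_map_mul, charFun_evenPart, Complex.ofReal_pow]
  choose Q hQ using hQ
  have hreven : ∀ ξ, r (-ξ) = r ξ := fun ξ => by simp [hr, charFun_neg]
  have hlim : ∀ ξ : ℝ, Tendsto (fun n : ℕ => r (c n * ξ) ^ n) atTop (𝓝 (Real.exp (-(a * |ξ| ^ α)))) := by
    have hpos : ∀ ξ : ℝ, 0 < ξ →
        Tendsto (fun n : ℕ => r (c n * ξ) ^ n) atTop (𝓝 (Real.exp (-(a * |ξ| ^ α)))) := by
      intro ξ hξ
      have key : Tendsto (fun n : ℕ => (n : ℝ) * (r (c n * ξ) - 1)) atTop (𝓝 (-(a * |ξ| ^ α))) := by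
        rw [abs_of_pos hξ]
        -- The quadratic error is of order n c_n², that is n^{1-2/α}.
        have hz : Tendsto (fun n : ℕ => (a / C) ^ (2 / α) * ξ ^ 2 * (α / (2 * (2 - α))) *
            (n : ℝ) ^ (-(2 / α - 1))) atTop (𝓝 0) := by
          have h1 : 0 < 2 / α - 1 := by rw [sub_pos, lt_div_iff₀ h0]; linarith
          have := ((tendsto_rpow_neg_atTop h1).comp tendsto_natCast_atTop_atTop).const_mul
            ((a / C) ^ (2 / α) * ξ ^ 2 * (α / (2 * (2 - α))))
          rwa [mul_zero] at this
        rw [tendsto_iff_norm_sub_tendsto_zero]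
        refine squeeze_zero' (Eventually.of_forall fun n => norm_nonneg _) ?_ hz
        filter_upwards [eventually_gt_atTop 0] with n hn
        have hn0 : (0 : ℝ) < n := by exact_mod_cast hn
        have hcn : 0 < c n := by simp only [hc]; positivity
        have hb := abs_one_sub_re_charFun_pareto_sub_le h0 h2 (mul_pos hcn hξ)
        have e1 : c n ^ α = a / (C * n) := by
          simp only [hc]; rw [← Real.rpow_mul (by positivity)]; simp [h0.ne']
        have e2 : c n ^ 2 = (a / C) ^ (2 / α) * (n : ℝ) ^ (-(2 / α)) := by
          simp only [hc]
          rw [← Real.rpow_natCast, ← Real.rpow_mul (by positivity), Real.rpow_neg hn0.le,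
            ← div_eq_mul_inv, ← Real.div_rpow (by positivity) hn0.le, div_div]
          congr 1
          push_cast; ring
        rw [Real.mul_rpow hcn.le hξ.le, e1] at hb
        have e3 : (n : ℝ) * (r (c n * ξ) - 1) - -(a * ξ ^ α)
            = -(n * (1 - r (c n * ξ) - a / (C * n) * ξ ^ α * C)) := by
          field_simp
          ring
        rw [e3, norm_neg, Real.norm_eq_abs, abs_mul, abs_of_pos hn0]
        refine (mul_le_mul_of_nonneg_left hb hn0.le).trans (le_of_eq ?_)
        rw [mul_pow, e2, show -(2 / α - 1) = -(2 / α) + 1 by ring, Real.rpow_add hn0, Real.rpow_one]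
        ring
      have := Real.tendsto_one_add_pow_exp_of_tendsto key
      simpa using this
    intro ξ
    rcases lt_trichotomy ξ 0 with h | rfl | h
    · have := hpos (-ξ) (by linarith)
      simpa [hreven] using this
    · have : r 0 = 1 := by simp [hr]
      simp [this, Real.zero_rpow h0.ne']
    · exact hpos ξ h
  obtain ⟨G, hG⟩ := exists_charFun_eq_of_tendsto Q
    (f := fun ξ => ((Real.exp (-(a * |ξ| ^ α)) : ℝ) : ℂ))
    (by
      refine Continuous.continuousAt (Complex.continuous_ofReal.comp ?_)
      have : Continuous fun ξ : ℝ => |ξ| ^ α := continuous_abs.rpow_const fun _ => Or.inr h0.le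
      fun_prop)
    (fun ξ => by
      simp_rw [hQ]
      exact (Complex.continuous_ofReal.tendsto _).comp (hlim ξ))
  exact ⟨G, inferInstance, hG⟩

lemma isStableLaw_stableLaw {a α : ℝ} (ha : 0 < a) (h0 : 0 < α) (h2 : α < 2) :
    IsStableLaw a α (stableLaw a α) := by
  have h := exists_isStableLaw ha h0 h2
  rw [stableLaw, dif_pos h]
  exact h.choose_spec

/-! ### Concentration bound for the stable law -/

lemma integrableOn_exp_neg_mul_rpow {a α : ℝ} (ha : 0 < a) (h0 : 0 < α) :
    IntegrableOn (fun ξ : ℝ => Real.exp (-(a * ξ ^ α))) (Ioi 0) := by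
  have := integrableOn_rpow_mul_exp_neg_mul_rpow (s := 0) (by norm_num) h0 ha
  simpa using this

/-- Interval masses are bounded below through g(0), whereas the final estimate contains the supremum
norm. The supremum is genuine because |cos| ≤ 1 bounds the whole family. -/
lemma stableDensity_zero_le {a α : ℝ} (ha : 0 < a) (h0 : 0 < α) :
    stableDensity a α 0 ≤ stableDensityNorm a α := by
  have hi := integrableOn_exp_neg_mul_rpow ha h0
  refine (le_abs_self _).trans (le_ciSup (f := fun x => |stableDensity a α x|)
    ⟨(1 / Real.pi) * ∫ ξ in Ioi (0 : ℝ), Real.exp (-(a * ξ ^ α)), ?_⟩ 0)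
  rintro _ ⟨x, rfl⟩
  simp only [stableDensity]
  rw [abs_mul, abs_of_pos (by positivity : 0 < 1 / Real.pi)]
  gcongr
  rw [← Real.norm_eq_abs]
  refine norm_integral_le_of_norm_le hi (Eventually.of_forall fun ξ => ?_)
  rw [norm_mul, Real.norm_of_nonneg (Real.exp_pos _).le]
  exact mul_le_of_le_one_left (Real.exp_pos _).le (Real.abs_cos_le_one _)

lemma integrable_comp_abs_of_integrableOn {f : ℝ → ℝ} (hf : IntegrableOn f (Ioi 0)) :
    Integrable fun x => f |x| := by
  have h1 : IntegrableOn (fun x => f |x|) (Ioi 0) :=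
    hf.congr_fun (fun x hx => by simp only [abs_of_pos (show 0 < x from hx)]) measurableSet_Ioi
  have h2 : IntegrableOn (fun x => f |x|) (Iic 0) := by
    have m : MeasurableEmbedding fun x : ℝ => -x := (Homeomorph.neg ℝ).measurableEmbedding
    rw [← Measure.map_neg_eq_self (volume : Measure ℝ), m.integrableOn_map_iff]
    simpa [Function.comp_def] using Iff.mpr integrableOn_Ici_iff_integrableOn_Ioi h1
  have h3 := h2.union h1
  rwa [Iic_union_Ioi, integrableOn_univ] at h3

lemma integral_Icc_fejerScaled {T a : ℝ} (hT : 0 < T) (ha : 0 ≤ a) :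
    ∫ v in Icc (-a) a, fejerScaled T v = ∫ v in (-(a * T))..(a * T), fejer v := by
  rw [integral_Icc_eq_integral_Ioc, ← intervalIntegral.integral_of_le (by linarith)]
  simp only [fejerScaled]
  rw [intervalIntegral.integral_const_mul, intervalIntegral.integral_comp_mul_right _ hT.ne',
    smul_eq_mul, ← mul_assoc, mul_inv_cancel₀ hT.ne', one_mul, neg_mul]

/-- The stable law charges an interval by at most `g(0)` times its length. -/
lemma IsStableLaw.real_Ioc_le {a α : ℝ} (ha : 0 < a) (h0 : 0 < α) {G : Measure ℝ}
    (hG : IsStableLaw a α G) {x y : ℝ} (hxy : x ≤ y) :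
    G.real (Ioc x y) ≤ stableDensity a α 0 * (y - x) := by
  have := hG.1
  set g := stableDensity a α 0 with hg
  have hi := integrableOn_exp_neg_mul_rpow ha h0
  have hgeq : g = 1 / (2 * Real.pi) * ∫ ξ, Real.exp (-(a * |ξ| ^ α)) := by
    rw [hg, stableDensity, integral_comp_abs (f := fun ξ => Real.exp (-(a * ξ ^ α)))]
    simp only [mul_zero, Real.cos_zero, one_mul]
    field_simp
  have hi2 : Integrable fun ξ : ℝ => Real.exp (-(a * |ξ| ^ α)) :=
    integrable_comp_abs_of_integrableOn (f := fun ξ : ℝ => Real.exp (-(a * ξ ^ α))) hi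
  -- The smoothed density is a Fourier integral whose modulus is dominated by that of the positive
  -- characteristic function, hence by g(0), uniformly in T.
  have hdens : ∀ T : ℝ, 0 < T → ∀ u, ∫ z, fejerScaled T (u - z) ∂G ≤ g := by
    intro T hT u
    have h1 := congrArg norm (integral_fejerScaled_sub hT G u)
    rw [Complex.norm_real, norm_mul, Complex.norm_real,
      Real.norm_of_nonneg (by positivity : (0 : ℝ) ≤ 1 / (2 * Real.pi))] at h1
    refine (le_abs_self _).trans (h1.le.trans ?_)
    rw [hgeq]
    gcongr
    refine norm_integral_le_of_norm_le hi2 (Eventually.of_forall fun ξ => ?_)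
    rw [norm_mul, norm_mul, ← Complex.ofReal_neg, Complex.norm_exp_ofReal_mul_I, one_mul,
      hG.2, Complex.norm_real, Complex.norm_real, Real.norm_of_nonneg (triangle_nonneg _),
      Real.norm_of_nonneg (Real.exp_pos _).le]
    exact mul_le_of_le_one_left (Real.exp_pos _).le (triangle_le_one _)
  have hdiff : G.real (Iic y) = G.real (Iic x) + G.real (Ioc x y) := by
    rw [← Iic_union_Ioc_eq_Iic hxy, measureReal_union _ measurableSet_Ioc]
    exact Set.disjoint_left.2 fun x hx hx' => not_lt.2 hx hx'.1
  -- Compare the mass of (x,y] with the smoothed mass of (x-ε,y+ε]; the kernel mass outside [-ε,ε]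
  -- is the error. Letting T → ∞ and then ε → 0 avoids proving that G has a density.
  have hstep : ∀ ε : ℝ, 0 < ε → ∀ T : ℝ, 0 < T →
      (∫ v in (-(ε * T))..(ε * T), fejer v) * G.real (Ioc x y) ≤
        g * (y - x + 2 * ε) + (1 - ∫ v in (-(ε * T))..(ε * T), fejer v) := by
    intro ε hε T hT
    rw [← integral_Icc_fejerScaled hT hε.le]
    set J := ∫ v in Icc (-ε) ε, fejerScaled T v
    have hk := integrable_fejerScaled hT
    have h1 : smoothCdf T G (y + ε) - smoothCdf T G (x - ε) ≤ g * (y - x + 2 * ε) := by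
      rw [smoothCdf_sub hT G (by linarith)]
      have := intervalIntegral.norm_integral_le_of_norm_le_const (a := x - ε) (b := y + ε)
        (f := fun u => ∫ z, fejerScaled T (u - z) ∂G) (C := g) (fun u _ => by
          rw [Real.norm_of_nonneg (integral_nonneg fun z => fejerScaled_nonneg hT _)]
          exact hdens T hT u)
      refine (le_abs_self _).trans (this.trans (le_of_eq ?_))
      rw [abs_of_nonneg (by linarith)]
      ring
    have h2 : G.real (Iic y) * J ≤ smoothCdf T G (y + ε) := by
      rw [← integral_const_mul, ← integral_indicator measurableSet_Icc]
      refine integral_mono ((hk.const_mul _).indicator measurableSet_Icc)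
        (integrable_smoothCdf hT G _) fun v => ?_
      by_cases hv : v ∈ Icc (-ε) ε
      · rw [indicator_of_mem hv]
        refine mul_le_mul_of_nonneg_right (measureReal_mono (Iic_subset_Iic.2 ?_))
          (fejerScaled_nonneg hT v)
        linarith [hv.2]
      · rw [indicator_of_notMem hv]
        exact mul_nonneg measureReal_nonneg (fejerScaled_nonneg hT v)
    have h3 : smoothCdf T G (x - ε) ≤ G.real (Iic x) * J + (1 - J) := by
      have e : G.real (Iic x) * J + (1 - J) = ∫ v, (fejerScaled T v -
          (1 - G.real (Iic x)) * (Icc (-ε) ε).indicator (fejerScaled T) v) := by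
        rw [integral_sub hk ((hk.indicator measurableSet_Icc).const_mul _), integral_const_mul,
          integral_indicator measurableSet_Icc, integral_fejerScaled hT]
        ring
      rw [e]
      refine integral_mono (integrable_smoothCdf hT G _)
        (hk.sub ((hk.indicator measurableSet_Icc).const_mul _)) fun v => ?_
      have hk0 := fejerScaled_nonneg hT v
      by_cases hv : v ∈ Icc (-ε) ε
      · simp only [indicator_of_mem hv]
        have : G.real (Iic (x - ε - v)) ≤ G.real (Iic x) :=
          measureReal_mono (Iic_subset_Iic.2 (by linarith [hv.1]))
        nlinarith
      · simp only [indicator_of_notMem hv, mul_zero, sub_zero]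
        exact mul_le_of_le_one_left hk0 measureReal_le_one
    have h4 : J * G.real (Ioc x y) = G.real (Iic y) * J - G.real (Iic x) * J := by
      rw [hdiff]; ring
    linarith
  have hε : ∀ ε : ℝ, 0 < ε → G.real (Ioc x y) ≤ g * (y - x + 2 * ε) := by
    intro ε hε
    have hlim : Tendsto (fun T : ℝ => ∫ v in (-(ε * T))..(ε * T), fejer v) atTop (𝓝 1) := by
      have h1 : Tendsto (fun T : ℝ => ε * T) atTop atTop := tendsto_id.const_mul_atTop hε
      rw [← integral_fejer]
      exact intervalIntegral_tendsto_integral integrable_fejer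
        (tendsto_neg_atTop_atBot.comp h1) h1
    have l1 := hlim.mul_const (G.real (Ioc x y))
    have l2 := (tendsto_const_nhds (x := g * (y - x + 2 * ε))).add
      ((tendsto_const_nhds (x := (1 : ℝ))).sub hlim)
    have := le_of_tendsto_of_tendsto l1 l2 ((eventually_gt_atTop 0).mono (hstep ε hε))
    simpa using this
  have l : Tendsto (fun ε : ℝ => g * (y - x + 2 * ε)) (𝓝[>] 0) (𝓝 (g * (y - x + 2 * 0))) :=
    (Continuous.tendsto (by fun_prop) 0).mono_left nhdsWithin_le_nhds
  have := ge_of_tendsto l (eventually_nhdsWithin_of_forall hε)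
  simpa using this

/-! ### The Lévy measure and the Stieltjes measure of `S*` -/

/-- The measure `α c y^{-α-1} dy` on `(0,∞)`. -/
noncomputable def levyMeasure (c α : ℝ) : Measure ℝ :=
  (volume.restrict (Ioi 0)).withDensity fun y =>
    ((Real.toNNReal (α * c * y ^ (-α - 1)) : NNReal) : ENNReal)

instance (c α : ℝ) : SFinite (levyMeasure c α) := by unfold levyMeasure; infer_instance

lemma measurable_levyDensity (c α : ℝ) :
    Measurable fun y : ℝ => Real.toNNReal (α * c * y ^ (-α - 1)) := by fun_prop

lemma setIntegral_levyMeasure {c α : ℝ} (hc : 0 ≤ c) (h0 : 0 < α) {s : Set ℝ} (hs : MeasurableSet s)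
    (hs0 : s ⊆ Ioi 0) (g : ℝ → ℝ) :
    ∫ y in s, g y ∂(levyMeasure c α) = ∫ y in s, g y * (α * c * y ^ (-α - 1)) := by
  rw [levyMeasure, restrict_withDensity hs, Measure.restrict_restrict hs, inter_eq_left.2 hs0,
    integral_withDensity_eq_integral_smul (measurable_levyDensity c α)]
  refine setIntegral_congr_fun hs fun y hy => ?_
  have hy0 : 0 < y := hs0 hy
  rw [NNReal.smul_def, Real.coe_toNNReal _ (by positivity), smul_eq_mul, mul_comm]

lemma integrableOn_levyMeasure_iff {c α : ℝ} (hc : 0 ≤ c) (h0 : 0 < α) {s : Set ℝ}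
    (hs : MeasurableSet s) (hs0 : s ⊆ Ioi 0) (g : ℝ → ℝ) :
    IntegrableOn g s (levyMeasure c α) ↔ IntegrableOn (fun y => g y * (α * c * y ^ (-α - 1))) s := by
  rw [IntegrableOn, levyMeasure, restrict_withDensity hs, Measure.restrict_restrict hs,
    inter_eq_left.2 hs0, integrable_withDensity_iff_integrable_smul (measurable_levyDensity c α)]
  refine integrableOn_congr_fun (fun y hy => ?_) hs
  have hy0 : 0 < y := hs0 hy
  rw [NNReal.smul_def, Real.coe_toNNReal _ (by positivity), smul_eq_mul, mul_comm]

lemma levyMeasure_Ioi_ne_top {c α : ℝ} (hc : 0 ≤ c) (h0 : 0 < α) {D : ℝ} (hD : 0 < D) :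
    levyMeasure c α (Ioi D) ≠ ⊤ := by
  have h := (integrableOn_levyMeasure_iff hc h0 (s := Ioi D) measurableSet_Ioi
    (Ioi_subset_Ioi hD.le) (fun _ => 1)).2 (by
      simp only [one_mul]
      exact (integrableOn_Ioi_rpow_of_lt (by linarith) hD).const_mul _)
  exact ((integrableOn_const_iff (by simp)).1 h).resolve_left (by simp) |>.ne

lemma isFiniteMeasure_levyMeasure_restrict {c α : ℝ} (hc : 0 ≤ c) (h0 : 0 < α) {D : ℝ} (hD : 0 < D) :
    IsFiniteMeasure ((levyMeasure c α).restrict (Ioi D)) :=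
  ⟨by simpa using (levyMeasure_Ioi_ne_top hc h0 hD).lt_top⟩

lemma levyMeasure_real_Ioc {c α : ℝ} (hc : 0 ≤ c) (h0 : 0 < α) {a b : ℝ} (ha : 0 < a) :
    (levyMeasure c α).real (Ioc a b) = ∫ y in Ioc a b, α * c * y ^ (-α - 1) := by
  have := setIntegral_levyMeasure hc h0 (s := Ioc a b) measurableSet_Ioc
    (fun y hy => ha.trans hy.1) (fun _ => 1)
  simpa using this

lemma sStar_eq_measureReal (μ₀ : Measure ℝ) [IsProbabilityMeasure μ₀] (c₀ α x : ℝ) :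
    sStar μ₀ c₀ α x = (evenPart μ₀).real (Ioi x) - c₀ / x ^ α := by
  rw [sStar, evenCdf, ← compl_Iic, measureReal_compl measurableSet_Iic]
  simp

lemma measurable_sStar (μ₀ : Measure ℝ) [IsProbabilityMeasure μ₀] (c₀ α : ℝ) :
    Measurable (sStar μ₀ c₀ α) := by
  have : Monotone (evenCdf μ₀) := fun a b h => measureReal_mono (Iic_subset_Iic.2 h)
  have := this.measurable
  unfold sStar
  fun_prop

lemma tendsto_sStar {μ₀ : Measure ℝ} {c₀ α : ℝ} (h0 : 0 < α)
    (hlim : Tendsto (fun x : ℝ => x ^ α * (1 - evenCdf μ₀ x)) atTop (𝓝 c₀)) :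
    Tendsto (sStar μ₀ c₀ α) atTop (𝓝 0) := by
  have h1 := ((hlim.sub_const c₀).mul (tendsto_rpow_neg_atTop h0))
  rw [mul_zero] at h1
  refine h1.congr' ?_
  filter_upwards [eventually_gt_atTop 0] with x hx
  have : x ^ α * x ^ (-α) = 1 := by rw [← Real.rpow_add hx]; simp
  rw [sStar, div_eq_mul_inv, ← Real.rpow_neg hx.le]
  linear_combination (1 - evenCdf μ₀ x) * this

lemma continuousWithinAt_sStar (μ₀ : Measure ℝ) [IsProbabilityMeasure μ₀] (c₀ α : ℝ) {x : ℝ}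
    (hx : 0 < x) : ContinuousWithinAt (sStar μ₀ c₀ α) (Ici x) x := by
  have h1 := (cdf (evenPart μ₀)).right_continuous x
  have h2 : ⇑(cdf (evenPart μ₀)) = evenCdf μ₀ := by ext y; rw [cdf_eq_real]; rfl
  rw [h2] at h1
  have h3 : ContinuousWithinAt (fun x : ℝ => c₀ / x ^ α) (Ici x) x :=
    (continuousAt_const.div (Real.continuousAt_rpow_const x α (Or.inl hx.ne'))
      (by positivity)).continuousWithinAt
  exact (continuousWithinAt_const.sub h1).sub h3

/-- The (positive or negative) Stieltjes measure of `S*` on `(D,∞)`, as a positive measure. -/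
lemma exists_stieltjes_sStar {μ₀ : Measure ℝ} [IsProbabilityMeasure μ₀] {c₀ α D : ℝ} (hc : 0 < c₀)
    (h0 : 0 < α) (hD : 0 < D)
    (hlim : Tendsto (fun x : ℝ => x ^ α * (1 - evenCdf μ₀ x)) atTop (𝓝 c₀))
    (hmono : MonotoneOn (sStar μ₀ c₀ α) (Ici D) ∨ AntitoneOn (sStar μ₀ c₀ α) (Ici D)) :
    ∃ (σ : ℝ) (m : Measure ℝ), |σ| = 1 ∧ IsFiniteMeasure m ∧ m (Iic D) = 0 ∧
      (∀ x, D ≤ x → m.real (Ioi x) = |sStar μ₀ c₀ α x|) ∧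
      ∀ (g : ℝ → ℝ) (C : ℝ), Continuous g → (∀ x, |g x| ≤ C) →
        stieltjesSStar μ₀ c₀ α D g = -(σ * ∫ y, g y ∂m) := by
  -- The sign σ makes -σS* increasing to 0, so σS* is nonnegative and equals |S*| on [D,∞).
  obtain ⟨σ, hσ, hmono⟩ : ∃ σ : ℝ, (σ = 1 ∨ σ = -1) ∧
      MonotoneOn (fun x => -σ * sStar μ₀ c₀ α x) (Ici D) := by
    rcases hmono with h | h
    · exact ⟨-1, Or.inr rfl, by simpa using h⟩
    · exact ⟨1, Or.inl rfl, by simpa using h.neg⟩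
  have hσ1 : |σ| = 1 := by rcases hσ with rfl | rfl <;> simp
  have hσ2 : σ * σ = 1 := by rcases hσ with rfl | rfl <;> simp
  set S := sStar μ₀ c₀ α with hS
  have hmem : ∀ x, max x D ∈ Ici D := fun x => (le_max_right x D : D ≤ max x D)
  -- Freezing the function to the left of D ensures that the measure carries no mass on (-∞,D], not
  -- even an atom at D.
  let f : StieltjesFunction ℝ :=
    { toFun := fun x => -σ * S (max x D)
      mono' := fun x y hxy => hmono (hmem x) (hmem y) (max_le_max_right D hxy)
      right_continuous' := fun x => by
        have h1 := continuousWithinAt_sStar μ₀ c₀ α (lt_of_lt_of_le hD (le_max_right x D))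
        have h2 : ContinuousWithinAt (fun y => S (max y D)) (Ici x) x :=
          ContinuousWithinAt.comp (f := fun y => max y D) (g := S) h1
            (by fun_prop) (fun y hy => max_le_max_right D hy)
        exact continuousWithinAt_const.mul h2 }
  have hfx : ∀ x, f x = -σ * S (max x D) := fun x => rfl
  have htop : Tendsto f atTop (𝓝 0) := by
    have := (tendsto_sStar h0 hlim).const_mul (-σ)
    rw [mul_zero] at this
    refine this.congr' ?_
    filter_upwards [eventually_ge_atTop D] with x hx
    rw [hfx, max_eq_left hx]
  have hbot : Tendsto f atBot (𝓝 (f D)) := by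
    refine tendsto_const_nhds.congr' ?_
    filter_upwards [eventually_le_atBot D] with x hx
    rw [hfx, hfx, max_self, max_eq_right hx]
  have hneg : ∀ x, f x ≤ 0 := fun x => f.mono.ge_of_tendsto htop x
  have hfin : IsFiniteMeasure f.measure := f.isFiniteMeasure hbot htop
  have hIoc : ∀ a b, a < b → D < b → f.measure.real (Ioc a b) =
      σ * ((evenPart μ₀).real (Ioc (max a D) b) - (levyMeasure c₀ α).real (Ioc (max a D) b)) := by
    intro a b hab hb
    have hpos : 0 < max a D := lt_of_lt_of_le hD (le_max_right _ _)
    have hle : max a D ≤ b := max_le hab.le hb.le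
    rw [measureReal_def, f.measure_Ioc, ENNReal.toReal_ofReal (by linarith [f.mono hab.le]), hfx, hfx,
      max_eq_left hb.le, levyMeasure_real_Ioc hc.le h0 hpos]
    have := sStar_sub_sStar μ₀ c₀ h0 hpos hle
    linear_combination (-σ) * this
  have hIoc0 : ∀ a b, a < b → b ≤ D → f.measure (Ioc a b) = 0 := by
    intro a b hab hb
    rw [f.measure_Ioc, hfx, hfx, max_eq_right hb, max_eq_right (hab.le.trans hb)]
    simp
  refine ⟨σ, f.measure, hσ1, hfin, ?_, fun x hx => ?_, fun g C hg hC => ?_⟩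
  · rw [f.measure_Iic hbot]; simp
  · rw [measureReal_def, f.measure_Ioi htop, ENNReal.toReal_ofReal (by linarith [hneg x])]
    have h1 := hneg x
    rw [hfx, max_eq_left hx] at h1 ⊢
    have h2 : |S x| = |σ * S x| := by rw [abs_mul, hσ1, one_mul]
    rw [h2, abs_of_nonneg (by linarith)]
    ring
  · have hfin2 := isFiniteMeasure_levyMeasure_restrict (c := c₀) (α := α) hc.le h0 hD
    have hgi : ∀ ν : Measure ℝ, IsFiniteMeasure ν → Integrable g ν := fun ν _ =>
      Integrable.of_bound hg.aestronglyMeasurable C (Eventually.of_forall hC)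
    have hres : ∀ (ν : Measure ℝ) (a b : ℝ), (ν.restrict (Ioi D)).real (Ioc a b)
        = ν.real (Ioc (max a D) b) := by
      intro ν a b
      rw [measureReal_restrict_apply measurableSet_Ioc]
      congr 1
      ext y; simp only [mem_inter_iff, mem_Ioc, mem_Ioi, max_lt_iff]; tauto
    rw [stieltjesSStar, ← setIntegral_levyMeasure hc.le h0 measurableSet_Ioi (Ioi_subset_Ioi hD.le)]
    have hcase : ∀ a b, a < b → (f.measure.real (Ioc a b) =
        σ * (((evenPart μ₀).restrict (Ioi D)).real (Ioc a b)
          - ((levyMeasure c₀ α).restrict (Ioi D)).real (Ioc a b))) := by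
      intro a b hab
      rw [hres, hres]
      rcases lt_or_ge D b with hb | hb
      · exact hIoc a b hab hb
      · rw [measureReal_def, hIoc0 a b hab hb, Ioc_eq_empty (not_lt.2 (hb.trans (le_max_right _ _)))]
        simp
    -- Either μ₀* exceeds the Lévy measure on (D,∞) or conversely. Writing the larger as the smaller
    -- plus f.measure keeps everything a positive measure.
    rcases hσ with rfl | rfl
    · have : (evenPart μ₀).restrict (Ioi D) = (levyMeasure c₀ α).restrict (Ioi D) + f.measure := by
        refine Measure.ext_of_Ioc _ _ fun a b hab => ?_
        rw [← measureReal_eq_measureReal_iff, measureReal_add_apply, hcase a b hab]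
        ring
      rw [this, integral_add_measure (hgi _ inferInstance) (hgi _ inferInstance)]
      ring
    · have : (levyMeasure c₀ α).restrict (Ioi D) = (evenPart μ₀).restrict (Ioi D) + f.measure := by
        refine Measure.ext_of_Ioc _ _ fun a b hab => ?_
        rw [← measureReal_eq_measureReal_iff, measureReal_add_apply, hcase a b hab]
        ring
      rw [this, integral_add_measure (hgi _ inferInstance) (hgi _ inferInstance)]
      ring

/-! ### The remainder `v₀*` -/

/-- Insert 1 - cos ξy = ∫₀^y ξ sin ξu du and exchange integrals. Only y² is assumed integrable, so
that the lemma covers the Lévy measure, which is infinite near 0, as well as μ₀*. -/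
lemma setIntegral_one_sub_cos_eq {ν : Measure ℝ} [SFinite ν] {D ξ : ℝ}
    (hν : IntegrableOn (fun y => y ^ 2) (Ioc 0 D) ν) :
    ∫ y in Ioc 0 D, (1 - Real.cos (ξ * y)) ∂ν
      = ∫ u in Ioc 0 D, ξ * Real.sin (ξ * u) * ν.real (Ioc u D) := by
  set F : ℝ → ℝ → ℝ := fun y u => {z : ℝ × ℝ | z.2 < z.1}.indicator
    (fun z => ξ * Real.sin (ξ * z.2)) (y, u) with hF
  have hFm : Measurable (Function.uncurry F) := by
    have : Function.uncurry F = {z : ℝ × ℝ | z.2 < z.1}.indicator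
      (fun z => ξ * Real.sin (ξ * z.2)) := by ext ⟨y, u⟩; rfl
    rw [this]
    exact Measurable.indicator (by fun_prop) (measurableSet_lt (by fun_prop) (by fun_prop))
  have hF1 : ∀ y, F y = (Iio y).indicator fun u => ξ * Real.sin (ξ * u) := by
    intro y; ext u; simp [hF, indicator]
  have hF2 : ∀ u, (fun y => F y u) = (Ioi u).indicator fun _ => ξ * Real.sin (ξ * u) := by
    intro u; ext y; simp [hF, indicator]
  have e1 : ∀ y ∈ Ioc 0 D, ∫ u in Ioc 0 D, F y u = 1 - Real.cos (ξ * y) := by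
    intro y hy
    rw [hF1, setIntegral_indicator measurableSet_Iio]
    have : Ioc 0 D ∩ Iio y = Ioo 0 y := by
      ext u; simp only [mem_inter_iff, mem_Ioc, mem_Iio, mem_Ioo]
      exact ⟨fun h => ⟨h.1.1, h.2⟩, fun h => ⟨⟨h.1, h.2.le.trans hy.2⟩, h.2⟩⟩
    rw [this, ← integral_Ioc_eq_integral_Ioo, ← intervalIntegral.integral_of_le hy.1.le]
    have hd : ∀ x ∈ uIcc 0 y, HasDerivAt (fun u => -Real.cos (ξ * u)) (ξ * Real.sin (ξ * x)) x := by
      intro x _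
      refine (((hasDerivAt_id x).const_mul ξ).cos.neg).congr_deriv ?_
      simp only [id]; ring
    rw [intervalIntegral.integral_eq_sub_of_hasDerivAt hd
      (Continuous.intervalIntegrable (by fun_prop) _ _)]
    simp; ring
  have e2 : ∀ u ∈ Ioc 0 D, ∫ y in Ioc 0 D, F y u ∂ν = ξ * Real.sin (ξ * u) * ν.real (Ioc u D) := by
    intro u hu
    rw [hF2, setIntegral_indicator measurableSet_Ioi, setIntegral_const]
    have : Ioc 0 D ∩ Ioi u = Ioc u D := by
      ext y; simp only [mem_inter_iff, mem_Ioc, mem_Ioi]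
      exact ⟨fun h => ⟨h.2, h.1.2⟩, fun h => ⟨⟨hu.1.trans h.1, h.2⟩, h.1⟩⟩
    rw [this, smul_eq_mul, mul_comm]
  rw [← setIntegral_congr_fun measurableSet_Ioc e1, ← setIntegral_congr_fun measurableSet_Ioc e2]
  refine integral_integral_swap ?_
  have hbd : ∀ y u, ‖F y u‖ ≤ ξ ^ 2 * |u| := by
    intro y u
    simp only [hF]
    refine (norm_indicator_le_norm_self _ _).trans ?_
    rw [norm_mul, Real.norm_eq_abs, Real.norm_eq_abs]
    calc |ξ| * |Real.sin (ξ * u)| ≤ |ξ| * |ξ * u| :=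
          mul_le_mul_of_nonneg_left Real.abs_sin_le_abs (abs_nonneg ξ)
      _ = _ := by rw [abs_mul, ← mul_assoc, ← sq, sq_abs]
  -- The bound |ξ sin ξu| ≤ ξ²u, with u < y, makes the inner integral at most ξ²y².
  refine (integrable_prod_iff hFm.aestronglyMeasurable).2 ⟨?_, ?_⟩
  · refine Eventually.of_forall fun y => ?_
    refine Integrable.of_bound (C := ξ ^ 2 * D)
      (hFm.comp measurable_prodMk_left).aestronglyMeasurable ?_
    refine (ae_restrict_iff' measurableSet_Ioc).2 (Eventually.of_forall fun u hu => ?_)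
    refine (hbd y u).trans ?_
    rw [abs_of_pos hu.1]
    gcongr
    exact hu.2
  · refine (hν.const_mul (ξ ^ 2)).mono' ?_ ?_
    · exact (hFm.norm.stronglyMeasurable.integral_prod_right
        (f := fun y u => ‖F y u‖)).aestronglyMeasurable
    · refine (ae_restrict_iff' measurableSet_Ioc).2 (Eventually.of_forall fun y hy => ?_)
      have hy0 := hy.1
      rw [Real.norm_of_nonneg (integral_nonneg fun u => norm_nonneg _)]
      have hle : ∀ u ∈ Ioc 0 D, ‖F y u‖ ≤ (Ioc 0 y).indicator (fun _ => ξ ^ 2 * y) u := by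
        intro u hu
        by_cases huy : u < y
        · rw [indicator_of_mem (show u ∈ Ioc 0 y from ⟨hu.1, huy.le⟩)]
          refine (hbd y u).trans ?_
          rw [abs_of_pos hu.1]
          gcongr
        · simp only [hF]
          rw [indicator_of_notMem (by simpa using huy), norm_zero]
          exact indicator_nonneg (fun _ _ => by positivity) _
      have hi1 : IntegrableOn ((Ioc 0 y).indicator fun _ : ℝ => ξ ^ 2 * y) (Ioc 0 D) :=
        (integrable_const _).indicator measurableSet_Ioc
      have hi2 : IntegrableOn (fun u => ‖F y u‖) (Ioc 0 D) :=
        hi1.mono' (hFm.norm.comp measurable_prodMk_left).aestronglyMeasurable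
          ((ae_restrict_iff' measurableSet_Ioc).2 (Eventually.of_forall fun u hu => by
            simpa using hle u hu))
      refine (setIntegral_mono_on hi2 hi1 measurableSet_Ioc hle).trans (le_of_eq ?_)
      rw [setIntegral_indicator measurableSet_Ioc, inter_eq_right.2 (Ioc_subset_Ioc_right hy.2),
        setIntegral_const, Real.volume_real_Ioc_of_le hy0.le, smul_eq_mul]
      ring

lemma integrableOn_rpow_Ioc {r D : ℝ} (hr : -1 < r) (hD : 0 ≤ D) :
    IntegrableOn (fun y : ℝ => y ^ r) (Ioc 0 D) :=
  (intervalIntegrable_iff_integrableOn_Ioc_of_le hD).1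
    (intervalIntegral.intervalIntegrable_rpow' hr)

lemma integrableOn_mul_abs_sStar (μ₀ : Measure ℝ) [IsProbabilityMeasure μ₀] {c₀ α D : ℝ}
    (hc : 0 < c₀) (h2 : α < 2) (hD : 0 ≤ D) :
    IntegrableOn (fun u => u * |sStar μ₀ c₀ α u|) (Ioc 0 D) := by
  have hi : IntegrableOn (fun u : ℝ => D + c₀ * u ^ (1 - α)) (Ioc 0 D) :=
    (integrable_const _).add ((integrableOn_rpow_Ioc (by linarith) hD).const_mul _)
  have hm := measurable_sStar μ₀ c₀ α
  refine hi.mono' (Measurable.aestronglyMeasurable (by fun_prop)) ?_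
  refine (ae_restrict_iff' measurableSet_Ioc).2 (Eventually.of_forall fun u hu => ?_)
  have hu0 := hu.1
  have h1 : |sStar μ₀ c₀ α u| ≤ 1 + c₀ / u ^ α := by
    rw [sStar_eq_measureReal]
    have h3 : (evenPart μ₀).real (Ioi u) ≤ 1 := measureReal_le_one
    have h4 : 0 ≤ (evenPart μ₀).real (Ioi u) := measureReal_nonneg
    have h5 : 0 ≤ c₀ / u ^ α := by positivity
    rw [abs_le]; constructor <;> linarith
  rw [Real.norm_of_nonneg (by positivity), Real.rpow_sub hu0, Real.rpow_one]
  calc u * |sStar μ₀ c₀ α u| ≤ u * (1 + c₀ / u ^ α) := by gcongr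
    _ = u + c₀ * (u / u ^ α) := by ring
    _ ≤ _ := by gcongr; exact hu.2

lemma vStar_neg (μ₀ : Measure ℝ) (c₀ α ξ : ℝ) : vStar μ₀ c₀ α (-ξ) = vStar μ₀ c₀ α ξ := by
  simp [vStar, charFun_neg]

lemma one_sub_re_charFun_eq (μ₀ : Measure ℝ) [IsProbabilityMeasure μ₀] {c₀ α : ℝ} (h0 : 0 < α)
    (ξ : ℝ) : 1 - (charFun μ₀ ξ).re = (scaleA c₀ α + vStar μ₀ c₀ α ξ) * |ξ| ^ α := by
  rcases eq_or_ne ξ 0 with rfl | h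
  · simp [Real.zero_rpow h0.ne']
  · rw [vStar, if_neg h]
    have : |ξ| ^ α ≠ 0 := by positivity
    field_simp
    ring

/-- `v₀*(ξ) ξ^α` is `b₂*(ξ)` up to a quadratic term. -/
lemma abs_vStar_mul_sub_bTwo_le {μ₀ : Measure ℝ} [IsProbabilityMeasure μ₀] {c₀ α D ξ : ℝ}
    (hc : 0 < c₀) (h0 : 0 < α) (h2 : α < 2) (hD : 0 < D) (hξ : 0 < ξ) :
    |vStar μ₀ c₀ α ξ * ξ ^ α - bTwo μ₀ c₀ α D ξ| ≤ 2 * kBarOne μ₀ c₀ α D * ξ ^ 2 := by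
  set S := sStar μ₀ c₀ α with hS
  set lam := levyMeasure c₀ α with hlam
  have hIocD : Ioc (0 : ℝ) D ⊆ Ioi 0 := Ioc_subset_Ioi_self
  have hIoiD : Ioi D ⊆ Ioi (0 : ℝ) := Ioi_subset_Ioi hD.le
  have hu : Ioc (0 : ℝ) D ∪ Ioi D = Ioi 0 := Ioc_union_Ioi_eq_Ioi hD.le
  have hμi := (integrable_one_sub_cos (evenPart μ₀) ξ).integrableOn (s := Ioi 0)
  have hlev := integrableOn_one_sub_cos_rpow h0 h2 ξ
  have hli : IntegrableOn (fun y => 1 - Real.cos (ξ * y)) (Ioi 0) lam := by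
    rw [hlam, integrableOn_levyMeasure_iff hc.le h0 measurableSet_Ioi Subset.rfl]
    refine (hlev.const_mul c₀).congr (Eventually.of_forall fun y => ?_)
    simp only; ring
  have hlint : ∫ y in Ioi 0, (1 - Real.cos (ξ * y)) ∂lam = c₀ * (ξ ^ α * levyConst α) := by
    rw [hlam, setIntegral_levyMeasure hc.le h0 measurableSet_Ioi Subset.rfl, ← integral_levy hξ,
      ← integral_const_mul]
    congr 1 with y
    ring
  -- Both 1 - Re φ₀ and a₀ξ^α are integrals of 2(1 - cos) over (0,∞), against μ₀* and the Lévy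
  -- measure. Their parts on (D,∞) are exactly b₂*.
  have e1 : vStar μ₀ c₀ α ξ * ξ ^ α - bTwo μ₀ c₀ α D ξ =
      2 * ((∫ y in Ioc 0 D, (1 - Real.cos (ξ * y)) ∂(evenPart μ₀)) -
        ∫ y in Ioc 0 D, (1 - Real.cos (ξ * y)) ∂lam) := by
    have h3 := one_sub_re_charFun_eq μ₀ (c₀ := c₀) h0 ξ
    rw [abs_of_pos hξ, one_sub_re_charFun_evenPart, ← hu, setIntegral_union (Ioc_disjoint_Ioi le_rfl)
      measurableSet_Ioi (hμi.mono_set hIocD) (hμi.mono_set hIoiD), scaleA_eq h0 h2] at h3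
    rw [← hu, setIntegral_union (Ioc_disjoint_Ioi le_rfl)
      measurableSet_Ioi (hli.mono_set hIocD) (hli.mono_set hIoiD)] at hlint
    rw [bTwo, stieltjesSStar, ← setIntegral_levyMeasure hc.le h0 measurableSet_Ioi hIoiD]
    linear_combination (-1) * h3 + 2 * hlint
  have hsq : ∀ ν : Measure ℝ, IsFiniteMeasure ν → IntegrableOn (fun y => y ^ 2) (Ioc 0 D) ν := by
    intro ν _
    refine Integrable.of_bound (Measurable.aestronglyMeasurable (by fun_prop)) (D ^ 2) ?_
    refine (ae_restrict_iff' measurableSet_Ioc).2 (Eventually.of_forall fun u hu => ?_)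
    rw [Real.norm_of_nonneg (by positivity)]
    have := hu.1.le
    gcongr
    exact hu.2
  have hsql : IntegrableOn (fun y => y ^ 2) (Ioc 0 D) lam := by
    rw [hlam, integrableOn_levyMeasure_iff hc.le h0 measurableSet_Ioc hIocD]
    refine IntegrableOn.congr_fun
      ((integrableOn_rpow_Ioc (r := 1 - α) (by linarith) hD.le).const_mul (α * c₀))
      (fun y hy => ?_) measurableSet_Ioc
    have e : y ^ (1 - α) = y ^ 2 * y ^ (-α - 1) := by
      rw [← Real.rpow_natCast, ← Real.rpow_add hy.1]; congr 1; push_cast; ring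
    simp only [e]; ring
  have hSi : IntegrableOn (fun u => ξ ^ 2 * (u * |S u| + u * |S D|)) (Ioc 0 D) := by
    refine ((integrableOn_mul_abs_sStar μ₀ hc h2 hD.le).add ?_).const_mul _
    refine Integrable.mul_const ?_ _
    exact (Continuous.integrableOn_Icc (by fun_prop)).mono_set Ioc_subset_Icc_self
  have hSm : Measurable S := measurable_sStar μ₀ c₀ α
  have hbound : ∀ u ∈ Ioc 0 D, ‖ξ * Real.sin (ξ * u) * (S u - S D)‖ ≤
      ξ ^ 2 * (u * |S u| + u * |S D|) := by
    intro u hu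
    have hu0 := hu.1
    rw [norm_mul, norm_mul, Real.norm_of_nonneg hξ.le, Real.norm_eq_abs, Real.norm_eq_abs]
    have h3 : |Real.sin (ξ * u)| ≤ ξ * u := by
      rw [← abs_of_pos (mul_pos hξ hu0)]; exact (Real.abs_sin_le_abs).trans_eq (by simp)
    calc ξ * |Real.sin (ξ * u)| * |S u - S D| ≤ ξ * (ξ * u) * (|S u| + |S D|) := by
          gcongr; exact abs_sub _ _
      _ = _ := by ring
  have hTi : IntegrableOn (fun u => ξ * Real.sin (ξ * u) * (S u - S D)) (Ioc 0 D) := by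
    refine hSi.mono' (Measurable.aestronglyMeasurable (by fun_prop)) ?_
    exact (ae_restrict_iff' measurableSet_Ioc).2 (Eventually.of_forall hbound)
  have hmm : Measurable fun u => (evenPart μ₀).real (Ioc u D) := by
    have : Antitone fun u => (evenPart μ₀).real (Ioc u D) :=
      fun a b h => measureReal_mono (Ioc_subset_Ioc_left h)
    exact this.measurable
  have hμt : IntegrableOn (fun u => ξ * Real.sin (ξ * u) * (evenPart μ₀).real (Ioc u D)) (Ioc 0 D) := by
    refine Integrable.of_bound (Measurable.aestronglyMeasurable (by fun_prop)) ξ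
      (Eventually.of_forall fun u => ?_)
    rw [norm_mul, norm_mul, Real.norm_of_nonneg hξ.le, Real.norm_of_nonneg measureReal_nonneg]
    calc _ ≤ ξ * 1 * 1 := by
          gcongr
          · exact Real.abs_sin_le_one _
          · exact measureReal_le_one
      _ = ξ := by ring
  -- By the tail formula the two integrals differ through μ₀*(u,D] minus the Lévy mass of (u,D],
  -- which is S*(u) - S*(D). This explains both summands of k̄₁.
  have e2 : ∫ y in Ioc 0 D, (1 - Real.cos (ξ * y)) ∂lam =
      (∫ y in Ioc 0 D, (1 - Real.cos (ξ * y)) ∂(evenPart μ₀)) -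
        ∫ u in Ioc 0 D, ξ * Real.sin (ξ * u) * (S u - S D) := by
    rw [setIntegral_one_sub_cos_eq hsql, setIntegral_one_sub_cos_eq (hsq _ inferInstance),
      ← integral_sub hμt hTi]
    refine setIntegral_congr_fun measurableSet_Ioc fun u hu => ?_
    have := sStar_sub_sStar μ₀ c₀ h0 hu.1 hu.2
    rw [← levyMeasure_real_Ioc hc.le h0 hu.1] at this
    linear_combination (-ξ * Real.sin (ξ * u)) * this
  rw [e1, e2, sub_sub_cancel, abs_mul, abs_of_pos two_pos, mul_assoc]
  refine mul_le_mul_of_nonneg_left ?_ two_pos.le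
  rw [← Real.norm_eq_abs]
  refine (norm_integral_le_of_norm_le hSi
    ((ae_restrict_iff' measurableSet_Ioc).2 (Eventually.of_forall hbound))).trans (le_of_eq ?_)
  have hid : IntegrableOn (fun u : ℝ => u) (Ioc 0 D) :=
    (Continuous.integrableOn_Icc (by fun_prop)).mono_set Ioc_subset_Icc_self
  rw [integral_const_mul, integral_add (integrableOn_mul_abs_sStar μ₀ hc h2 hD.le) (hid.mul_const _),
    integral_mul_const, ← intervalIntegral.integral_of_le hD.le (f := fun u => u), integral_id,
    kBarOne, integral_Ioc_eq_integral_Ioo]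
  ring

lemma exists_tail_le {μ₀ : Measure ℝ} [IsProbabilityMeasure μ₀] {c₀ α : ℝ} (h0 : 0 < α)
    (hlim : Tendsto (fun x : ℝ => x ^ α * (1 - evenCdf μ₀ x)) atTop (𝓝 c₀)) :
    ∃ C : ℝ, 0 ≤ C ∧ ∀ x, 0 < x → x ^ α * (evenPart μ₀).real (Ioi x) ≤ C := by
  obtain ⟨X, hX⟩ := (hlim.eventually (gt_mem_nhds (lt_add_one c₀))).exists_forall_of_atTop
  refine ⟨max (c₀ + 1) (|X| ^ α), le_max_of_le_right (by positivity), fun x hx => ?_⟩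
  rcases le_total X x with h | h
  · refine le_max_of_le_left ?_
    have := hX x h
    rw [evenCdf] at this
    rw [← compl_Iic, measureReal_compl measurableSet_Iic]
    simpa using this.le
  · refine le_max_of_le_right ?_
    calc x ^ α * (evenPart μ₀).real (Ioi x) ≤ x ^ α * 1 := by gcongr; exact measureReal_le_one
      _ ≤ |X| ^ α := by
        rw [mul_one]; exact Real.rpow_le_rpow hx.le (h.trans (le_abs_self X)) h0.le

/-- Split at y = 1/ξ. Below, the tail formula with tail at most C u^{-α} gives ξ²∫u^{1-α}du; above,
the tail itself is of order ξ^α. -/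
lemma exists_one_sub_re_charFun_le {μ₀ : Measure ℝ} [IsProbabilityMeasure μ₀] {c₀ α : ℝ}
    (h0 : 0 < α) (h2 : α < 2)
    (hlim : Tendsto (fun x : ℝ => x ^ α * (1 - evenCdf μ₀ x)) atTop (𝓝 c₀)) :
    ∃ K : ℝ, ∀ ξ, 0 < ξ → 1 - (charFun μ₀ ξ).re ≤ K * ξ ^ α := by
  obtain ⟨C, hC0, hC⟩ := exists_tail_le h0 hlim
  refine ⟨2 * (C / (2 - α) + 2 * C), fun ξ hξ => ?_⟩
  have hα : 0 < 2 - α := by linarith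
  set R := ξ⁻¹ with hR
  have hR0 : 0 < R := inv_pos.2 hξ
  have hi := (integrable_one_sub_cos (evenPart μ₀) ξ).integrableOn (s := Ioi 0)
  have htail : ∀ x, 0 < x → (evenPart μ₀).real (Ioi x) ≤ C * x ^ (-α) := by
    intro x hx
    rw [Real.rpow_neg hx.le, ← div_eq_mul_inv, le_div_iff₀ (by positivity), mul_comm]
    exact hC x hx
  rw [one_sub_re_charFun_evenPart, ← Ioc_union_Ioi_eq_Ioi hR0.le,
    setIntegral_union (Ioc_disjoint_Ioi le_rfl) measurableSet_Ioi
      (hi.mono_set Ioc_subset_Ioi_self) (hi.mono_set (Ioi_subset_Ioi hR0.le)), mul_assoc]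
  refine mul_le_mul_of_nonneg_left ?_ two_pos.le
  rw [add_mul]
  have hRα : R ^ (-α) = ξ ^ α := by
    rw [hR, Real.inv_rpow hξ.le, Real.rpow_neg hξ.le, inv_inv]
  refine add_le_add ?_ ?_
  · have hsq : IntegrableOn (fun y => y ^ 2) (Ioc 0 R) (evenPart μ₀) := by
      refine Integrable.of_bound (Measurable.aestronglyMeasurable (by fun_prop)) (R ^ 2) ?_
      refine (ae_restrict_iff' measurableSet_Ioc).2 (Eventually.of_forall fun u hu => ?_)
      rw [Real.norm_of_nonneg (by positivity)]
      have := hu.1.le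
      gcongr
      exact hu.2
    rw [setIntegral_one_sub_cos_eq hsq]
    have hi2 : IntegrableOn (fun u : ℝ => ξ ^ 2 * C * u ^ (1 - α)) (Ioc 0 R) :=
      (integrableOn_rpow_Ioc (by linarith) hR0.le).const_mul _
    refine (le_abs_self _).trans ?_
    rw [← Real.norm_eq_abs]
    refine (norm_integral_le_of_norm_le hi2 ((ae_restrict_iff' measurableSet_Ioc).2
      (Eventually.of_forall fun u hu => ?_))).trans (le_of_eq ?_)
    · have hu0 := hu.1
      rw [norm_mul, norm_mul, Real.norm_of_nonneg hξ.le, Real.norm_of_nonneg measureReal_nonneg,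
        Real.norm_eq_abs]
      have h3 : |Real.sin (ξ * u)| ≤ ξ * u := by
        rw [← abs_of_pos (mul_pos hξ hu0)]; exact (Real.abs_sin_le_abs).trans_eq (by simp)
      have h4 : (evenPart μ₀).real (Ioc u R) ≤ C * u ^ (-α) :=
        (measureReal_mono Ioc_subset_Ioi_self).trans (htail u hu0)
      have e : u ^ (1 - α) = u * u ^ (-α) := by
        rw [sub_eq_add_neg, Real.rpow_add hu0, Real.rpow_one]
      calc ξ * |Real.sin (ξ * u)| * (evenPart μ₀).real (Ioc u R)
          ≤ ξ * (ξ * u) * (C * u ^ (-α)) := by gcongr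
        _ = _ := by rw [e]; ring
    · rw [integral_const_mul, ← intervalIntegral.integral_of_le hR0.le,
        integral_rpow (Or.inl (by linarith)), show 1 - α + 1 = 2 - α by ring,
        Real.zero_rpow hα.ne', sub_zero, ← hRα, show 2 - α = 2 + -α by ring, Real.rpow_add hR0]
      have : R ^ (2 : ℝ) = (ξ ^ 2)⁻¹ := by rw [hR]; norm_cast; rw [inv_pow]
      rw [this]
      field_simp
  · have h5 : ∫ y in Ioi R, (1 - Real.cos (ξ * y)) ∂(evenPart μ₀) ≤ ∫ y in Ioi R, 2 ∂(evenPart μ₀) := by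
      refine setIntegral_mono_on (hi.mono_set (Ioi_subset_Ioi hR0.le)) (integrable_const _)
        measurableSet_Ioi fun y _ => ?_
      linarith [Real.neg_one_le_cos (ξ * y)]
    refine h5.trans ?_
    rw [setIntegral_const, smul_eq_mul, ← hRα]
    linarith [htail R hR0]

/-- Boundedness is what makes `vNorm` and `vBar` true upper bounds, since `sSup` of an unbounded set
of reals is 0. -/
lemma exists_abs_vStar_le {μ₀ : Measure ℝ} [IsProbabilityMeasure μ₀] {c₀ α : ℝ}
    (h0 : 0 < α) (h2 : α < 2)
    (hlim : Tendsto (fun x : ℝ => x ^ α * (1 - evenCdf μ₀ x)) atTop (𝓝 c₀)) :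
    ∃ K : ℝ, ∀ ξ, |vStar μ₀ c₀ α ξ| ≤ K := by
  obtain ⟨K, hK⟩ := exists_one_sub_re_charFun_le h0 h2 hlim
  have hpos : ∀ ξ, 0 < ξ → |vStar μ₀ c₀ α ξ| ≤ |K| + |scaleA c₀ α| := by
    intro ξ hξ
    rw [vStar, if_neg hξ.ne', abs_of_pos hξ]
    refine (abs_sub _ _).trans (add_le_add_left ?_ _)
    have h3 : (charFun μ₀ ξ).re ≤ 1 := (Complex.re_le_norm _).trans (norm_charFun_le_one ξ)
    rw [abs_of_nonneg (div_nonneg (by linarith) (by positivity)), div_le_iff₀ (by positivity)]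
    exact (hK ξ hξ).trans (by gcongr; exact le_abs_self K)
  refine ⟨|K| + |scaleA c₀ α|, fun ξ => ?_⟩
  rcases lt_trichotomy ξ 0 with h | rfl | h
  · rw [← vStar_neg]; exact hpos _ (by linarith)
  · simp [vStar]; positivity
  · exact hpos ξ h

lemma abs_vStar_le_vNorm {μ₀ : Measure ℝ} {c₀ α : ℝ} (hb : ∃ K : ℝ, ∀ ξ, |vStar μ₀ c₀ α ξ| ≤ K)
    (ξ : ℝ) : |vStar μ₀ c₀ α ξ| ≤ vNorm μ₀ c₀ α := by
  obtain ⟨K, hK⟩ := hb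
  have : |vStar μ₀ c₀ α ξ| = |vStar μ₀ c₀ α (|ξ|)| := by
    rcases abs_choice (ξ) with h | h
    · rw [h]
    · rw [h, vStar_neg]
  rw [this]
  exact le_csSup ⟨K, by rintro _ ⟨y, -, rfl⟩; exact hK y⟩ ⟨|ξ|, abs_nonneg ξ, rfl⟩

lemma abs_vStar_le_vBar {μ₀ : Measure ℝ} {c₀ α : ℝ} (hb : ∃ K : ℝ, ∀ ξ, |vStar μ₀ c₀ α ξ| ≤ K)
    (ξ : ℝ) : |vStar μ₀ c₀ α ξ| ≤ vBar μ₀ c₀ α |ξ| := by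
  obtain ⟨K, hK⟩ := hb
  have : |vStar μ₀ c₀ α ξ| = |vStar μ₀ c₀ α (|ξ|)| := by
    rcases abs_choice (ξ) with h | h
    · rw [h]
    · rw [h, vStar_neg]
  rw [this]
  exact le_csSup ⟨K, by rintro _ ⟨y, -, rfl⟩; exact hK y⟩ ⟨|ξ|, ⟨abs_nonneg ξ, le_rfl⟩, rfl⟩

/-! ### The functions `h*`, `H₁*`, `H₃*` -/

/-- Bounds the integrands of H₁* and H₃*. The point x = 0 is included because a vanishing weight q
turns y/q into 0. -/
lemma exists_abs_hStar_le {μ₀ : Measure ℝ} [IsProbabilityMeasure μ₀] {c₀ α : ℝ} (hc : 0 < c₀)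
    (h0 : 0 < α) (hlim : Tendsto (fun x : ℝ => x ^ α * (1 - evenCdf μ₀ x)) atTop (𝓝 c₀)) :
    ∃ C : ℝ, 0 ≤ C ∧ ∀ x, 0 ≤ x → |hStar μ₀ c₀ α x| ≤ C := by
  obtain ⟨C, hC0, hC⟩ := exists_tail_le h0 hlim
  refine ⟨C + c₀, by positivity, fun x hx => ?_⟩
  rcases hx.eq_or_lt with rfl | hx
  · simp [hStar, Real.zero_rpow h0.ne']; positivity
  · have h1 := hC x hx
    have h2 : 0 ≤ x ^ α * (evenPart μ₀).real (Ioi x) := by positivity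
    have h3 : hStar μ₀ c₀ α x = x ^ α * (evenPart μ₀).real (Ioi x) - c₀ := by
      rw [hStar, sStar_eq_measureReal]
      have : x ^ α ≠ 0 := by positivity
      field_simp
    rw [h3, abs_le]; constructor <;> linarith

lemma measurable_hStar (μ₀ : Measure ℝ) [IsProbabilityMeasure μ₀] (c₀ α : ℝ) :
    Measurable (hStar μ₀ c₀ α) := by
  have := measurable_sStar μ₀ c₀ α
  unfold hStar
  fun_prop

lemma measurable_hOne (μ₀ : Measure ℝ) [IsProbabilityMeasure μ₀] (c₀ α : ℝ) :
    Measurable (hOne μ₀ c₀ α) := by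
  have hm := measurable_hStar μ₀ c₀ α
  refine StronglyMeasurable.measurable ?_
  unfold hOne
  refine StronglyMeasurable.integral_prod_right'
    (f := fun z : ℝ × ℝ => z.2 ^ (1 - α) * |hStar μ₀ c₀ α (z.2 / z.1)|) ?_
  exact Measurable.stronglyMeasurable (by fun_prop)

lemma measurable_hThree (μ₀ : Measure ℝ) [IsProbabilityMeasure μ₀] (c₀ α : ℝ) :
    Measurable (hThree μ₀ c₀ α) := by
  have hm := measurable_hStar μ₀ c₀ α
  refine StronglyMeasurable.measurable ?_
  unfold hThree
  refine StronglyMeasurable.integral_prod_right'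
    (f := fun z : ℝ × ℝ => z.2 ^ (-(1 + α)) * |hStar μ₀ c₀ α (z.2 / z.1)|) ?_
  exact Measurable.stronglyMeasurable (by fun_prop)

lemma hOne_nonneg (μ₀ : Measure ℝ) (c₀ α q : ℝ) : 0 ≤ hOne μ₀ c₀ α q :=
  setIntegral_nonneg measurableSet_Ioo fun y hy => by have := hy.1; positivity

lemma hThree_nonneg (μ₀ : Measure ℝ) (c₀ α q : ℝ) : 0 ≤ hThree μ₀ c₀ α q :=
  setIntegral_nonneg measurableSet_Ioi fun y hy => by
    have : (0 : ℝ) < y := one_pos.trans hy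
    positivity

lemma integrableOn_hOne {μ₀ : Measure ℝ} [IsProbabilityMeasure μ₀] {c₀ α C q : ℝ} (h2 : α < 2)
    (hC : ∀ x, 0 ≤ x → |hStar μ₀ c₀ α x| ≤ C) (hq : 0 ≤ q) :
    IntegrableOn (fun y => y ^ (1 - α) * |hStar μ₀ c₀ α (y / q)|) (Ioc 0 1) := by
  have hm := measurable_hStar μ₀ c₀ α
  refine ((integrableOn_rpow_Ioc (r := 1 - α) (by linarith) zero_le_one).mul_const C).mono'
    (Measurable.aestronglyMeasurable (by fun_prop)) ?_
  refine (ae_restrict_iff' measurableSet_Ioc).2 (Eventually.of_forall fun y hy => ?_)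
  have hy0 := hy.1
  rw [Real.norm_of_nonneg (by positivity)]
  gcongr
  exact hC _ (by positivity)

lemma integrableOn_hThree {μ₀ : Measure ℝ} [IsProbabilityMeasure μ₀] {c₀ α C q : ℝ} (h0 : 0 < α)
    (hC : ∀ x, 0 ≤ x → |hStar μ₀ c₀ α x| ≤ C) (hq : 0 ≤ q) :
    IntegrableOn (fun y => y ^ (-(1 + α)) * |hStar μ₀ c₀ α (y / q)|) (Ioi 1) := by
  have hm := measurable_hStar μ₀ c₀ α
  refine ((integrableOn_Ioi_rpow_of_lt (a := -(1 + α)) (by linarith) one_pos).mul_const C).mono'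
    (Measurable.aestronglyMeasurable (by fun_prop)) ?_
  refine (ae_restrict_iff' measurableSet_Ioi).2 (Eventually.of_forall fun y hy => ?_)
  have hy0 : (0 : ℝ) < y := one_pos.trans hy
  rw [Real.norm_of_nonneg (by positivity)]
  gcongr
  exact hC _ (by positivity)

/-- Together with ∑|β_j|^α = 1 this gives a uniform bound on the leaf sum whose expectation appears
in the final estimate, hence its integrability under the tree law. -/
lemma exists_hOne_add_hThree_le {μ₀ : Measure ℝ} [IsProbabilityMeasure μ₀] {c₀ α : ℝ} (hc : 0 < c₀)
    (h0 : 0 < α) (h2 : α < 2)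
    (hlim : Tendsto (fun x : ℝ => x ^ α * (1 - evenCdf μ₀ x)) atTop (𝓝 c₀)) :
    ∃ B : ℝ, ∀ q, 0 ≤ q → hOne μ₀ c₀ α q + hThree μ₀ c₀ α q ≤ B := by
  obtain ⟨C, hC0, hC⟩ := exists_abs_hStar_le hc h0 hlim
  refine ⟨(∫ y in Ioo (0 : ℝ) 1, y ^ (1 - α) * C) + ∫ y in Ioi (1 : ℝ), y ^ (-(1 + α)) * C,
    fun q hq => add_le_add ?_ ?_⟩
  · refine setIntegral_mono_on ((integrableOn_hOne h2 hC hq).mono_set Ioo_subset_Ioc_self)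
      (IntegrableOn.mono_set
        ((integrableOn_rpow_Ioc (r := 1 - α) (by linarith) zero_le_one).mul_const C)
        Ioo_subset_Ioc_self) measurableSet_Ioo fun y hy => ?_
    have hy0 := hy.1
    gcongr
    exact hC _ (by positivity)
  · refine setIntegral_mono_on (integrableOn_hThree h0 hC hq)
      ((integrableOn_Ioi_rpow_of_lt (a := -(1 + α)) (by linarith) one_pos).mul_const C)
      measurableSet_Ioi fun y hy => ?_
    have hy0 : (0 : ℝ) < y := one_pos.trans hy
    gcongr
    exact hC _ (by positivity)

/-- `∫₀^∞ min(u, 1/u) |S*(u/q)| du = q^α (H₁*(q) + H₃*(q))`. -/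
lemma lintegral_min_sStar {μ₀ : Measure ℝ} [IsProbabilityMeasure μ₀] {c₀ α q : ℝ}
    (hc : 0 < c₀) (h0 : 0 < α) (h2 : α < 2)
    (hlim : Tendsto (fun x : ℝ => x ^ α * (1 - evenCdf μ₀ x)) atTop (𝓝 c₀)) (hq : 0 < q) :
    ∫⁻ u in Ioi (0 : ℝ), ENNReal.ofReal (min u (1 / u) * |sStar μ₀ c₀ α (u / q)|) =
      ENNReal.ofReal (q ^ α * (hOne μ₀ c₀ α q + hThree μ₀ c₀ α q)) := by
  obtain ⟨C, hC0, hC⟩ := exists_abs_hStar_le hc h0 hlim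
  -- The factor u^{-α} turns min(u,1/u) into the weights u^{1-α} on (0,1] and u^{-(1+α)} on (1,∞) of
  -- H₁* and H₃*.
  have hS : ∀ u, 0 < u → |sStar μ₀ c₀ α (u / q)| = q ^ α * (u ^ (-α) * |hStar μ₀ c₀ α (u / q)|) := by
    intro u hu
    have : 0 < u / q := by positivity
    rw [hStar, abs_mul, abs_of_pos (Real.rpow_pos_of_pos this α), Real.div_rpow hu.le hq.le,
      Real.rpow_neg hu.le]
    have h1 : q ^ α ≠ 0 := by positivity
    have h3 : u ^ α ≠ 0 := by positivity
    field_simp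
  have e1 : ∫⁻ u in Ioc (0 : ℝ) 1, ENNReal.ofReal (min u (1 / u) * |sStar μ₀ c₀ α (u / q)|)
      = ENNReal.ofReal (q ^ α * hOne μ₀ c₀ α q) := by
    rw [hOne, ← integral_Ioc_eq_integral_Ioo, ← integral_const_mul,
      ofReal_integral_eq_lintegral_ofReal ((integrableOn_hOne h2 hC hq.le).const_mul _)
        ((ae_restrict_iff' measurableSet_Ioc).2 (Eventually.of_forall fun y hy => by
          have := hy.1; simp only [Pi.zero_apply]; positivity))]
    refine setLIntegral_congr_fun measurableSet_Ioc fun u hu => ?_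
    have hu0 := hu.1
    have hmin : min u (1 / u) = u := min_eq_left (by
      rw [le_div_iff₀ hu0]; nlinarith [hu.2])
    have e : u ^ (1 - α) = u * u ^ (-α) := by
      rw [sub_eq_add_neg, Real.rpow_add hu0, Real.rpow_one]
    simp only [hmin, hS u hu0, e]
    congr 1; ring
  have e2 : ∫⁻ u in Ioi (1 : ℝ), ENNReal.ofReal (min u (1 / u) * |sStar μ₀ c₀ α (u / q)|)
      = ENNReal.ofReal (q ^ α * hThree μ₀ c₀ α q) := by
    rw [hThree, ← integral_const_mul,
      ofReal_integral_eq_lintegral_ofReal ((integrableOn_hThree h0 hC hq.le).const_mul _)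
        ((ae_restrict_iff' measurableSet_Ioi).2 (Eventually.of_forall fun y hy => by
          have : (0 : ℝ) < y := one_pos.trans hy
          simp only [Pi.zero_apply]; positivity))]
    refine setLIntegral_congr_fun measurableSet_Ioi fun u hu => ?_
    have hu1 : (1 : ℝ) < u := hu
    have hu0 : (0 : ℝ) < u := one_pos.trans hu
    have hmin : min u (1 / u) = u⁻¹ := by
      rw [one_div]; exact min_eq_right (by rw [inv_le_iff_one_le_mul₀ hu0]; nlinarith)
    have e : u ^ (-(1 + α)) = u⁻¹ * u ^ (-α) := by
      rw [neg_add, Real.rpow_add hu0, Real.rpow_neg_one]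
    simp only [hmin, hS u hu0, e]
    congr 1; ring
  rw [← Ioc_union_Ioi_eq_Ioi (zero_le_one (α := ℝ)),
    lintegral_union measurableSet_Ioi (Ioc_disjoint_Ioi le_rfl), e1, e2, ← ENNReal.ofReal_add, mul_add]
  · exact mul_nonneg (by positivity) (hOne_nonneg _ _ _ _)
  · exact mul_nonneg (by positivity) (hThree_nonneg _ _ _ _)

/-! ### The constant `z₀` -/

/-- Evaluates both entries of the maximum defining z₀: r = 0 and r = 2 give the total variation of
n₀ and the integral of x²|n₀'|. Since f is prescribed only on (0,∞), its derivative is computed from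
local agreement there. -/
lemma integral_abs_deriv_exp_neg_mul_rpow {a α r : ℝ} (ha : 0 < a) (h0 : 0 < α) (hr : 0 ≤ r)
    {f : ℝ → ℝ} (hf : ∀ x, 0 < x → f x = Real.exp (-(a * x ^ α))) :
    ∫ x in Ioi (0 : ℝ), x ^ r * |deriv f x| =
      a * α * (a ^ (-(r + α) / α) * (1 / α) * Real.Gamma ((r + α) / α)) := by
  have h := integral_rpow_mul_exp_neg_mul_rpow (p := α) (q := r + α - 1) h0 (by linarith) ha
  rw [show r + α - 1 + 1 = r + α by ring] at h
  rw [← h, ← integral_const_mul]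
  refine setIntegral_congr_fun measurableSet_Ioi fun x hx => ?_
  have hx0 : (0 : ℝ) < x := hx
  have hd : HasDerivAt f (Real.exp (-(a * x ^ α)) * (-(a * (α * x ^ (α - 1))))) x := by
    have h1 : HasDerivAt (fun x : ℝ => Real.exp (-(a * x ^ α)))
        (Real.exp (-(a * x ^ α)) * (-(a * (α * x ^ (α - 1))))) x :=
      (((Real.hasDerivAt_rpow_const (Or.inl hx0.ne')).const_mul a).neg).exp
    refine h1.congr_of_eventuallyEq ?_
    filter_upwards [lt_mem_nhds hx0] with y hy using hf y hy
  have e : x ^ (r + α - 1) = x ^ r * x ^ (α - 1) := by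
    rw [← Real.rpow_add hx0]; congr 1; ring
  simp only [hd.deriv, abs_mul, abs_neg, Real.abs_exp, abs_of_pos ha, abs_of_pos h0,
    abs_of_pos (Real.rpow_pos_of_pos hx0 (α - 1)), e, neg_mul]
  ring

lemma nFun_zero (c₀ α η x : ℝ) :
    nFun c₀ α η 0 x = Real.exp (-((scaleA c₀ α - η) * x ^ α)) := by
  simp [nFun]

/-- The function n₀ decreases from 1 to 0, so its total variation is 1. -/
lemma one_le_zConst {c₀ α η : ℝ} (h0 : 0 < α) (hη : η < scaleA c₀ α) : 1 ≤ zConst c₀ α η 0 := by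
  refine le_max_of_le_left (le_of_eq ?_)
  have h := integral_abs_deriv_exp_neg_mul_rpow (sub_pos.2 hη) h0 le_rfl
    (fun x _ => nFun_zero c₀ α η x)
  simp only [Real.rpow_zero, one_mul, zero_add, neg_div, div_self h0.ne', Real.Gamma_one,
    Real.rpow_neg_one] at h
  rw [h]
  have : scaleA c₀ α - η ≠ 0 := (sub_pos.2 hη).ne'
  field_simp

/-- Integration by parts gives ½∫x²|n₀'| = ∫x n₀ = N₂; here both sides are evaluated by Gamma
functions. -/
lemma constN_two_le_zConst {c₀ α η : ℝ} (h0 : 0 < α) (hη : η < scaleA c₀ α) :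
    constN c₀ α η 2 ≤ zConst c₀ α η 0 := by
  refine le_max_of_le_right (le_of_eq ?_)
  have ha := sub_pos.2 hη
  have h := integral_abs_deriv_exp_neg_mul_rpow ha h0 two_pos.le
    (fun x _ => nFun_zero c₀ α η x)
  have h2 := integral_rpow_mul_exp_neg_mul_rpow (p := α) (q := 1) h0 (by linarith) ha
  norm_num at h
  norm_num only [Real.rpow_one] at h2
  simp only [neg_mul] at h2
  have e : constN c₀ α η 2 = ∫ x in Ioi (0 : ℝ), x * Real.exp (-((scaleA c₀ α - η) * x ^ α)) := by
    unfold constN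
    congr 1 with x
    norm_num [mul_comm]
  rw [e, h, h2, show (2 + α) / α = 2 / α + 1 by field_simp, Real.Gamma_add_one (by positivity),
    show (-α + -2) / α = -2 / α + (-1) by field_simp; ring, Real.rpow_add ha, Real.rpow_neg_one]
  field_simp

lemma integrableOn_constN {c₀ α η l : ℝ} (h0 : 0 < α) (hl : 0 < l) (hη : η < scaleA c₀ α) :
    IntegrableOn (fun ξ => Real.exp (-((scaleA c₀ α - η) * ξ ^ α)) * ξ ^ (l - 1)) (Ioi 0) := by
  have := integrableOn_rpow_mul_exp_neg_mul_rpow (p := α) (s := l - 1) (by linarith) h0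
    (sub_pos.2 hη)
  refine this.congr_fun (fun x hx => ?_) measurableSet_Ioi
  simp only; ring_nf

lemma constN_pos {c₀ α η l : ℝ} (h0 : 0 < α) (hl : 0 < l) (hη : η < scaleA c₀ α) :
    0 < constN c₀ α η l := by
  have h := integral_rpow_mul_exp_neg_mul_rpow (p := α) (q := l - 1) h0 (by linarith)
    (sub_pos.2 hη)
  have e : constN c₀ α η l = ∫ x in Ioi (0 : ℝ), x ^ (l - 1) *
      Real.exp (-(scaleA c₀ α - η) * x ^ α) := by
    unfold constN
    congr 1 with x
    rw [mul_comm, neg_mul]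
  rw [e, h]
  have := sub_pos.2 hη
  have := Real.Gamma_pos_of_pos (s := (l - 1 + 1) / α) (by ring_nf; positivity)
  positivity

/-! ### The function `b ↦ ∫₀^∞ n(ξ) (1 - cos bξ) / ξ dξ` -/

lemma one_sub_cos_div_le_mul {b ξ : ℝ} (hξ : 0 < ξ) :
    (1 - Real.cos (b * ξ)) / ξ ≤ b ^ 2 / 2 * ξ := by
  rw [div_le_iff₀ hξ]
  nlinarith [Real.one_sub_sq_div_two_le_cos (x := b * ξ)]

lemma one_sub_cos_div_le_div {b ξ : ℝ} (hξ : 0 < ξ) : (1 - Real.cos (b * ξ)) / ξ ≤ 2 / ξ := by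
  gcongr
  linarith [Real.neg_one_le_cos (b * ξ)]

lemma one_sub_cos_div_nonneg {b ξ : ℝ} (hξ : 0 < ξ) : 0 ≤ (1 - Real.cos (b * ξ)) / ξ :=
  div_nonneg (by linarith [Real.cos_le_one (b * ξ)]) hξ.le

section LogBounds

variable {n : ℝ → ℝ} {N b : ℝ}

lemma integrableOn_mul_one_sub_cos_div (hn0 : ∀ ξ, 0 ≤ n ξ)
    (hnm : Measurable n) (hi : IntegrableOn (fun ξ => n ξ * ξ) (Ioi 0)) (b : ℝ) :
    IntegrableOn (fun ξ => n ξ * ((1 - Real.cos (b * ξ)) / ξ)) (Ioi 0) := by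
  refine Integrable.mono' (g := fun ξ => b ^ 2 / 2 * (n ξ * ξ)) (hi.const_mul _)
    (Measurable.aestronglyMeasurable (by fun_prop)) ?_
  refine (ae_restrict_iff' measurableSet_Ioi).2 (Eventually.of_forall fun ξ hξ => ?_)
  rw [Real.norm_of_nonneg (mul_nonneg (hn0 ξ) (one_sub_cos_div_nonneg hξ))]
  nlinarith [mul_le_mul_of_nonneg_left (one_sub_cos_div_le_mul (b := b) hξ) (hn0 ξ)]

lemma integral_mul_one_sub_cos_div_le (hn0 : ∀ ξ, 0 ≤ n ξ)
    (hnm : Measurable n) (hi : IntegrableOn (fun ξ => n ξ * ξ) (Ioi 0))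
    (hN : ∫ ξ in Ioi (0 : ℝ), n ξ * ξ = N) (b : ℝ) :
    ∫ ξ in Ioi (0 : ℝ), n ξ * ((1 - Real.cos (b * ξ)) / ξ) ≤ b ^ 2 * N / 2 := by
  have : b ^ 2 * N / 2 = ∫ ξ in Ioi (0 : ℝ), b ^ 2 / 2 * (n ξ * ξ) := by
    rw [integral_const_mul, hN]; ring
  rw [this]
  refine setIntegral_mono_on (integrableOn_mul_one_sub_cos_div hn0 hnm hi b) (hi.const_mul _)
    measurableSet_Ioi fun ξ hξ => ?_
  nlinarith [mul_le_mul_of_nonneg_left (one_sub_cos_div_le_mul (b := b) hξ) (hn0 ξ)]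

lemma integrableOn_max_one_sub_cos_div (b N x y : ℝ) (hx : 0 ≤ x) :
    IntegrableOn (fun ξ => max ((1 - Real.cos (b * ξ)) / ξ - ξ / N) 0) (Icc x y) := by
  rw [integrableOn_Icc_iff_integrableOn_Ioc]
  refine Integrable.mono' (g := fun ξ => b ^ 2 / 2 * ξ + |ξ / N|) ?_
    (Measurable.aestronglyMeasurable (by fun_prop)) ?_
  · exact (Continuous.integrableOn_Icc (by fun_prop)).mono_set Ioc_subset_Icc_self
  refine (ae_restrict_iff' measurableSet_Ioc).2 (Eventually.of_forall fun ξ hξ => ?_)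
  have hξ0 : 0 < ξ := hx.trans_lt hξ.1
  rw [Real.norm_of_nonneg (le_max_right _ _)]
  refine max_le ?_ (by positivity)
  linarith [one_sub_cos_div_le_mul (b := b) hξ0, neg_abs_le (ξ / N)]

/-- The bathtub principle with the weight `ξ`. -/
lemma integral_mul_one_sub_cos_div_le_one_add (hn0 : ∀ ξ, 0 ≤ n ξ) (hn1 : ∀ ξ, 0 < ξ → n ξ ≤ 1)
    (hnm : Measurable n) (hi : IntegrableOn (fun ξ => n ξ * ξ) (Ioi 0))
    (hN : ∫ ξ in Ioi (0 : ℝ), n ξ * ξ = N) (hNpos : 0 < N) :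
    ∫ ξ in Ioi (0 : ℝ), n ξ * ((1 - Real.cos (b * ξ)) / ξ) ≤
      1 + ∫ ξ in (0 : ℝ)..√(2 * N), max ((1 - Real.cos (b * ξ)) / ξ - ξ / N) 0 := by
  -- Beyond this point 2/ξ ≤ ξ/N, so the excess of (1 - cos bξ)/ξ over ξ/N is nonpositive.
  set R := √(2 * N)
  have hR : 0 ≤ R := Real.sqrt_nonneg _
  have hR2 : R ^ 2 = 2 * N := Real.sq_sqrt (by positivity)
  have hk := (integrableOn_max_one_sub_cos_div b N 0 R le_rfl).mono_set Ioc_subset_Icc_self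
  have hk' : IntegrableOn ((Ioc 0 R).indicator
      fun ξ => max ((1 - Real.cos (b * ξ)) / ξ - ξ / N) 0) (Ioi 0) :=
    ((integrable_indicator_iff measurableSet_Ioc).2 hk).integrableOn
  have e1 : (1 : ℝ) = ∫ ξ in Ioi (0 : ℝ), N⁻¹ * (n ξ * ξ) := by
    rw [integral_const_mul, hN, inv_mul_cancel₀ hNpos.ne']
  have e2 : ∫ ξ in (0 : ℝ)..R, max ((1 - Real.cos (b * ξ)) / ξ - ξ / N) 0 =
      ∫ ξ in Ioi (0 : ℝ), (Ioc 0 R).indicator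
        (fun ξ => max ((1 - Real.cos (b * ξ)) / ξ - ξ / N) 0) ξ := by
    rw [setIntegral_indicator measurableSet_Ioc,
      inter_eq_self_of_subset_right (Ioc_subset_Ioi_self), intervalIntegral.integral_of_le hR]
  rw [e2]
  nth_rewrite 2 [e1]
  rw [← integral_add (hi.const_mul _) hk']
  refine setIntegral_mono_on (integrableOn_mul_one_sub_cos_div hn0 hnm hi b)
    ((hi.const_mul _).add hk') measurableSet_Ioi fun ξ hξ => ?_
  have hξ0 : (0 : ℝ) < ξ := hξ
  -- The multiple ξ/N integrates against n to exactly 1. The remainder is largest when n is 1 where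
  -- it is positive and 0 elsewhere.
  have h1 : n ξ * ((1 - Real.cos (b * ξ)) / ξ) =
      N⁻¹ * (n ξ * ξ) + n ξ * ((1 - Real.cos (b * ξ)) / ξ - ξ / N) := by
    field_simp; ring
  rw [h1]
  gcongr
  by_cases h : ξ ≤ R
  · rw [indicator_of_mem (show ξ ∈ Ioc 0 R from ⟨hξ0, h⟩)]
    calc _ ≤ n ξ * max ((1 - Real.cos (b * ξ)) / ξ - ξ / N) 0 := by
          gcongr
          · exact hn0 ξ
          · exact le_max_left _ _
      _ ≤ 1 * max ((1 - Real.cos (b * ξ)) / ξ - ξ / N) 0 := by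
          gcongr
          · exact hn1 ξ hξ0
      _ = _ := one_mul _
  · rw [indicator_of_notMem (fun hh => h hh.2)]
    refine mul_nonpos_of_nonneg_of_nonpos (hn0 ξ) ?_
    have h3 := one_sub_cos_div_le_div (b := b) hξ0
    have h4 : 2 / ξ ≤ ξ / N := by
      rw [div_le_div_iff₀ hξ0 hNpos, ← hR2]
      nlinarith [not_le.1 h]
    linarith

/-- The integrand with a positive part has no convenient primitive, so it is dominated by an
explicit derivative g'. -/
lemma integral_max_le_sub {x y : ℝ} (hx : 0 ≤ x) (hxy : x ≤ y) {g g' : ℝ → ℝ}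
    (hg : ContinuousOn g (Icc x y)) (hg' : ∀ ξ ∈ Ioo x y, HasDerivAt g (g' ξ) ξ)
    (hle : ∀ ξ ∈ Ioo x y, max ((1 - Real.cos (b * ξ)) / ξ - ξ / N) 0 ≤ g' ξ) :
    ∫ ξ in x..y, max ((1 - Real.cos (b * ξ)) / ξ - ξ / N) 0 ≤ g y - g x :=
  intervalIntegral.integral_le_sub_of_hasDeriv_right_of_le hxy hg
    (fun ξ hξ => (hg' ξ hξ).hasDerivWithinAt) (integrableOn_max_one_sub_cos_div b N x y hx) hle

lemma integral_max_split {x y : ℝ} (hx : 0 ≤ x) (hxy : x ≤ y) :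
    ∫ ξ in (0 : ℝ)..y, max ((1 - Real.cos (b * ξ)) / ξ - ξ / N) 0 =
      (∫ ξ in (0 : ℝ)..x, max ((1 - Real.cos (b * ξ)) / ξ - ξ / N) 0) +
        ∫ ξ in x..y, max ((1 - Real.cos (b * ξ)) / ξ - ξ / N) 0 := by
  rw [intervalIntegral.integral_add_adjacent_intervals]
  · exact (intervalIntegrable_iff_integrableOn_Icc_of_le hx).2
      (integrableOn_max_one_sub_cos_div b N 0 x le_rfl)
  · exact (intervalIntegrable_iff_integrableOn_Icc_of_le hxy).2
      (integrableOn_max_one_sub_cos_div b N x y hx)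

lemma hasDerivAt_half_sq (x : ℝ) : HasDerivAt (fun y : ℝ => y ^ 2 / 2) x x := by
  have h := (hasDerivAt_pow 2 x).div_const 2
  norm_num at h
  exact h

/-- Split at 2/b, where the bounds b²ξ/2 and 2/ξ for (1 - cos bξ)/ξ cross. This is sharp enough for
moderate b²N. -/
lemma integral_max_le_log (hb : 0 < b) (hNpos : 0 < N) (hs : 2 ≤ b ^ 2 * N) :
    ∫ ξ in (0 : ℝ)..√(2 * N), max ((1 - Real.cos (b * ξ)) / ξ - ξ / N) 0 ≤
      Real.log (b ^ 2 * N / 2) := by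
  set R := √(2 * N) with hRdef
  have hR : 0 < R := Real.sqrt_pos.2 (by positivity)
  have hR2 : R ^ 2 = 2 * N := Real.sq_sqrt (by positivity)
  have hle : 2 / b ≤ R := by
    refine Real.le_sqrt_of_sq_le ?_
    rw [div_pow, div_le_iff₀ (by positivity)]
    linarith
  have hb2 : 1 / N ≤ b ^ 2 / 2 := by
    rw [div_le_div_iff₀ hNpos two_pos]; linarith
  rw [integral_max_split (by positivity) hle]
  have h1 := integral_max_le_sub (b := b) (N := N) le_rfl (show 0 ≤ 2 / b by positivity)
    (g := fun ξ => (b ^ 2 / 2 - 1 / N) * (ξ ^ 2 / 2)) (g' := fun ξ => (b ^ 2 / 2 - 1 / N) * ξ)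
    (by fun_prop)
    (fun ξ _ => (hasDerivAt_half_sq ξ).const_mul _)
    (fun ξ hξ => max_le (by
      have := one_sub_cos_div_le_mul (b := b) hξ.1
      have e : ξ / N = 1 / N * ξ := by ring
      rw [e]; linarith) (mul_nonneg (by linarith) hξ.1.le))
  have h2 := integral_max_le_sub (b := b) (N := N) (show 0 ≤ 2 / b by positivity) hle
    (g := fun ξ => 2 * Real.log ξ - ξ ^ 2 / 2 / N) (g' := fun ξ => 2 / ξ - ξ / N)
    (by
      have hne : ∀ ξ ∈ Icc (2 / b) R, ξ ≠ 0 := fun ξ hξ =>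
        ((show (0 : ℝ) < 2 / b by positivity).trans_le hξ.1).ne'
      exact ContinuousOn.sub ((continuousOn_id.log hne).const_mul 2 |>.congr fun _ _ => rfl)
        (by fun_prop))
    (fun ξ hξ => by
      have hξ0 : 0 < ξ := (show (0 : ℝ) < 2 / b by positivity).trans hξ.1
      exact ((Real.hasDerivAt_log hξ0.ne').const_mul 2).sub ((hasDerivAt_half_sq ξ).div_const N))
    (fun ξ hξ => by
      have hξ0 : 0 < ξ := (show (0 : ℝ) < 2 / b by positivity).trans hξ.1
      refine max_le (by linarith [one_sub_cos_div_le_div (b := b) hξ0]) ?_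
      rw [sub_nonneg, div_le_div_iff₀ hNpos hξ0, ← hR2]
      nlinarith [hξ.2])
  have e : Real.log (b ^ 2 * N / 2) = 2 * Real.log R - 2 * Real.log (2 / b) := by
    rw [← mul_sub, ← Real.log_div hR.ne' (by positivity), ← Real.log_rpow (by positivity)]
    congr 1
    norm_num [div_pow, hR2]
    field_simp
    norm_num
  -- The quadratic contributions cancel exactly, leaving only the logarithm.
  have e2 : (b ^ 2 / 2 - 1 / N) * ((2 / b) ^ 2 / 2) - (R ^ 2 / 2 / N - (2 / b) ^ 2 / 2 / N) = 0 := by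
    rw [hR2]; field_simp; ring
  rw [e]
  have e3 : (b ^ 2 / 2 - 1 / N) * ((0 : ℝ) ^ 2 / 2) = 0 := by ring
  linarith

/-- For large b²N the oscillation of cos must be used: its mean is 0, so 1/ξ replaces 2/ξ and the
coefficient of the logarithm is halved, at the price of an additive constant. -/
lemma integral_max_le_log_add (hb : 0 < b) (hNpos : 0 < N) (hs : 1 ≤ b ^ 2 * N) :
    ∫ ξ in (0 : ℝ)..√(2 * N), max ((1 - Real.cos (b * ξ)) / ξ - ξ / N) 0 ≤
      Real.log (b ^ 2 * N) / 2 + 3 := by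
  set R := √(2 * N) with hRdef
  have hR : 0 < R := Real.sqrt_pos.2 (by positivity)
  have hR2 : R ^ 2 = 2 * N := Real.sq_sqrt (by positivity)
  have hle : 1 / b ≤ R := by
    refine Real.le_sqrt_of_sq_le ?_
    rw [div_pow, div_le_iff₀ (by positivity)]
    linarith
  have hmax : ∀ ξ, 0 < ξ → max ((1 - Real.cos (b * ξ)) / ξ - ξ / N) 0 ≤
      (1 - Real.cos (b * ξ)) / ξ := fun ξ hξ =>
    max_le (by have : 0 ≤ ξ / N := by positivity
               linarith) (one_sub_cos_div_nonneg hξ)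
  rw [integral_max_split (by positivity) hle]
  have h1 := integral_max_le_sub (b := b) (N := N) le_rfl (show 0 ≤ 1 / b by positivity)
    (g := fun ξ => b ^ 2 / 2 * (ξ ^ 2 / 2)) (g' := fun ξ => b ^ 2 / 2 * ξ)
    (by fun_prop)
    (fun ξ _ => (hasDerivAt_half_sq ξ).const_mul _)
    (fun ξ hξ => (hmax ξ hξ.1).trans (one_sub_cos_div_le_mul hξ.1))
  have hpos : ∀ ξ ∈ Icc (1 / b) R, 0 < ξ := fun ξ hξ =>
        ((show (0 : ℝ) < 1 / b by positivity).trans_le hξ.1)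
  -- The sine term is the primitive of cos(bξ)/ξ to leading order. The added 1 makes the leftover
  -- (sin bξ + 1)/(bξ²) nonnegative, so g' dominates the integrand.
  have h2 := integral_max_le_sub (b := b) (N := N) (show 0 ≤ 1 / b by positivity) hle
    (g := fun ξ => Real.log ξ - (Real.sin (b * ξ) + 1) / (b * ξ))
    (g' := fun ξ => 1 / ξ - (Real.cos (b * ξ) * b * (b * ξ) - (Real.sin (b * ξ) + 1) * b) /
      (b * ξ) ^ 2)
    (by
      refine ContinuousOn.sub (continuousOn_id.log fun ξ hξ => (hpos ξ hξ).ne') ?_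
      exact ContinuousOn.div (by fun_prop) (by fun_prop) fun ξ hξ => by
        have := hpos ξ hξ; positivity)
    (fun ξ hξ => by
      have hξ0 : 0 < ξ := hpos ξ (Ioo_subset_Icc_self hξ)
      have hl : HasDerivAt (fun ξ => b * ξ) b ξ := by simpa using (hasDerivAt_id ξ).const_mul b
      have h := (Real.hasDerivAt_log hξ0.ne').sub ((hl.sin.add_const 1).div hl (by positivity))
      rw [one_div]
      exact h)
    (fun ξ hξ => by
      have hξ0 : 0 < ξ := hpos ξ (Ioo_subset_Icc_self hξ)
      refine (hmax ξ hξ0).trans ?_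
      have e : 1 / ξ - (Real.cos (b * ξ) * b * (b * ξ) - (Real.sin (b * ξ) + 1) * b) /
          (b * ξ) ^ 2 = (1 - Real.cos (b * ξ)) / ξ + (Real.sin (b * ξ) + 1) / (b * ξ ^ 2) := by
        field_simp; ring
      rw [e]
      have := Real.neg_one_le_sin (b * ξ)
      have : 0 ≤ (Real.sin (b * ξ) + 1) / (b * ξ ^ 2) := div_nonneg (by linarith) (by positivity)
      linarith)
  have e1 : b ^ 2 / 2 * ((1 / b) ^ 2 / 2) = 1 / 4 := by field_simp; norm_num
  have e2 : b * (1 / b) = 1 := by field_simp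
  have e3 : Real.log R - Real.log (1 / b) = Real.log (b ^ 2 * N) / 2 + Real.log 2 / 2 := by
    rw [← Real.log_div hR.ne' (by positivity)]
    have : Real.log (b ^ 2 * N) + Real.log 2 = 2 * Real.log (R / (1 / b)) := by
      rw [← Real.log_mul (by positivity) (by positivity), ← Real.log_rpow (by positivity)]
      congr 1
      norm_num [mul_pow, hR2]
      ring
    linarith
  have h5 : 0 ≤ (Real.sin (b * R) + 1) / (b * R) :=
    div_nonneg (by linarith [Real.neg_one_le_sin (b * R)]) (by positivity)
  rw [e1] at h1
  rw [e2] at h2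
  have := Real.sin_le_one 1
  have := Real.log_two_lt_d9
  have e4 : b ^ 2 / 2 * ((0 : ℝ) ^ 2 / 2) = 0 := by ring
  rw [div_one] at h2
  linarith

/-- Comparison of the bounds on `∫₀^∞ n(ξ) (1 - cos bξ) / ξ dξ` with the right-hand side. -/
lemma integral_mul_one_sub_cos_div_le_half_log (hn0 : ∀ ξ, 0 ≤ n ξ)
    (hn1 : ∀ ξ, 0 < ξ → n ξ ≤ 1)
    (hnm : Measurable n) (hi : IntegrableOn (fun ξ => n ξ * ξ) (Ioi 0))
    (hN : ∫ ξ in Ioi (0 : ℝ), n ξ * ξ = N) (hNpos : 0 < N) (hb : 0 < b) (hs : 1 ≤ b ^ 2 * N) :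
    ∫ ξ in Ioi (0 : ℝ), n ξ * ((1 - Real.cos (b * ξ)) / ξ) ≤
      19 / 20 * (1 + Real.log (b ^ 2 * N)) := by
  set s := b ^ 2 * N with hsdef
  have hs0 : 0 < s := by positivity
  -- For s ≤ 2 the quadratic bound s/2 is enough, because log s ≥ 1 - 1/s ≥ (s - 1)/2 on [1,2].
  rcases le_total s 2 with h | h
  · refine (integral_mul_one_sub_cos_div_le hn0 hnm hi hN b).trans ?_
    have h1 := Real.one_sub_inv_le_log_of_pos hs0
    have h2 : s⁻¹ ≤ 1 := inv_le_one_of_one_le₀ hs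
    have h3 : s⁻¹ ≤ (3 - s) / 2 := by
      rw [inv_le_iff_one_le_mul₀ hs0]; nlinarith
    rw [← hsdef]
    linarith
  · have hA := integral_mul_one_sub_cos_div_le_one_add (b := b) hn0 hn1 hnm hi hN hNpos
    -- The bound 1 + log s - log 2 works up to about log s = 12.8, and 4 + (log s)/2 works from
    -- about 6.8 on; 12 lies in the overlap.
    rcases le_total (Real.log s) 12 with h' | h'
    · have := integral_max_le_log hb hNpos h
      rw [← hsdef, Real.log_div hs0.ne' two_ne_zero] at this
      have := Real.log_two_gt_d9
      linarith
    · have := integral_max_le_log_add hb hNpos hs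
      rw [← hsdef] at this
      linarith

end LogBounds

/-! ### Comparison with the primitive of min(u,1/u) -/

/-- `∫₀^x min(u, 1/u) du`. -/
noncomputable def minPrimitive (x : ℝ) : ℝ := ∫ u in (0 : ℝ)..x, min u (1 / u)

lemma intervalIntegrable_min (x y : ℝ) (hx : 0 ≤ x) (hxy : x ≤ y) :
    IntervalIntegrable (fun u : ℝ => min u (1 / u)) volume x y := by
  rw [intervalIntegrable_iff_integrableOn_Ioc_of_le hxy]
  refine Integrable.mono' (g := fun u => u) ?_ (Measurable.aestronglyMeasurable (by fun_prop)) ?_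
  · exact (Continuous.integrableOn_Icc (by fun_prop)).mono_set Ioc_subset_Icc_self
  · refine (ae_restrict_iff' measurableSet_Ioc).2 (Eventually.of_forall fun u hu => ?_)
    have hu0 : 0 < u := hx.trans_lt hu.1
    rw [Real.norm_of_nonneg (by positivity)]
    exact min_le_left _ _

lemma minPrimitive_of_le_one {x : ℝ} (h0 : 0 ≤ x) (h1 : x ≤ 1) : minPrimitive x = x ^ 2 / 2 := by
  have : minPrimitive x = ∫ u in (0 : ℝ)..x, u := by
    refine intervalIntegral.integral_congr_ae (Eventually.of_forall fun u hu => ?_)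
    rw [uIoc_of_le h0] at hu
    have hu0 := hu.1
    exact min_eq_left (by rw [le_div_iff₀ hu0]; nlinarith [hu.2])
  rw [this, integral_id]
  ring

lemma minPrimitive_of_one_le {x : ℝ} (h1 : 1 ≤ x) : minPrimitive x = 1 / 2 + Real.log x := by
  have h : minPrimitive x = minPrimitive 1 + ∫ u in (1 : ℝ)..x, min u (1 / u) :=
    (intervalIntegral.integral_add_adjacent_intervals
      (intervalIntegrable_min 0 1 le_rfl zero_le_one)
      (intervalIntegrable_min 1 x zero_le_one h1)).symm
  have h2 : ∫ u in (1 : ℝ)..x, min u (1 / u) = ∫ u in (1 : ℝ)..x, 1 / u := by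
    refine intervalIntegral.integral_congr_ae (Eventually.of_forall fun u hu => ?_)
    rw [uIoc_of_le h1] at hu
    have hu0 : 0 < u := one_pos.trans hu.1
    exact min_eq_right (by rw [div_le_iff₀ hu0]; nlinarith [hu.1])
  rw [h, h2, minPrimitive_of_le_one zero_le_one le_rfl, integral_one_div_of_pos one_pos (by linarith)]
  norm_num

/-- The right-hand side dominates `½ N b²` when `b ≤ 1` or `N b² ≤ 1`. -/
lemma half_sq_le_minPrimitive {Z N b x : ℝ} (hZ : 1 ≤ Z) (hNZ : N ≤ Z) (hx : 0 ≤ x)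
    (hxb : x ≤ b) (h : b ≤ 1 ∨ b ^ 2 * N ≤ 1) :
    b ^ 2 * N / 2 ≤ Z * (minPrimitive b - minPrimitive x) + N * x ^ 2 / 2 := by
  rcases le_or_gt b 1 with hb | hb
  · rw [minPrimitive_of_le_one (hx.trans hxb) hb, minPrimitive_of_le_one hx (hxb.trans hb)]
    nlinarith [mul_le_mul_of_nonneg_right hNZ (show 0 ≤ b ^ 2 - x ^ 2 by nlinarith)]
  have hb0 : 0 < b := by linarith
  have hs : b ^ 2 * N ≤ 1 := h.resolve_left hb.not_ge
  have hN' : N ≤ (b ^ 2)⁻¹ := by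
    rw [← one_div, le_div_iff₀ (by positivity), mul_comm]; exact hs
  rw [minPrimitive_of_one_le hb.le]
  rcases le_total x 1 with hx1 | hx1
  · rw [minPrimitive_of_le_one hx hx1]
    -- With N ≤ b⁻² this gives N(b² - 1) ≤ 1 - b⁻² ≤ 2 log b. The remaining part of b²N, up to
    -- radius 1, is handled by N ≤ Z.
    have h1 := Real.one_sub_inv_le_log_of_pos (show 0 < b ^ 2 by positivity)
    rw [Real.log_pow] at h1
    have h2 : N * (b ^ 2 - 1) ≤ 1 - (b ^ 2)⁻¹ := by
      have := mul_le_mul_of_nonneg_right hN' (show 0 ≤ b ^ 2 - 1 by nlinarith)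
      refine this.trans (le_of_eq ?_)
      field_simp
    have h3 : Real.log b ≤ Z * Real.log b := le_mul_of_one_le_left (Real.log_nonneg hb.le) hZ
    have h4 := mul_le_mul_of_nonneg_right hNZ (show 0 ≤ 1 - x ^ 2 by nlinarith)
    push_cast at h1
    linarith
  · rw [minPrimitive_of_one_le hx1]
    have hx0 : 0 < x := by linarith
    have h1 := Real.one_sub_inv_le_log_of_pos (show 0 < (b / x) ^ 2 by positivity)
    rw [Real.log_pow, Real.log_div hb0.ne' hx0.ne'] at h1
    have h2 : N * (b ^ 2 - x ^ 2) ≤ 1 - ((b / x) ^ 2)⁻¹ := by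
      have := mul_le_mul_of_nonneg_right hN' (show 0 ≤ b ^ 2 - x ^ 2 by nlinarith)
      refine this.trans (le_of_eq ?_)
      field_simp
    have h3 : Real.log b - Real.log x ≤ Z * (Real.log b - Real.log x) :=
      le_mul_of_one_le_left (sub_nonneg.2 (Real.log_le_log hx0 hxb)) hZ
    push_cast at h1
    linarith

/-- The inequality log w ≤ w - 1 absorbs the dependence on N: it is applied to w = N if x ≤ 1 and to
w = Nx² if x ≥ 1. The logarithm of b is covered by the primitive since Z ≥ 1. -/
lemma half_log_le_minPrimitive {Z N b x : ℝ} (hZ : 1 ≤ Z) (hNZ : N ≤ Z) (hN : 0 < N) (hx : 0 ≤ x)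
    (hxb : x ≤ b) (hb : 1 ≤ b) :
    (1 + Real.log (b ^ 2 * N)) / 2 ≤ Z * (minPrimitive b - minPrimitive x) + N * x ^ 2 / 2 := by
  have hb0 : 0 < b := by linarith
  rw [minPrimitive_of_one_le hb, Real.log_mul (by positivity) hN.ne', Real.log_pow]
  push_cast
  rcases le_total x 1 with hx1 | hx1
  · rw [minPrimitive_of_le_one hx hx1]
    have h1 := Real.log_le_sub_one_of_pos hN
    have h3 : Real.log b ≤ Z * Real.log b := le_mul_of_one_le_left (Real.log_nonneg hb) hZ
    have h4 := mul_le_mul_of_nonneg_right hNZ (show 0 ≤ 1 - x ^ 2 by nlinarith)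
    linarith
  · rw [minPrimitive_of_one_le hx1]
    have hx0 : 0 < x := by linarith
    have h1 := Real.log_le_sub_one_of_pos (show 0 < N * x ^ 2 by positivity)
    rw [Real.log_mul hN.ne' (by positivity), Real.log_pow] at h1
    have h3 : Real.log b - Real.log x ≤ Z * (Real.log b - Real.log x) :=
      le_mul_of_one_le_left (sub_nonneg.2 (Real.log_le_log hx0 hxb)) hZ
    push_cast at h1
    linarith

lemma minPrimitive_mono {x y : ℝ} (hx : 0 ≤ x) (hxy : x ≤ y) : minPrimitive x ≤ minPrimitive y := by
  have h : minPrimitive y = minPrimitive x + ∫ u in x..y, min u (1 / u) :=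
    (intervalIntegral.integral_add_adjacent_intervals
      (intervalIntegrable_min 0 x le_rfl hx) (intervalIntegrable_min x y hx hxy)).symm
  rw [h]
  have : 0 ≤ ∫ u in x..y, min u (1 / u) := intervalIntegral.integral_nonneg hxy fun u hu => by
    have := hx.trans hu.1
    positivity
  linarith

/-- The main estimate on `∫₀^∞ n(ξ) (1 - cos bξ) / ξ dξ`; the constant `19/10` is strictly less
than the constant `2` provided by an integration by parts. -/
lemma integral_mul_one_sub_cos_div_le_minPrimitive {n : ℝ → ℝ} {N Z b x : ℝ} (hn0 : ∀ ξ, 0 ≤ n ξ)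
    (hn1 : ∀ ξ, 0 < ξ → n ξ ≤ 1)
    (hnm : Measurable n) (hi : IntegrableOn (fun ξ => n ξ * ξ) (Ioi 0))
    (hN : ∫ ξ in Ioi (0 : ℝ), n ξ * ξ = N) (hNpos : 0 < N) (hZ : 1 ≤ Z) (hNZ : N ≤ Z)
    (hx : 0 ≤ x) (hxb : x ≤ b) :
    ∫ ξ in Ioi (0 : ℝ), n ξ * ((1 - Real.cos (b * ξ)) / ξ) ≤
      19 / 10 * (Z * (minPrimitive b - minPrimitive x) + N * x ^ 2 / 2) := by
  have hR : 0 ≤ Z * (minPrimitive b - minPrimitive x) + N * x ^ 2 / 2 := by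
    have := minPrimitive_mono hx hxb
    have : 0 ≤ Z * (minPrimitive b - minPrimitive x) := mul_nonneg (by linarith) (by linarith)
    positivity
  -- In the first regime the quadratic bound is within factor 1 of the right-hand side. In the
  -- second the factor is 2 · 19/20.
  by_cases h : b ≤ 1 ∨ b ^ 2 * N ≤ 1
  · have h1 := half_sq_le_minPrimitive hZ hNZ hx hxb h
    have h2 := integral_mul_one_sub_cos_div_le hn0 hnm hi hN b
    linarith
  · push Not at h
    have h1 := half_log_le_minPrimitive hZ hNZ hNpos hx hxb h.1.le
    have h2 := integral_mul_one_sub_cos_div_le_half_log hn0 hn1 hnm hi hN hNpos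
      (by linarith [h.1]) h.2.le
    linarith

/-! ### The contribution of `b₂*` -/

section Tail

variable {μ₀ : Measure ℝ} [IsProbabilityMeasure μ₀] {c₀ α D η : ℝ}

/-- A layer-cake formula for the tail measure `m` of `S*`. -/
lemma lintegral_minPrimitive_sub_le (hc : 0 < c₀) (h0 : 0 < α) (h2 : α < 2) (hD : 0 < D)
    (hlim : Tendsto (fun x : ℝ => x ^ α * (1 - evenCdf μ₀ x)) atTop (𝓝 c₀))
    {m : Measure ℝ} [IsFiniteMeasure m]
    (hm : ∀ x, D ≤ x → m.real (Ioi x) = |sStar μ₀ c₀ α x|) {q : ℝ} (hq : 0 < q) :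
    ∫⁻ y in Ioi D, ENNReal.ofReal (minPrimitive (q * y) - minPrimitive (q * D)) ∂m ≤
      ENNReal.ofReal (q ^ α * (hOne μ₀ c₀ α q + hThree μ₀ c₀ α q)) := by
  -- Written as an integral over u with the indicator of u/q < y, the expression is ready for
  -- Tonelli, which produces the tail m(u/q,∞).
  have e1 : ∀ y ∈ Ioi D, ENNReal.ofReal (minPrimitive (q * y) - minPrimitive (q * D)) =
      ∫⁻ u in Ioi (q * D), (Ioi (u / q)).indicator (fun _ => ENNReal.ofReal (min u (1 / u))) y := by
    intro y hy
    have hy' : q * D ≤ q * y := mul_le_mul_of_nonneg_left (le_of_lt hy) hq.le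
    have hqD : 0 < q * D := by positivity
    have h : minPrimitive (q * y) - minPrimitive (q * D) =
        ∫ u in Ioo (q * D) (q * y), min u (1 / u) := by
      rw [← integral_Ioc_eq_integral_Ioo, ← intervalIntegral.integral_of_le hy', minPrimitive,
        minPrimitive, intervalIntegral.integral_interval_sub_left]
      · exact intervalIntegrable_min 0 _ le_rfl (hqD.le.trans hy')
      · exact intervalIntegrable_min 0 _ le_rfl hqD.le
    rw [h, ofReal_integral_eq_lintegral_ofReal]
    · rw [← Ioi_inter_Iio, inter_comm, ← Measure.restrict_restrict measurableSet_Iio, ← lintegral_indicator measurableSet_Iio]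
      refine lintegral_congr fun u => ?_
      simp only [indicator, mem_Iio, mem_Ioi, div_lt_iff₀ hq, mul_comm q]
    · exact ((intervalIntegrable_iff_integrableOn_Ioc_of_le hy').1
        (intervalIntegrable_min _ _ hqD.le hy')).mono_set Ioo_subset_Ioc_self
    · refine (ae_restrict_iff' measurableSet_Ioo).2 (Eventually.of_forall fun u hu => ?_)
      have : 0 < u := hqD.trans hu.1
      simp only [Pi.zero_apply]
      positivity
  rw [setLIntegral_congr_fun measurableSet_Ioi e1, ← lintegral_min_sStar hc h0 h2 hlim hq,
    lintegral_lintegral_swap]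
  -- On u > qD one has u/q ≥ D, so the tail is |S*(u/q)|. Enlarging the domain to u > 0 yields H₁* +
  -- H₃*.
  · refine le_trans (le_of_eq ?_) (lintegral_mono_set (Ioi_subset_Ioi
      (show (0 : ℝ) ≤ q * D by positivity)))
    refine setLIntegral_congr_fun measurableSet_Ioi fun u hu => ?_
    have hDu : D ≤ u / q := by
      rw [le_div_iff₀ hq, mul_comm]; exact (mem_Ioi.1 hu).le
    have hu0 : 0 < u := (show 0 < q * D by positivity).trans hu
    rw [lintegral_indicator measurableSet_Ioi, Measure.restrict_restrict measurableSet_Ioi,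
      setLIntegral_const, inter_eq_self_of_subset_left (Ioi_subset_Ioi hDu),
      ENNReal.ofReal_mul (by positivity), ← hm _ hDu, ofReal_measureReal]
  · refine Measurable.aemeasurable ?_
    have hms : MeasurableSet {z : ℝ × ℝ | z.2 / q < z.1} :=
      measurableSet_lt (by fun_prop) (by fun_prop)
    have : Measurable fun z : ℝ × ℝ => {z : ℝ × ℝ | z.2 / q < z.1}.indicator
        (fun z => ENNReal.ofReal (min z.2 (1 / z.2))) z :=
      (Measurable.ennreal_ofReal (by fun_prop)).indicator hms
    exact this

lemma measurable_bTwo : Measurable (bTwo μ₀ c₀ α D) := by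
  have h1 : Measurable fun x => ∫ y in Ioi D, (1 - Real.cos (x * y)) ∂(evenPart μ₀) :=
    (StronglyMeasurable.integral_prod_right'
      (f := fun z : ℝ × ℝ => 1 - Real.cos (z.1 * z.2))
      (Measurable.stronglyMeasurable (by fun_prop))).measurable
  have h2 : Measurable fun x => ∫ y in Ioi D, (1 - Real.cos (x * y)) * (α * c₀ * y ^ (-α - 1)) :=
    (StronglyMeasurable.integral_prod_right'
      (f := fun z : ℝ × ℝ => (1 - Real.cos (z.1 * z.2)) * (α * c₀ * z.2 ^ (-α - 1)))
      (Measurable.stronglyMeasurable (by fun_prop))).measurable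
  unfold bTwo stieltjesSStar
  fun_prop

/-- The constant sign of dS* gives |b₂*(x)| = 2∫(1 - cos xy)m(dy) with m positive, and Tonelli moves
the ξ-integral inside. The estimate with b = qy and x = qD leaves a difference of primitives, which
the layer-cake bound turns into q^α(H₁*+H₃*), and N₂(qD)²/2, which is multiplied by the total mass
|S*(D)|. -/
lemma lintegral_bTwo_le (hc : 0 < c₀) (h0 : 0 < α) (h2 : α < 2) (hD : 0 < D)
    (hlim : Tendsto (fun x : ℝ => x ^ α * (1 - evenCdf μ₀ x)) atTop (𝓝 c₀))
    (hmono : MonotoneOn (sStar μ₀ c₀ α) (Ici D) ∨ AntitoneOn (sStar μ₀ c₀ α) (Ici D))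
    (hη : η < scaleA c₀ α) {q : ℝ} (hq : 0 < q) :
    ∫⁻ ξ in Ioi (0 : ℝ), ENNReal.ofReal
        (Real.exp (-((scaleA c₀ α - η) * ξ ^ α)) * |bTwo μ₀ c₀ α D (q * ξ)| / ξ) ≤
      ENNReal.ofReal (19 / 10 * (2 * zConst c₀ α η 0 * (q ^ α * (hOne μ₀ c₀ α q + hThree μ₀ c₀ α q))
        + |sStar μ₀ c₀ α D| * D ^ 2 * constN c₀ α η 2 * q ^ 2)) := by
  obtain ⟨σ, m, hσ, hfin, hm0, hm, hst⟩ := exists_stieltjes_sStar hc h0 hD hlim hmono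
  set n : ℝ → ℝ := fun ξ => Real.exp (-((scaleA c₀ α - η) * ξ ^ α)) with hn
  have ha := sub_pos.2 hη
  have hn0 : ∀ ξ, 0 ≤ n ξ := fun ξ => (Real.exp_pos _).le
  have hn1 : ∀ ξ, 0 < ξ → n ξ ≤ 1 := fun ξ hξ => Real.exp_le_one_iff.2 (by
    have : 0 ≤ (scaleA c₀ α - η) * ξ ^ α := by positivity
    linarith)
  have hnm : Measurable n := by fun_prop
  have hi : IntegrableOn (fun ξ => n ξ * ξ) (Ioi 0) := by
    have := integrableOn_constN (c₀ := c₀) (η := η) h0 two_pos hη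
    norm_num at this
    exact this
  have hN : ∫ ξ in Ioi (0 : ℝ), n ξ * ξ = constN c₀ α η 2 := by
    unfold constN; norm_num [hn]
  have hb : ∀ x, |bTwo μ₀ c₀ α D x| ≤ 2 * ∫ y, (1 - Real.cos (x * y)) ∂m := by
    intro x
    have hcos : ∀ y, 0 ≤ 1 - Real.cos (x * y) := fun y => by linarith [Real.cos_le_one (x * y)]
    rw [bTwo, hst (fun y => 1 - Real.cos (x * y)) 2 (by fun_prop) (fun y => by
      rw [abs_of_nonneg (hcos y)]; linarith [Real.neg_one_le_cos (x * y)]), abs_mul, abs_neg,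
      abs_neg, abs_mul, hσ, one_mul, abs_of_nonneg (integral_nonneg hcos)]
    simp
  have hmD : ∀ᵐ y ∂m, y ∈ Ioi D := by
    rw [ae_iff]
    simp only [mem_Ioi, not_lt]
    exact hm0
  have hmr : m.restrict (Ioi D) = m := Measure.restrict_eq_self_of_ae_mem hmD
  have hcosi : ∀ x, Integrable (fun y => 1 - Real.cos (x * y)) m := fun x =>
    Integrable.of_bound (Measurable.aestronglyMeasurable (by fun_prop)) 2
      (Eventually.of_forall fun y => by
        rw [Real.norm_eq_abs, abs_le]
        constructor <;> linarith [Real.cos_le_one (x * y), Real.neg_one_le_cos (x * y)])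
  calc _ ≤ ∫⁻ ξ in Ioi (0 : ℝ), ∫⁻ y, ENNReal.ofReal
        (2 * (n ξ * ((1 - Real.cos (q * y * ξ)) / ξ))) ∂m := by
        refine setLIntegral_mono' measurableSet_Ioi fun ξ hξ => ?_
        have hξ0 : (0 : ℝ) < ξ := hξ
        rw [← ofReal_integral_eq_lintegral_ofReal]
        · refine ENNReal.ofReal_le_ofReal ?_
          rw [integral_const_mul, integral_const_mul, integral_div]
          have := hb (q * ξ)
          have e : ∫ y, (1 - Real.cos (q * ξ * y)) ∂m = ∫ y, (1 - Real.cos (q * y * ξ)) ∂m := by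
            congr 1 with y; ring_nf
          rw [e] at this
          calc n ξ * |bTwo μ₀ c₀ α D (q * ξ)| / ξ
              ≤ n ξ * (2 * ∫ y, (1 - Real.cos (q * y * ξ)) ∂m) / ξ := by
                gcongr
            _ = _ := by ring
        · refine Integrable.const_mul (Integrable.const_mul (Integrable.div_const ?_ _) _) _
          exact (hcosi (q * ξ)).congr (Eventually.of_forall fun y => by ring_nf)
        · refine Eventually.of_forall fun y => ?_
          have := one_sub_cos_div_nonneg (b := q * y) hξ0
          have := hn0 ξ
          simp only [Pi.zero_apply]
          positivity
    _ = ∫⁻ y, (∫⁻ ξ in Ioi (0 : ℝ), ENNReal.ofReal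
        (2 * (n ξ * ((1 - Real.cos (q * y * ξ)) / ξ)))) ∂m := by
        rw [lintegral_lintegral_swap]
        exact (Measurable.ennreal_ofReal (by fun_prop)).aemeasurable
    _ = ∫⁻ y in Ioi D, (∫⁻ ξ in Ioi (0 : ℝ), ENNReal.ofReal
        (2 * (n ξ * ((1 - Real.cos (q * y * ξ)) / ξ)))) ∂m := by rw [hmr]
    _ ≤ ∫⁻ y in Ioi D, (ENNReal.ofReal (19 / 10 * 2 * zConst c₀ α η 0) *
          ENNReal.ofReal (minPrimitive (q * y) - minPrimitive (q * D)) +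
          ENNReal.ofReal (19 / 10 * constN c₀ α η 2 * (q * D) ^ 2)) ∂m := by
        refine setLIntegral_mono' measurableSet_Ioi fun y hy => ?_
        have hy0 : D < y := hy
        rw [← ofReal_integral_eq_lintegral_ofReal
          ((integrableOn_mul_one_sub_cos_div hn0 hnm hi (q * y)).const_mul 2)]
        · have hN0 := constN_pos (c₀ := c₀) (η := η) h0 two_pos hη
          have hZ := one_le_zConst h0 hη
          have hle : q * D ≤ q * y := by gcongr
          have := minPrimitive_mono (by positivity) hle
          rw [← ENNReal.ofReal_mul (by linarith), ← ENNReal.ofReal_add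
            (mul_nonneg (by linarith) (by linarith)) (by positivity)]
          refine ENNReal.ofReal_le_ofReal ?_
          rw [integral_const_mul]
          have := integral_mul_one_sub_cos_div_le_minPrimitive (b := q * y) (x := q * D) hn0 hn1 hnm
            hi hN hN0 hZ (constN_two_le_zConst h0 hη) (by positivity) hle
          linarith
        · refine (ae_restrict_iff' measurableSet_Ioi).2 (Eventually.of_forall fun ξ hξ => ?_)
          have := one_sub_cos_div_nonneg (b := q * y) hξ
          have := hn0 ξ
          simp only [Pi.zero_apply]
          positivity
    _ ≤ _ := by
        have hN0 := constN_pos (c₀ := c₀) (η := η) h0 two_pos hη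
        have hZ := one_le_zConst h0 hη
        have hH := add_nonneg (hOne_nonneg μ₀ c₀ α q) (hThree_nonneg μ₀ c₀ α q)
        rw [lintegral_add_right _ measurable_const, setLIntegral_const, lintegral_const_mul'
          _ _ ENNReal.ofReal_ne_top, ← ofReal_measureReal (measure_ne_top m _), hm D le_rfl,
          ← ENNReal.ofReal_mul (by positivity)]
        refine (add_le_add_left (mul_le_mul_right
          (lintegral_minPrimitive_sub_le hc h0 h2 hD hlim hm hq) _) _).trans (le_of_eq ?_)
        rw [← ENNReal.ofReal_mul (by linarith), ← ENNReal.ofReal_add]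
        · congr 1; ring
        · exact mul_nonneg (by linarith) (mul_nonneg (by positivity) hH)
        · positivity

end Tail

/-! ### Products of characteristic functions -/

/-- Four Taylor terms and the remainder x⁵/(1 - x): for x ≤ 3/8 the coefficients 1/2 + 1/8 + 9/256 +
27/320 of x² stay below 4/5. The threshold 3/8 is the one built into d̃. -/
lemma abs_log_one_sub_add_le {x : ℝ} (h0 : 0 ≤ x) (h1 : x ≤ 3 / 8) :
    |Real.log (1 - x) + x| ≤ 4 / 5 * x ^ 2 := by
  have h := Real.abs_log_sub_add_sum_range_le (x := x) (by rw [abs_of_nonneg h0]; linarith) 4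
  simp only [Finset.sum_range_succ, Finset.sum_range_zero] at h
  rw [abs_of_nonneg h0] at h
  have h2 : x ^ (4 + 1) / (1 - x) ≤ 27 / 320 * x ^ 2 := by
    rw [div_le_iff₀ (by linarith)]
    have h3 : x ^ 3 ≤ (3 / 8) ^ 3 := pow_le_pow_left₀ h0 h1 3
    have : x ^ (4 + 1) = x ^ 2 * x ^ 3 := by ring
    rw [this]
    nlinarith [mul_le_mul_of_nonneg_left h3 (sq_nonneg x),
      mul_nonneg (sq_nonneg x) (show 0 ≤ 3 / 8 - x by linarith)]
  have h3 : x ^ 3 ≤ 3 / 8 * x ^ 2 := by nlinarith [sq_nonneg x]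
  have h4 : x ^ 4 ≤ 9 / 64 * x ^ 2 := by
    have : x ^ 2 ≤ 9 / 64 := by nlinarith
    nlinarith [sq_nonneg x]
  have h5 : 0 ≤ x ^ 3 := by positivity
  have h6 : 0 ≤ x ^ 4 := by positivity
  have h7 := sq_nonneg x
  rw [abs_le] at h ⊢
  norm_num at h
  constructor <;> linarith [h.1, h.2]

lemma abs_exp_sub_one_le (z : ℝ) : |Real.exp z - 1| ≤ |z| * Real.exp |z| := by
  rcases le_total 0 z with h | h
  · rw [abs_of_nonneg h, abs_of_nonneg (by linarith [Real.add_one_le_exp z])]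
    have h1 := Real.add_one_le_exp (-z)
    have h2 : Real.exp (-z) * Real.exp z = 1 := by rw [← Real.exp_add]; simp
    nlinarith [Real.exp_pos z]
  · rw [abs_of_nonpos h, abs_of_nonpos (by linarith [Real.exp_le_one_iff.2 h])]
    have h1 := Real.add_one_le_exp z
    have h2 : 1 ≤ Real.exp (-z) := Real.one_le_exp (by linarith)
    nlinarith

section Product

variable {ι : Type*} [Fintype ι] {μ₀ : Measure ℝ} [IsProbabilityMeasure μ₀] {c₀ α D η d : ℝ}

/-- The logarithmic expansion of `∏ Re φ₀(βᵢ ξ)`. -/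
lemma abs_prod_re_charFun_sub_exp_le (h0 : 0 < α)
    (hb : ∃ K : ℝ, ∀ ξ, |vStar μ₀ c₀ α ξ| ≤ K)
    (hη0 : 0 < η) (hη : η < scaleA c₀ α) (hd0 : 0 < d) (hd1 : d < 1)
    (hdη : ∀ x : ℝ, |x| ≤ dTilde μ₀ c₀ α d →
          4 / 5 * bigM μ₀ c₀ α ^ 2 * |x| ^ α + vBar μ₀ c₀ α |x| ≤ η)
    {β : ι → ℝ} (hβ : ∑ i, |β i| ^ α = 1) {ξ : ℝ} (hξ0 : 0 < ξ)
    (hξ : ∀ i, |β i| * ξ ≤ dTilde μ₀ c₀ α d) :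
    |∏ i, (charFun μ₀ (β i * ξ)).re - Real.exp (-(scaleA c₀ α * ξ ^ α))| ≤
      Real.exp (-((scaleA c₀ α - η) * ξ ^ α)) *
        ∑ i, (|vStar μ₀ c₀ α (|β i| * ξ)| * (|β i| * ξ) ^ α +
          4 / 5 * bigM μ₀ c₀ α ^ 2 * (|β i| * ξ) ^ (2 * α)) := by
  set a := scaleA c₀ α
  set M := bigM μ₀ c₀ α with hM
  set v := vStar μ₀ c₀ α with hv
  have hv0 : ∀ x, |v x| ≤ vNorm μ₀ c₀ α := abs_vStar_le_vNorm hb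
  have hMpos : 0 < M := by
    have := (abs_nonneg _).trans (hv0 0)
    rw [hM, bigM]; linarith
  have hr : ∀ i, 0 ≤ |β i| * ξ := fun i => by positivity
  have hrα : ∀ i, 0 ≤ (|β i| * ξ) ^ α := fun i => Real.rpow_nonneg (hr i) _
  set x : ι → ℝ := fun i => (a + v (|β i| * ξ)) * (|β i| * ξ) ^ α with hx
  have hxe : ∀ i, (charFun μ₀ (β i * ξ)).re = 1 - x i := by
    intro i
    have h1 := one_sub_re_charFun_eq μ₀ (c₀ := c₀) h0 (|β i| * ξ)
    rw [abs_of_nonneg (hr i)] at h1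
    have h2 : (charFun μ₀ (|β i| * ξ)).re = (charFun μ₀ (β i * ξ)).re := by
      rcases abs_choice (β i) with h | h
      · rw [h]
      · rw [h, neg_mul, charFun_neg]; simp
    rw [← h2, hx]
    linarith
  have hx0 : ∀ i, 0 ≤ x i := fun i => by
    have := (Complex.re_le_norm _).trans (norm_charFun_le_one (μ := μ₀) (β i * ξ))
    rw [hxe] at this
    linarith
  have hxM : ∀ i, x i ≤ M * (|β i| * ξ) ^ α := fun i => by
    refine mul_le_mul_of_nonneg_right ?_ (hrα i)
    rw [hM, bigM]
    linarith [le_abs_self (v (|β i| * ξ)), hv0 (|β i| * ξ)]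
  have hdt : dTilde μ₀ c₀ α d ^ α = 3 * d / (8 * M) := by
    rw [dTilde, ← Real.rpow_mul (by positivity), one_div, inv_mul_cancel₀ h0.ne', Real.rpow_one]
  -- The definition of d̃ is exactly M d̃^α = 3d/8.
  have hx38 : ∀ i, x i ≤ 3 / 8 := fun i => by
    have h1 : (|β i| * ξ) ^ α ≤ 3 * d / (8 * M) := by
      rw [← hdt]; exact Real.rpow_le_rpow (hr i) (hξ i) h0.le
    calc x i ≤ M * (3 * d / (8 * M)) := (hxM i).trans (by gcongr)
      _ = 3 * d / 8 := by field_simp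
      _ ≤ 3 / 8 := by linarith
  -- The exponent left over after extracting -a₀ξ^α, which is possible because ∑|β_i|^α = 1.
  set z : ℝ := ∑ i, ((Real.log (1 - x i) + x i) - v (|β i| * ξ) * (|β i| * ξ) ^ α) with hz
  have hsum : ∑ i, (|β i| * ξ) ^ α = ξ ^ α := by
    rw [← one_mul (ξ ^ α), ← hβ, Finset.sum_mul]
    exact Finset.sum_congr rfl fun i _ => Real.mul_rpow (abs_nonneg (β i)) hξ0.le
  have hprod : ∏ i, (charFun μ₀ (β i * ξ)).re = Real.exp (-(a * ξ ^ α)) * Real.exp z := by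
    rw [← Real.exp_add, ← hsum, Finset.mul_sum, ← Finset.sum_neg_distrib, hz,
      ← Finset.sum_add_distrib, Real.exp_sum]
    refine Finset.prod_congr rfl fun i _ => ?_
    rw [hxe, ← Real.exp_log (show 0 < 1 - x i by linarith [hx38 i])]
    rw [Real.log_exp, hx]
    congr 1
    ring
  have hsq : ∀ i, (|β i| * ξ) ^ (2 * α) = ((|β i| * ξ) ^ α) ^ 2 := fun i => by
    rw [mul_comm 2, Real.rpow_mul (hr i)]; norm_cast
  have hterm : ∀ i, |(Real.log (1 - x i) + x i) - v (|β i| * ξ) * (|β i| * ξ) ^ α| ≤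
      |v (|β i| * ξ)| * (|β i| * ξ) ^ α + 4 / 5 * M ^ 2 * (|β i| * ξ) ^ (2 * α) := by
    intro i
    refine (abs_sub _ _).trans ?_
    rw [abs_mul, abs_of_nonneg (hrα i), hsq]
    have h1 := abs_log_one_sub_add_le (hx0 i) (hx38 i)
    have h2 : x i ^ 2 ≤ (M * (|β i| * ξ) ^ α) ^ 2 := pow_le_pow_left₀ (hx0 i) (hxM i) 2
    linarith
  have hz1 : |z| ≤ ∑ i, (|v (|β i| * ξ)| * (|β i| * ξ) ^ α +
          4 / 5 * M ^ 2 * (|β i| * ξ) ^ (2 * α)) :=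
    (Finset.abs_sum_le_sum_abs _ _).trans (Finset.sum_le_sum fun i _ => hterm i)
  -- The condition defining d, applied leaf by leaf, lets the factor e^{|z|} be absorbed by
  -- replacing a₀ with a₀ - η.
  have hz2 : |z| ≤ η * ξ ^ α := by
    refine hz1.trans ?_
    rw [← hsum, Finset.mul_sum]
    refine Finset.sum_le_sum fun i _ => ?_
    have h1 := hdη (|β i| * ξ) (by rw [abs_of_nonneg (hr i)]; exact hξ i)
    have h2 := abs_vStar_le_vBar hb (|β i| * ξ)
    rw [abs_of_nonneg (hr i)] at h1 h2
    rw [hsq]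
    nlinarith [mul_le_mul_of_nonneg_right h1 (hrα i), mul_le_mul_of_nonneg_right h2 (hrα i)]
  have e : Real.exp (-((a - η) * ξ ^ α)) = Real.exp (-(a * ξ ^ α)) * Real.exp (η * ξ ^ α) := by
    rw [← Real.exp_add]; congr 1; ring
  rw [hprod, e, ← mul_sub_one, abs_mul, Real.abs_exp, mul_assoc]
  refine mul_le_mul_of_nonneg_left ?_ (Real.exp_pos _).le
  refine (abs_exp_sub_one_le z).trans ?_
  rw [mul_comm]
  exact mul_le_mul (Real.exp_le_exp.2 hz2) hz1 (abs_nonneg z) (Real.exp_pos _).le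

lemma re_charFun_neg (μ : Measure ℝ) (ξ : ℝ) : (charFun μ (-ξ)).re = (charFun μ ξ).re := by
  rw [charFun_neg]; simp

lemma bTwo_zero (μ₀ : Measure ℝ) (c₀ α D : ℝ) : bTwo μ₀ c₀ α D 0 = 0 := by
  simp [bTwo, stieltjesSStar]

/-- The estimate for the lower integral also supplies the integrability on which the Bochner
integral depends. A zero weight is treated apart, its integrand being 0. -/
lemma integrableOn_and_integral_bTwo_le (hc : 0 < c₀) (h0 : 0 < α) (h2 : α < 2) (hD : 0 < D)
    (hlim : Tendsto (fun x : ℝ => x ^ α * (1 - evenCdf μ₀ x)) atTop (𝓝 c₀))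
    (hmono : MonotoneOn (sStar μ₀ c₀ α) (Ici D) ∨ AntitoneOn (sStar μ₀ c₀ α) (Ici D))
    (hη : η < scaleA c₀ α) {q : ℝ} (hq : 0 ≤ q) :
    IntegrableOn (fun ξ => Real.exp (-((scaleA c₀ α - η) * ξ ^ α)) * |bTwo μ₀ c₀ α D (q * ξ)| / ξ)
        (Ioi 0) ∧
      ∫ ξ in Ioi (0 : ℝ), Real.exp (-((scaleA c₀ α - η) * ξ ^ α)) * |bTwo μ₀ c₀ α D (q * ξ)| / ξ ≤
        19 / 10 * (2 * zConst c₀ α η 0 * (q ^ α * (hOne μ₀ c₀ α q + hThree μ₀ c₀ α q))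
          + |sStar μ₀ c₀ α D| * D ^ 2 * constN c₀ α η 2 * q ^ 2) := by
  have hN0 := constN_pos (c₀ := c₀) (η := η) h0 two_pos hη
  have hZ := one_le_zConst h0 hη
  have hH := add_nonneg (hOne_nonneg μ₀ c₀ α q) (hThree_nonneg μ₀ c₀ α q)
  have hrhs : 0 ≤ 19 / 10 * (2 * zConst c₀ α η 0 *
      (q ^ α * (hOne μ₀ c₀ α q + hThree μ₀ c₀ α q))
          + |sStar μ₀ c₀ α D| * D ^ 2 * constN c₀ α η 2 * q ^ 2) := by positivity
  rcases hq.eq_or_lt with rfl | hq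
  · refine ⟨?_, ?_⟩
    · simp [bTwo_zero]
    · simpa only [zero_mul, bTwo_zero, abs_zero, mul_zero, zero_div, integral_zero] using hrhs
  have hle := lintegral_bTwo_le hc h0 h2 hD hlim hmono hη hq
  have hm := measurable_bTwo (μ₀ := μ₀) (c₀ := c₀) (α := α) (D := D)
  have hme : AEStronglyMeasurable (fun ξ => Real.exp (-((scaleA c₀ α - η) * ξ ^ α)) *
      |bTwo μ₀ c₀ α D (q * ξ)| / ξ) (volume.restrict (Ioi 0)) :=
    Measurable.aestronglyMeasurable (by fun_prop)
  have hnn : 0 ≤ᵐ[volume.restrict (Ioi 0)] fun ξ => Real.exp (-((scaleA c₀ α - η) * ξ ^ α)) *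
      |bTwo μ₀ c₀ α D (q * ξ)| / ξ :=
    (ae_restrict_iff' measurableSet_Ioi).2 (Eventually.of_forall fun ξ hξ => by
      have : (0 : ℝ) < ξ := hξ
      simp only [Pi.zero_apply]
      positivity)
  refine ⟨⟨hme, ?_⟩, ?_⟩
  · rw [hasFiniteIntegral_iff_ofReal hnn]
    exact hle.trans_lt ENNReal.ofReal_lt_top
  · rw [integral_eq_lintegral_of_nonneg_ae hnn hme]
    exact ENNReal.toReal_le_of_le_ofReal hrhs hle

lemma bigM_pos {μ₀ : Measure ℝ} (hb : ∃ K : ℝ, ∀ ξ, |vStar μ₀ c₀ α ξ| ≤ K) (ha : 0 < scaleA c₀ α) :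
    0 < bigM μ₀ c₀ α := by
  have := (abs_nonneg _).trans (abs_vStar_le_vNorm hb 0)
  rw [bigM]
  linarith

lemma dTilde_pos {μ₀ : Measure ℝ} (hb : ∃ K : ℝ, ∀ ξ, |vStar μ₀ c₀ α ξ| ≤ K) (ha : 0 < scaleA c₀ α) (hd0 : 0 < d) :
    0 < dTilde μ₀ c₀ α d := by
  have := bigM_pos hb ha
  rw [dTilde]
  positivity

lemma kBarOne_nonneg (μ₀ : Measure ℝ) (c₀ α D : ℝ) : 0 ≤ kBarOne μ₀ c₀ α D := by
  have : 0 ≤ ∫ x in Ioo (0 : ℝ) D, x * |sStar μ₀ c₀ α x| :=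
    setIntegral_nonneg measurableSet_Ioo fun x hx => by have := hx.1; positivity
  rw [kBarOne]
  positivity

lemma abs_vStar_mul_le (hc : 0 < c₀) (h0 : 0 < α) (h2 : α < 2) (hD : 0 < D) {x : ℝ} (hx : 0 ≤ x) :
    |vStar μ₀ c₀ α x| * x ^ α ≤ |bTwo μ₀ c₀ α D x| + 2 * kBarOne μ₀ c₀ α D * x ^ 2 := by
  rcases hx.eq_or_lt with rfl | hx
  · simp [vStar]
  · have h := abs_vStar_mul_sub_bTwo_le (μ₀ := μ₀) hc h0 h2 hD hx
    have h3 : |vStar μ₀ c₀ α x| * x ^ α = |vStar μ₀ c₀ α x * x ^ α| := by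
      rw [abs_mul, abs_of_pos (Real.rpow_pos_of_pos hx α)]
    rw [h3]
    have := abs_add_le (vStar μ₀ c₀ α x * x ^ α - bTwo μ₀ c₀ α D x) (bTwo μ₀ c₀ α D x)
    rw [sub_add_cancel] at this
    linarith

/-- The bound for the distance between the conditional law, given the weights, and the stable law. -/
lemma kolmogorov_prod_le (hc : 0 < c₀) (h0 : 0 < α) (h2 : α < 2) (hD : 0 < D)
    (hlim : Tendsto (fun x : ℝ => x ^ α * (1 - evenCdf μ₀ x)) atTop (𝓝 c₀))
    (hmono : MonotoneOn (sStar μ₀ c₀ α) (Ici D) ∨ AntitoneOn (sStar μ₀ c₀ α) (Ici D))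
    (hη0 : 0 < η) (hη : η < scaleA c₀ α) (hd0 : 0 < d) (hd1 : d < 1)
    (hdη : ∀ x : ℝ, |x| ≤ dTilde μ₀ c₀ α d →
          4 / 5 * bigM μ₀ c₀ α ^ 2 * |x| ^ α + vBar μ₀ c₀ α |x| ≤ η)
    {C : ℝ} (hC : ∀ (P G : Measure ℝ) (m T : ℝ), IsProbabilityMeasure P →
      IsProbabilityMeasure G → 0 ≤ m → 0 < T →
      (∀ x y, x ≤ y → G.real (Ioc x y) ≤ m * (y - x)) →
      IntegrableOn (fun ξ : ℝ => ‖charFun P ξ - charFun G ξ‖ / |ξ|) (Icc (-T) T) →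
      kolmogorov P G ≤
        (20 / 19) / (2 * Real.pi) * (∫ ξ in Icc (-T) T, ‖charFun P ξ - charFun G ξ‖ / |ξ|)
          + C * m / T)
    {β : ι → ℝ} (hβ : ∑ i, |β i| ^ α = 1) {B : ℝ} (hB0 : 0 < B) (hB : ∀ i, |β i| ≤ B)
    {P : Measure ℝ} [IsProbabilityMeasure P]
    (hP : ∀ ξ, charFun P ξ = ((∏ i, (charFun μ₀ (β i * ξ)).re : ℝ) : ℂ)) :
    kolmogorov P (stableLaw (scaleA c₀ α) α) ≤
      2 / Real.pi * (2 * zConst c₀ α η 0 *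
          ∑ i, |β i| ^ α * (hOne μ₀ c₀ α |β i| + hThree μ₀ c₀ α |β i|)
        + (2 * kBarOne μ₀ c₀ α D * constN c₀ α η 2
            + |sStar μ₀ c₀ α D| * D ^ 2 * constN c₀ α η 2) * ∑ i, |β i| ^ (2 : ℝ)
        + bFive μ₀ c₀ α η * ∑ i, |β i| ^ (2 * α))
      + C * stableDensityNorm (scaleA c₀ α) α / dTilde μ₀ c₀ α d * B := by
  set a := scaleA c₀ α with hadef
  set M := bigM μ₀ c₀ α with hM
  set N := constN c₀ α η 2 with hN
  set K := kBarOne μ₀ c₀ α D with hK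
  have hK0 : 0 ≤ K := kBarOne_nonneg _ _ _ _
  have ha : 0 < a := hη0.trans hη
  have hb := exists_abs_vStar_le h0 h2 hlim
  obtain ⟨hGp, hG⟩ := isStableLaw_stableLaw ha h0 h2
  set G := stableLaw a α with hGdef
  have hd := dTilde_pos (d := d) hb ha hd0
  -- The largest cutoff for which |β_i|ξ ≤ d̃ holds on [0,T] for every i, given the common bound B.
  set T := dTilde μ₀ c₀ α d / B with hT
  have hT0 : 0 < T := by positivity
  set g := stableDensityNorm a α with hg
  have hGlip : ∀ x y, x ≤ y → G.real (Ioc x y) ≤ g * (y - x) := fun x y hxy =>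
    (IsStableLaw.real_Ioc_le ha h0 ⟨hGp, hG⟩ hxy).trans
      (mul_le_mul_of_nonneg_right (stableDensity_zero_le ha h0) (sub_nonneg.2 hxy))
  have hg0 : 0 ≤ g := by
    have := (measureReal_nonneg).trans (hGlip 0 1 zero_le_one)
    linarith
  set n : ℝ → ℝ := fun ξ => Real.exp (-((a - η) * ξ ^ α)) with hn
  have hn0 : ∀ ξ, 0 ≤ n ξ := fun ξ => (Real.exp_pos _).le
  -- The contribution of one leaf divided by ξ: the b₂* part, the 2k̄₁ correction, and the quadratic
  -- error of the logarithm.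
  set f : ι → ℝ → ℝ := fun i ξ => n ξ * |bTwo μ₀ c₀ α D (|β i| * ξ)| / ξ
    + 2 * K * |β i| ^ (2 : ℝ) * (n ξ * ξ ^ ((2 : ℝ) - 1))
    + 4 / 5 * M ^ 2 * |β i| ^ (2 * α) * (n ξ * ξ ^ (2 * α - 1)) with hf
  have hb2 := fun i => integrableOn_and_integral_bTwo_le (D := D) hc h0 h2 hD hlim hmono hη
    (abs_nonneg (β i))
  have hi2 := integrableOn_constN (c₀ := c₀) (η := η) h0 two_pos hη
  have hi2α := integrableOn_constN (c₀ := c₀) (η := η) (l := 2 * α) h0 (by positivity) hη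
  have hfi : ∀ i, IntegrableOn (f i) (Ioi 0) := fun i =>
    ((hb2 i).1.add (hi2.const_mul _)).add (hi2α.const_mul _)
  have hfint : ∀ i, ∫ ξ in Ioi (0 : ℝ), f i ξ ≤
      19 / 10 * (2 * zConst c₀ α η 0 * (|β i| ^ α * (hOne μ₀ c₀ α |β i| + hThree μ₀ c₀ α |β i|))
          + |sStar μ₀ c₀ α D| * D ^ 2 * N * |β i| ^ (2 : ℝ))
        + 2 * K * |β i| ^ (2 : ℝ) * N + bFive μ₀ c₀ α η * |β i| ^ (2 * α) := by
    intro i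
    have e : ∫ ξ in Ioi (0 : ℝ), f i ξ = (∫ ξ in Ioi (0 : ℝ),
        n ξ * |bTwo μ₀ c₀ α D (|β i| * ξ)| / ξ) + 2 * K * |β i| ^ (2 : ℝ) * N +
        4 / 5 * M ^ 2 * |β i| ^ (2 * α) * constN c₀ α η (2 * α) := by
      rw [hN, constN, constN, ← integral_const_mul, ← integral_const_mul,
        ← integral_add (hb2 i).1 (hi2.const_mul _), ← integral_add _ (hi2α.const_mul _)]
      exact (hb2 i).1.add (hi2.const_mul _)
    have h3 : ∫ ξ in Ioi (0 : ℝ), n ξ * |bTwo μ₀ c₀ α D (|β i| * ξ)| / ξ ≤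
        19 / 10 * (2 * zConst c₀ α η 0 * (|β i| ^ α * (hOne μ₀ c₀ α |β i| + hThree μ₀ c₀ α |β i|))
          + |sStar μ₀ c₀ α D| * D ^ 2 * N * |β i| ^ 2) := (hb2 i).2
    rw [e, bFive, ← hM, Real.rpow_two]
    linarith
  have hFi : IntegrableOn (fun ξ => ∑ i, f i ξ) (Ioi 0) :=
    integrable_finsetSum _ fun i _ => hfi i
  have hFabs := integrable_comp_abs_of_integrableOn hFi
  have hf0 : ∀ i ξ, 0 ≤ ξ → 0 ≤ f i ξ := fun i ξ hξ => by
    have := hn0 ξ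
    rw [hf]
    positivity
  have hmain : ∀ ξ, 0 < ξ → ξ ≤ T → ‖charFun P ξ - charFun G ξ‖ / ξ ≤ ∑ i, f i ξ := by
    intro ξ hξ hξT
    rw [hP, hG, ← Complex.ofReal_sub, Complex.norm_real, Real.norm_eq_abs, div_le_iff₀ hξ,
      abs_of_pos hξ]
    refine (abs_prod_re_charFun_sub_exp_le h0 hb hη0 hη hd0 hd1 hdη hβ hξ fun i => ?_).trans ?_
    · calc |β i| * ξ ≤ B * T := by gcongr; exact hB i
        _ = _ := by rw [hT]; field_simp
    · rw [Finset.mul_sum, Finset.sum_mul]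
      refine Finset.sum_le_sum fun i _ => ?_
      have hr : 0 ≤ |β i| * ξ := by positivity
      have h3 := abs_vStar_mul_le (μ₀ := μ₀) hc h0 h2 hD hr
      have e1 : |β i| ^ (2 : ℝ) = |β i| ^ 2 := Real.rpow_two _
      have e2 : ξ ^ ((2 : ℝ) - 1) = ξ := by norm_num
      have e3 : ξ ^ (2 * α - 1) * ξ = ξ ^ (2 * α) := by
        rw [← Real.rpow_add_one hξ.ne']; ring_nf
      rw [Real.mul_rpow (abs_nonneg _) hξ.le (z := 2 * α)]
      calc _ ≤ n ξ * ((|bTwo μ₀ c₀ α D (|β i| * ξ)| + 2 * K * (|β i| * ξ) ^ 2) +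
            4 / 5 * M ^ 2 * (|β i| ^ (2 * α) * ξ ^ (2 * α))) := by
            refine mul_le_mul_of_nonneg_left ?_ (hn0 ξ)
            gcongr
        _ = f i ξ * ξ := by
            simp only [hf, e1, e2, ← e3]
            field_simp
  -- Both characteristic functions are even. At ξ = 0 the quotient is 0 by the convention for
  -- division.
  have hmain' : ∀ ξ, |ξ| ≤ T → ‖charFun P ξ - charFun G ξ‖ / |ξ| ≤ ∑ i, f i |ξ| := by
    intro ξ hξT
    rcases eq_or_ne ξ 0 with rfl | hne
    · simpa using Finset.sum_nonneg fun i _ => hf0 i 0 le_rfl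
    · have e : ‖charFun P ξ - charFun G ξ‖ = ‖charFun P |ξ| - charFun G |ξ|‖ := by
        rw [hP, hG, hP, hG, abs_abs]
        rcases abs_choice ξ with h | h
        · rw [h]
        · rw [h]; simp only [mul_neg, re_charFun_neg]
      rw [e]
      exact hmain |ξ| (abs_pos.2 hne) hξT
  have hmeas : AEStronglyMeasurable (fun ξ : ℝ => ‖charFun P ξ - charFun G ξ‖ / |ξ|)
      (volume.restrict (Icc (-T) T)) := Measurable.aestronglyMeasurable (by fun_prop)
  have hae : ∀ᵐ ξ ∂(volume.restrict (Icc (-T) T)),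
      ‖‖charFun P ξ - charFun G ξ‖ / |ξ|‖ ≤ ∑ i, f i |ξ| :=
    (ae_restrict_iff' measurableSet_Icc).2 (Eventually.of_forall fun ξ hξ => by
      rw [Real.norm_of_nonneg (by positivity)]
      exact hmain' ξ (abs_le.2 hξ))
  have hint := Integrable.mono' hFabs.integrableOn hmeas hae
  have hbound : ∫ ξ in Icc (-T) T, ‖charFun P ξ - charFun G ξ‖ / |ξ| ≤
      2 * ∑ i, (19 / 10 * (2 * zConst c₀ α η 0 *
          (|β i| ^ α * (hOne μ₀ c₀ α |β i| + hThree μ₀ c₀ α |β i|))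
          + |sStar μ₀ c₀ α D| * D ^ 2 * N * |β i| ^ (2 : ℝ))
        + 2 * K * |β i| ^ (2 : ℝ) * N + bFive μ₀ c₀ α η * |β i| ^ (2 * α)) := by
    calc _ ≤ ∫ ξ in Icc (-T) T, ∑ i, f i |ξ| := by
          refine integral_mono_ae hint hFabs.integrableOn (hae.mono fun ξ hξ => ?_)
          exact (le_abs_self _).trans hξ
      _ ≤ ∫ ξ, ∑ i, f i |ξ| := setIntegral_le_integral hFabs
          (Eventually.of_forall fun ξ => Finset.sum_nonneg fun i _ => hf0 i _ (abs_nonneg ξ))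
      _ = 2 * ∫ ξ in Ioi (0 : ℝ), ∑ i, f i ξ := integral_comp_abs (f := fun ξ => ∑ i, f i ξ)
      _ ≤ _ := by
          rw [integral_finsetSum _ fun i _ => hfi i]
          gcongr with i
          exact hfint i
  have hfin := hC P G g T inferInstance hGp hg0 hT0 hGlip hint
  have hN0 : 0 < N := constN_pos h0 two_pos hη
  have hB5 : 0 ≤ bFive μ₀ c₀ α η := by
    have := constN_pos (c₀ := c₀) (η := η) (l := 2 * α) h0 (by positivity) hη
    rw [bFive]; positivity
  have hS2 : 0 ≤ ∑ i, |β i| ^ (2 : ℝ) := Finset.sum_nonneg fun i _ => by positivity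
  have hS5 : 0 ≤ ∑ i, |β i| ^ (2 * α) := Finset.sum_nonneg fun i _ => by positivity
  refine hfin.trans (add_le_add ?_ (le_of_eq ?_))
  · refine (mul_le_mul_of_nonneg_left hbound (by positivity)).trans ?_
    rw [Finset.sum_add_distrib, Finset.sum_add_distrib, ← Finset.mul_sum, Finset.sum_add_distrib,
      ← Finset.mul_sum, ← Finset.mul_sum, ← Finset.mul_sum, ← Finset.sum_mul, ← Finset.mul_sum]
    set S1 := ∑ i, |β i| ^ α * (hOne μ₀ c₀ α |β i| + hThree μ₀ c₀ α |β i|)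
    set S2 := ∑ i, |β i| ^ (2 : ℝ)
    set S5 := ∑ i, |β i| ^ (2 * α)
    have hpi : 0 < Real.pi⁻¹ := inv_pos.2 Real.pi_pos
    -- Here 20/19 · 19/10 = 2 meets the required constant exactly; the other terms carry only the
    -- factor 20/19.
    have e : 20 / 19 / (2 * Real.pi) * (2 * (19 / 10 * (2 * zConst c₀ α η 0 * S1 +
        |sStar μ₀ c₀ α D| * D ^ 2 * N * S2) + 2 * K * S2 * N + bFive μ₀ c₀ α η * S5)) =
        Real.pi⁻¹ * (2 * (2 * zConst c₀ α η 0 * S1 + |sStar μ₀ c₀ α D| * D ^ 2 * N * S2)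
          + 20 / 19 * (2 * K * S2 * N) + 20 / 19 * (bFive μ₀ c₀ α η * S5)) := by
      field_simp; ring
    rw [e, show 2 / Real.pi = Real.pi⁻¹ * 2 by ring, mul_assoc Real.pi⁻¹ 2]
    refine mul_le_mul_of_nonneg_left ?_ hpi.le
    have h3 : 0 ≤ K * S2 * N := by positivity
    have h4 : 0 ≤ bFive μ₀ c₀ α η * S5 := by positivity
    linarith
  · rw [hT]; field_simp

end Product

/-! ### Sums over binary trees -/

namespace BinTree

lemma one_le_leaves (g : BinTree) : 1 ≤ g.leaves := by
  induction g with
  | leaf => exact le_rfl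
  | node l r hl hr => simp only [leaves]; omega

lemma leaves_add_sub_pos (l r : BinTree) : (0 : ℝ) < (l.leaves : ℝ) + r.leaves - 1 := by
  have h1 : (1 : ℝ) ≤ l.leaves := by exact_mod_cast one_le_leaves l
  have h2 : (1 : ℝ) ≤ r.leaves := by exact_mod_cast one_le_leaves r
  linarith

lemma prob_nonneg (g : BinTree) : 0 ≤ g.prob := by
  induction g with
  | leaf => exact zero_le_one
  | node l r hl hr => exact div_nonneg (mul_nonneg hl hr) (leaves_add_sub_pos l r).le

/-- An injection of the set of binary trees into the natural numbers. -/
def code : BinTree → ℕ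
  | leaf => 0
  | node l r => Nat.pair (code l) (code r) + 1

lemma code_injective : Function.Injective code := by
  intro a
  induction a with
  | leaf => intro b h; cases b with
    | leaf => rfl
    | node l r => simp [code] at h
  | node l r hl hr => intro b h; cases b with
    | leaf => simp [code] at h
    | node l' r' =>
      simp only [code, add_left_inj, Nat.pair_eq_pair] at h
      rw [hl h.1, hr h.2]

instance : Countable BinTree := code_injective.countable

lemma node_injective : Function.Injective fun z : BinTree × BinTree => node z.1 z.2 := by
  rintro ⟨a, b⟩ ⟨c, d⟩ h
  simpa using h

/-- Summation over trees that omits the leaf becomes summation over pairs of subtrees; every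
recursion over the random tree uses this form. -/
lemma tsum_node {M : Type*} [AddCommMonoid M] [TopologicalSpace M] {f : BinTree → M}
    (hf : f leaf = 0) : ∑' g, f g = ∑' z : BinTree × BinTree, f (node z.1 z.2) := by
  refine (node_injective.tsum_eq fun g hg => ?_).symm
  cases g with
  | leaf => exact absurd hf hg
  | node l r => exact ⟨(l, r), rfl⟩

lemma summable_node {f : BinTree → ℝ}
    (hf : f leaf = 0) : Summable f ↔ Summable fun z : BinTree × BinTree => f (node z.1 z.2) := by
  refine (node_injective.summable_iff fun g hg => ?_).symm
  cases g with
  | leaf => exact hf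
  | node l r => exact absurd ⟨(l, r), rfl⟩ hg

/-- Strong induction: for n + 2 leaves there are n + 1 possible sizes of the left subtree, each
contributing a product of two total masses 1, and n + 1 is the denominator in `prob`. -/
lemma tsum_prob_leaves (n : ℕ) : ∑' g : BinTree, (if g.leaves = n then ENNReal.ofReal g.prob else 0) =
    if n = 0 then 0 else 1 := by
  classical
  induction n using Nat.strong_induction_on with
  | _ n ih =>
  rcases n with _ | _ | n
  · simp only [if_true]
    refine ENNReal.tsum_eq_zero.2 fun g => if_neg ?_
    have := one_le_leaves g
    omega
  · rw [tsum_eq_single leaf]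
    · simp [leaves, prob]
    · intro g hg
      cases g with
      | leaf => exact absurd rfl hg
      | node l r =>
        have := one_le_leaves l
        have := one_le_leaves r
        rw [if_neg]
        simp only [leaves]
        omega
  · rw [tsum_node (by simp [leaves]), if_neg (by omega)]
    -- The left subtree has i + 1 leaves and the right n - i + 1. Since i ≤ n, the natural
    -- subtraction is the true one, and at most one summand is nonzero.
    have e : ∀ z : BinTree × BinTree,
        (if (node z.1 z.2).leaves = n + 1 + 1 then ENNReal.ofReal (node z.1 z.2).prob else 0) =
        ENNReal.ofReal ((n : ℝ) + 1)⁻¹ * ∑ i ∈ Finset.range (n + 1),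
          ((if z.1.leaves = i + 1 then ENNReal.ofReal z.1.prob else 0) *
            (if z.2.leaves = n - i + 1 then ENNReal.ofReal z.2.prob else 0)) := by
      rintro ⟨l, r⟩
      have hl := one_le_leaves l
      have hr := one_le_leaves r
      have hlr : (node l r).leaves = l.leaves + r.leaves := rfl
      dsimp only
      by_cases h : (node l r).leaves = n + 1 + 1
      · rw [if_pos h, Finset.sum_eq_single (l.leaves - 1)]
        · rw [if_pos (by omega), if_pos (by omega), ← ENNReal.ofReal_mul (prob_nonneg l),
            ← ENNReal.ofReal_mul (by positivity)]
          congr 1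
          have h' : (l.leaves : ℝ) + r.leaves = n + 1 + 1 := by exact_mod_cast hlr ▸ h
          rw [prob, h']
          field_simp
          ring
        · intro i hi hne
          rw [if_neg (by omega), zero_mul]
        · intro h'
          simp only [Finset.mem_range] at h'
          omega
      · rw [if_neg h, Finset.sum_eq_zero, mul_zero]
        intro i hi
        simp only [Finset.mem_range] at hi
        by_cases h1 : l.leaves = i + 1
        · rw [if_neg (show ¬ r.leaves = n - i + 1 by omega), mul_zero]
        · rw [if_neg h1, zero_mul]
    simp_rw [e]
    rw [ENNReal.tsum_mul_left, Summable.tsum_finsetSum fun i _ => ENNReal.summable]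
    have e2 : ∀ i ∈ Finset.range (n + 1), ∑' z : BinTree × BinTree,
        ((if z.1.leaves = i + 1 then ENNReal.ofReal z.1.prob else 0) *
            (if z.2.leaves = n - i + 1 then ENNReal.ofReal z.2.prob else 0)) = 1 := by
      intro i hi
      simp only [Finset.mem_range] at hi
      rw [ENNReal.tsum_prod']
      simp_rw [ENNReal.tsum_mul_left]
      rw [ENNReal.tsum_mul_right, ih (i + 1) (by omega), ih (n - i + 1) (by omega)]
      simp
    rw [Finset.sum_congr rfl e2]
    simp only [Finset.sum_const, Finset.card_range, nsmul_eq_mul, mul_one]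
    rw [← ENNReal.ofReal_natCast (n + 1), ← ENNReal.ofReal_mul (by positivity)]
    push_cast
    rw [inv_mul_cancel₀ (by positivity), ENNReal.ofReal_one]

end BinTree

open BinTree

/-! ### The law of the random tree and its forward equation -/

/-- The probability of the tree `g` under the law of `γ_t`. -/
noncomputable def treeWeight (t : ℝ) (g : BinTree) : ℝ :=
  Real.exp (-t) * (1 - Real.exp (-t)) ^ (g.leaves - 1) * g.prob

lemma one_sub_exp_neg_nonneg {t : ℝ} (ht : 0 ≤ t) : 0 ≤ 1 - Real.exp (-t) := by
  have := Real.exp_le_one_iff.2 (neg_nonpos.2 ht)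
  linarith

lemma treeWeight_nonneg {t : ℝ} (ht : 0 ≤ t) (g : BinTree) : 0 ≤ treeWeight t g :=
  mul_nonneg (mul_nonneg (Real.exp_pos _).le (pow_nonneg (one_sub_exp_neg_nonneg ht) _))
    (prob_nonneg g)

lemma tsum_ofReal_treeWeight {t : ℝ} (ht : 0 ≤ t) :
    ∑' g, ENNReal.ofReal (treeWeight t g) = 1 := by
  have h1 := one_sub_exp_neg_nonneg ht
  have h2 := Real.exp_pos (-t)
  have e : ∀ g, ENNReal.ofReal (treeWeight t g) = ∑' n : ℕ,
      ENNReal.ofReal (Real.exp (-t) * (1 - Real.exp (-t)) ^ n) *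
        (if g.leaves = n + 1 then ENNReal.ofReal g.prob else 0) := by
    intro g
    have := one_le_leaves g
    rw [tsum_eq_single (g.leaves - 1), if_pos (by omega), ← ENNReal.ofReal_mul (by positivity),
      treeWeight]
    intro n hn
    rw [if_neg (by omega), mul_zero]
  simp_rw [e]
  rw [ENNReal.tsum_comm]
  simp_rw [ENNReal.tsum_mul_left, tsum_prob_leaves]
  simp only [Nat.add_eq_zero_iff, one_ne_zero, and_false, if_false, mul_one]
  have hlt : 1 - Real.exp (-t) < 1 := by linarith
  rw [← ENNReal.ofReal_tsum_of_nonneg (fun n => by positivity)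
    ((summable_geometric_of_lt_one h1 hlt).mul_left _), tsum_mul_left,
    tsum_geometric_of_lt_one h1 hlt, sub_sub_cancel, mul_inv_cancel₀ h2.ne', ENNReal.ofReal_one]

lemma hasSum_treeWeight {t : ℝ} (ht : 0 ≤ t) : HasSum (treeWeight t) 1 := by
  have h := tsum_ofReal_treeWeight ht
  have hs : Summable (treeWeight t) := by
    have := ENNReal.summable_toReal (h.trans_ne ENNReal.one_ne_top)
    simpa only [ENNReal.toReal_ofReal (treeWeight_nonneg ht _)] using this
  have h2 : ∑' g, treeWeight t g = 1 := by
    rw [← ENNReal.ofReal_tsum_of_nonneg (treeWeight_nonneg ht) hs] at h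
    exact ENNReal.ofReal_eq_one.1 h
  rw [← h2]
  exact hs.hasSum

lemma summable_treeWeight_mul {t : ℝ} (ht : 0 ≤ t) {X : BinTree → ℝ} {C : ℝ} (hX : ∀ g, |X g| ≤ C) :
    Summable fun g => treeWeight t g * X g := by
  refine Summable.of_norm_bounded ((hasSum_treeWeight ht).summable.mul_right C) fun g => ?_
  rw [Real.norm_eq_abs, abs_mul, abs_of_nonneg (treeWeight_nonneg ht g)]
  exact mul_le_mul_of_nonneg_left (hX g) (treeWeight_nonneg ht g)

lemma abs_tsum_treeWeight_mul_le {t : ℝ} (ht : 0 ≤ t) {X : BinTree → ℝ} {C : ℝ}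
    (hX : ∀ g, |X g| ≤ C) : |∑' g, treeWeight t g * X g| ≤ C := by
  have h := tsum_of_norm_bounded (f := fun g => treeWeight t g * X g)
    ((hasSum_treeWeight ht).mul_right C) fun g => by
      rw [Real.norm_eq_abs, abs_mul, abs_of_nonneg (treeWeight_nonneg ht g)]
      exact mul_le_mul_of_nonneg_left (hX g) (treeWeight_nonneg ht g)
  rwa [one_mul] at h

/-- The gain term in the derivative of the weights. -/
noncomputable def gainTerm (t : ℝ) : BinTree → ℝ
  | leaf => 0
  | node l r => treeWeight t l * treeWeight t r

/-- Differentiating (1 - e^{-t})^{n-1} produces the factor n - 1, which cancels the denominator in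
`prob`. The gain is therefore just the product of the weights of the two subtrees. -/
lemma hasDerivAt_treeWeight (t : ℝ) (g : BinTree) :
    HasDerivAt (fun t => treeWeight t g) (-treeWeight t g + gainTerm t g) t := by
  have he : HasDerivAt (fun t : ℝ => Real.exp (-t)) (-Real.exp (-t)) t := by
    simpa using (hasDerivAt_neg t).exp
  cases g with
  | leaf =>
    simp only [treeWeight, gainTerm, leaves, prob]
    simpa using he
  | node l r =>
    have hl := one_le_leaves l
    have hr := one_le_leaves r
    have h := (he.mul ((he.const_sub 1).pow ((node l r).leaves - 1))).mul_const (node l r).prob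
    have e : -treeWeight t (node l r) + gainTerm t (node l r) =
        (-Real.exp (-t) * (1 - Real.exp (-t)) ^ ((node l r).leaves - 1) + Real.exp (-t) *
          (((node l r).leaves - 1 : ℕ) * (1 - Real.exp (-t)) ^ ((node l r).leaves - 1 - 1) *
            (- -Real.exp (-t)))) * (node l r).prob := by
      have h1 : (((node l r).leaves - 1 : ℕ) : ℝ) * (node l r).prob = l.prob * r.prob := by
        have := leaves_add_sub_pos l r
        rw [Nat.cast_sub (by simp only [leaves]; omega), prob]
        simp only [leaves]
        push_cast
        field_simp
      have h2 : (node l r).leaves - 1 - 1 = (l.leaves - 1) + (r.leaves - 1) := by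
        simp only [leaves]; omega
      rw [h2, pow_add]
      simp only [treeWeight, gainTerm]
      linear_combination (-Real.exp (-t) ^ 2 * ((1 - Real.exp (-t)) ^ (l.leaves - 1) *
        (1 - Real.exp (-t)) ^ (r.leaves - 1))) * h1
    rw [e]
    exact h

/-- A summable majorant uniform in s ≤ T, which allows termwise differentiation and continuity. It
rests on e^{-s} ≤ 1 and the monotonicity of 1 - e^{-s}. -/
lemma treeWeight_le_of_le {s T : ℝ} (hs : 0 ≤ s) (hsT : s ≤ T) (g : BinTree) :
    treeWeight s g ≤ Real.exp T * treeWeight T g := by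
  have h1 := one_sub_exp_neg_nonneg hs
  have h2 : Real.exp (-s) ≤ 1 := Real.exp_le_one_iff.2 (neg_nonpos.2 hs)
  have h3 : Real.exp (-T) ≤ Real.exp (-s) := Real.exp_le_exp.2 (by linarith)
  have e : Real.exp T * treeWeight T g = 1 * (1 - Real.exp (-T)) ^ (g.leaves - 1) * g.prob := by
    rw [treeWeight, ← mul_assoc, ← mul_assoc, ← Real.exp_add, add_neg_cancel, Real.exp_zero]
  rw [e, treeWeight]
  have := prob_nonneg g
  gcongr

lemma summable_treeWeight_mul_treeWeight {t : ℝ} (ht : 0 ≤ t) :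
    Summable fun z : BinTree × BinTree => treeWeight t z.1 * treeWeight t z.2 :=
  (hasSum_treeWeight ht).summable.mul_of_nonneg (hasSum_treeWeight ht).summable
    (treeWeight_nonneg ht) (treeWeight_nonneg ht)

lemma summable_gainTerm {t : ℝ} (ht : 0 ≤ t) : Summable (gainTerm t) :=
  (summable_node rfl).2 (summable_treeWeight_mul_treeWeight ht)

lemma gainTerm_nonneg {t : ℝ} (ht : 0 ≤ t) (g : BinTree) : 0 ≤ gainTerm t g := by
  cases g with
  | leaf => exact le_rfl
  | node l r => exact mul_nonneg (treeWeight_nonneg ht l) (treeWeight_nonneg ht r)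

lemma gainTerm_le_of_le {s T : ℝ} (hs : 0 ≤ s) (hsT : s ≤ T) (g : BinTree) :
    gainTerm s g ≤ Real.exp T ^ 2 * gainTerm T g := by
  cases g with
  | leaf => simp [gainTerm]
  | node l r =>
    have h1 := treeWeight_le_of_le hs hsT l
    have h2 := treeWeight_le_of_le hs hsT r
    calc gainTerm s (node l r) ≤ (Real.exp T * treeWeight T l) * (Real.exp T * treeWeight T r) :=
          mul_le_mul h1 h2 (treeWeight_nonneg hs r) ((treeWeight_nonneg hs l).trans h1)
      _ = _ := by rw [gainTerm]; ring

/-- The forward equation for expectations over the random tree. -/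
lemma hasDerivAt_tsum_treeWeight_mul {X : BinTree → ℝ} {C : ℝ} (hX : ∀ g, |X g| ≤ C) {t : ℝ}
    (ht : 0 < t) :
    HasDerivAt (fun t => ∑' g, treeWeight t g * X g)
      ((∑' z : BinTree × BinTree, treeWeight t z.1 * treeWeight t z.2 * X (node z.1 z.2))
        - ∑' g, treeWeight t g * X g) t := by
  have hC : 0 ≤ C := (abs_nonneg _).trans (hX leaf)
  -- Any T > t works: the majorants at T control the series on the open interval (0,T) around t.
  set T := t + 1
  have hT : 0 ≤ T := by positivity
  have hu : Summable fun g => (Real.exp T * treeWeight T g + Real.exp T ^ 2 * gainTerm T g) * C :=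
    (((hasSum_treeWeight hT).summable.mul_left _).add ((summable_gainTerm hT).mul_left _)).mul_right C
  have h := hasDerivAt_tsum_of_isPreconnected (g := fun g t => treeWeight t g * X g)
    (g' := fun g t => (-treeWeight t g + gainTerm t g) * X g) (y₀ := t) (y := t) hu
    (isOpen_Ioo (a := 0) (b := T)) isPreconnected_Ioo
    (fun g s _ => (hasDerivAt_treeWeight s g).mul_const (X g))
    (fun g s hs => by
      rw [norm_mul, Real.norm_eq_abs, Real.norm_eq_abs]
      refine mul_le_mul ?_ (hX g) (abs_nonneg _) (add_nonneg (mul_nonneg (Real.exp_pos _).le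
        (treeWeight_nonneg hT g)) (mul_nonneg (by positivity) (gainTerm_nonneg hT g)))
      refine (abs_add_le _ _).trans ?_
      rw [abs_neg, abs_of_nonneg (treeWeight_nonneg hs.1.le g),
        abs_of_nonneg (gainTerm_nonneg hs.1.le g)]
      exact add_le_add (treeWeight_le_of_le hs.1.le hs.2.le g) (gainTerm_le_of_le hs.1.le hs.2.le g))
    (show t ∈ Ioo 0 T from ⟨ht, by linarith⟩) (summable_treeWeight_mul ht.le hX)
    (show t ∈ Ioo 0 T from ⟨ht, by linarith⟩)
  have hs1 := summable_treeWeight_mul ht.le hX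
  have hs2 : Summable fun g => gainTerm t g * X g := by
    refine Summable.of_norm_bounded ((summable_gainTerm ht.le).mul_right C) fun g => ?_
    rw [Real.norm_eq_abs, abs_mul, abs_of_nonneg (gainTerm_nonneg ht.le g)]
    exact mul_le_mul_of_nonneg_left (hX g) (gainTerm_nonneg ht.le g)
  have e : ∑' g, (-treeWeight t g + gainTerm t g) * X g =
      (∑' z : BinTree × BinTree, treeWeight t z.1 * treeWeight t z.2 * X (node z.1 z.2))
        - ∑' g, treeWeight t g * X g := by
    have e1 : ∑' g, gainTerm t g * X g =
        ∑' z : BinTree × BinTree, treeWeight t z.1 * treeWeight t z.2 * X (node z.1 z.2) :=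
      tsum_node (by simp [gainTerm])
    rw [← e1, ← hs2.tsum_sub hs1]
    congr 1 with g
    ring
  rw [← e]
  exact h

lemma continuousOn_tsum_treeWeight_mul {X : BinTree → ℝ} {C : ℝ} (hX : ∀ g, |X g| ≤ C) :
    ContinuousOn (fun t => ∑' g, treeWeight t g * X g) (Ici 0) := by
  intro t ht
  have ht0 : 0 ≤ t := ht
  set T := t + 1
  have hT : 0 ≤ T := by positivity
  have h : ContinuousOn (fun t => ∑' g, treeWeight t g * X g) (Icc 0 T) := by
    refine continuousOn_tsum (u := fun g => Real.exp T * treeWeight T g * C)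
      (fun g => ?_) (((hasSum_treeWeight hT).summable.mul_left _).mul_right C) fun g s hs => ?_
    · exact fun s _ => ((hasDerivAt_treeWeight s g).mul_const (X g)).continuousAt.continuousWithinAt
    · rw [norm_mul, Real.norm_eq_abs, Real.norm_eq_abs, abs_of_nonneg (treeWeight_nonneg hs.1 g)]
      exact mul_le_mul (treeWeight_le_of_le hs.1 hs.2 g) (hX g) (abs_nonneg _)
        (mul_nonneg (Real.exp_pos _).le (treeWeight_nonneg hT g))
  refine (h t ⟨ht0, by linarith⟩).mono_of_mem_nhdsWithin ?_
  have : Iio T ∈ 𝓝 t := Iio_mem_nhds (by linarith)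
  filter_upwards [self_mem_nhdsWithin, mem_nhdsWithin_of_mem_nhds this] with s h1 h2
  exact ⟨h1, le_of_lt h2⟩

/-- At t = 0 the base 1 - e^{-t} vanishes, and only the exponent 0 of the single leaf survives. -/
lemma tsum_treeWeight_zero_mul (X : BinTree → ℝ) : ∑' g, treeWeight 0 g * X g = X leaf := by
  rw [tsum_eq_single leaf]
  · simp [treeWeight, leaves, prob]
  · intro g hg
    cases g with
    | leaf => exact absurd rfl hg
    | node l r =>
      have hl := one_le_leaves l
      have hr := one_le_leaves r
      have : (node l r).leaves - 1 ≠ 0 := by simp only [leaves]; omega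
      simp [treeWeight, this]

/-! ### The sequence of angles -/

/-- The law of a sequence of independent angles. -/
noncomputable def angleLaw : Measure (ℕ → ℝ) := Measure.infinitePi fun _ : ℕ => uniformAngle

instance : IsProbabilityMeasure angleLaw := by unfold angleLaw; infer_instance

/-- The sequence consisting of the first angle, the first `m - 1` terms of the second sequence and
the third sequence. -/
noncomputable def splice (m : ℕ) (z : ℝ × (ℕ → ℝ) × (ℕ → ℝ)) (k : ℕ) : ℝ :=
  if k = 0 then z.1 else if k < m then z.2.1 (k - 1) else z.2.2 (k - m)

lemma measurable_splice (m : ℕ) : Measurable (splice m) := by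
  refine measurable_pi_iff.2 fun k => ?_
  unfold splice
  split_ifs <;> fun_prop

/-- Concatenating an angle and two independent angle sequences gives an independent sequence again:
a cylinder pulls back to a product of three cylinders. With m the number of leaves of the left
subtree, the blocks feed the root, its m - 1 internal nodes, and the right subtree. -/
lemma map_splice (m : ℕ) (hm : 1 ≤ m) :
    (uniformAngle.prod (angleLaw.prod angleLaw)).map (splice m) = angleLaw := by
  obtain ⟨m, rfl⟩ : ∃ m', m = m' + 1 := ⟨m - 1, by omega⟩
  refine Measure.eq_infinitePi _ fun s t ht => ?_
  obtain ⟨M, hM⟩ : ∃ M, s ⊆ Finset.range (m + 1 + M) := by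
    refine ⟨s.sup id + 1, fun k hk => ?_⟩
    have : k ≤ s.sup id := Finset.le_sup (f := id) hk
    simp only [Finset.mem_range]
    omega
  -- Padding by the whole line turns the cylinder over s into one over an initial segment that
  -- contains the first two blocks.
  set t' : ℕ → Set ℝ := fun k => if k ∈ s then t k else univ with ht'
  have hmt : ∀ k, MeasurableSet (t' k) := fun k => by
    simp only [ht']
    split_ifs
    · exact ht k
    · exact MeasurableSet.univ
  have hpi : (s : Set ℕ).pi t = {θ | ∀ k ∈ Finset.range (m + 1 + M), θ k ∈ t' k} := by
    ext θ
    simp only [Set.mem_pi, Finset.mem_coe, Set.mem_ofPred_eq, ht']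
    constructor
    · intro h k _
      by_cases hk : k ∈ s
      · rw [if_pos hk]; exact h k hk
      · rw [if_neg hk]; trivial
    · intro h k hk
      have := h k (hM hk)
      rwa [if_pos (Finset.mem_coe.1 hk)] at this
  have hprod : ∏ i ∈ s, uniformAngle (t i) = ∏ k ∈ Finset.range (m + 1 + M), uniformAngle (t' k) := by
    rw [← Finset.prod_subset hM (f := fun k => uniformAngle (t' k))]
    · exact Finset.prod_congr rfl fun k hk => by simp only [ht', if_pos hk]
    · intro k _ hk
      simp only [ht', if_neg hk, measure_univ]
  have hmeas : MeasurableSet ((s : Set ℕ).pi t) :=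
    MeasurableSet.pi (Set.to_countable _) fun k _ => ht k
  rw [Measure.map_apply (measurable_splice _) hmeas, hprod, hpi]
  have hpre : splice (m + 1) ⁻¹' {θ | ∀ k ∈ Finset.range (m + 1 + M), θ k ∈ t' k} =
      t' 0 ×ˢ (((Finset.range m : Finset ℕ) : Set ℕ).pi (fun k => t' (k + 1)) ×ˢ
        ((Finset.range M : Finset ℕ) : Set ℕ).pi (fun k => t' (m + 1 + k))) := by
    ext ⟨u, a, b⟩
    simp only [mem_preimage, Set.mem_ofPred_eq, mem_prod, Set.mem_pi, Finset.mem_coe, Finset.mem_range, splice]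
    constructor
    · intro h
      refine ⟨by simpa using h 0 (by omega), fun k hk => ?_, fun k hk => ?_⟩
      · have := h (k + 1) (by omega)
        rwa [if_neg (by omega), if_pos (by omega), Nat.add_sub_cancel] at this
      · have := h (m + 1 + k) (by omega)
        rwa [if_neg (by omega), if_neg (by omega), Nat.add_sub_cancel_left] at this
    · rintro ⟨h0, h1, h2⟩ k hk
      rcases Nat.eq_zero_or_pos k with rfl | hk0
      · simpa using h0
      · rw [if_neg (by omega)]
        by_cases hkm : k < m + 1
        · rw [if_pos hkm]
          have := h1 (k - 1) (by omega)
          rwa [Nat.sub_add_cancel hk0] at this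
        · rw [if_neg hkm]
          have := h2 (k - (m + 1)) (by omega)
          rwa [Nat.add_sub_cancel' (by omega)] at this
  rw [hpre, Measure.prod_prod, Measure.prod_prod, angleLaw,
    Measure.infinitePi_pi _ (fun k _ => hmt _), Measure.infinitePi_pi _ (fun k _ => hmt _),
    Finset.prod_range_add, Finset.prod_range_succ']
  ring

lemma integral_angleLaw (m : ℕ) (hm : 1 ≤ m) {f : (ℕ → ℝ) → ℝ} (hf : Measurable f) :
    ∫ θ, f θ ∂angleLaw = ∫ z, f (splice m z) ∂(uniformAngle.prod (angleLaw.prod angleLaw)) := by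
  rw [← map_splice m hm, integral_map (measurable_splice m).aemeasurable
    hf.aestronglyMeasurable, map_splice m hm]

/-! ### The weights -/

namespace BinTree

lemma length_weights (p : ℝ) (g : BinTree) (θ : ℕ → ℝ) : (weights p g θ).length = g.leaves := by
  induction g generalizing θ with
  | leaf => rfl
  | node l r hl hr => simp [weights, leaves, hl, hr]

/-- A tree with n leaves reads only the n - 1 angles of its internal nodes, so the part of a block
beyond them is irrelevant. -/
lemma weights_congr (p : ℝ) (g : BinTree) {θ θ' : ℕ → ℝ} (h : ∀ k, k + 1 < g.leaves → θ k = θ' k) :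
    weights p g θ = weights p g θ' := by
  induction g generalizing θ θ' with
  | leaf => rfl
  | node l r hl hr =>
    have h1 := one_le_leaves l
    have h2 := one_le_leaves r
    simp only [leaves] at h
    simp only [weights]
    rw [h 0 (by omega), hl (θ := fun k => θ (k + 1)) fun k hk => h (k + 1) (by omega),
      hr (θ := fun k => θ (k + l.leaves)) fun k hk => h (k + l.leaves) (by omega)]

lemma weights_node_splice (p : ℝ) (l r : BinTree) (u : ℝ) (a b : ℕ → ℝ) :
    weights p (node l r) (splice l.leaves (u, a, b)) =
      (weights p l a).map (fun x => cosP p u * x) ++ (weights p r b).map (fun x => sinP p u * x) := by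
  have h1 := one_le_leaves l
  have e1 : weights p l (fun k => splice l.leaves (u, a, b) (k + 1)) = weights p l a :=
    weights_congr p l fun k hk => by simp [splice, hk]
  have e2 : (fun k => splice l.leaves (u, a, b) (k + l.leaves)) = b := by
    ext k
    rw [splice, if_neg (by omega), if_neg (by omega), Nat.add_sub_cancel]
  have e3 : splice l.leaves (u, a, b) 0 = u := by simp [splice]
  rw [weights, e1, e2, e3]

end BinTree

lemma measurable_cosP (p : ℝ) : Measurable (cosP p) := by unfold cosP; fun_prop

lemma measurable_sinP (p : ℝ) : Measurable (sinP p) := by unfold sinP; fun_prop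

open BinTree

/-- Measurability is stated coordinate by coordinate: the list has constant length, so its entries
determine all sums, products and maxima used later. -/
lemma measurable_getD_weights (p : ℝ) (g : BinTree) (i : ℕ) :
    Measurable fun θ => (weights p g θ).getD i 0 := by
  induction g generalizing i with
  | leaf => exact measurable_const (a := ([1] : List ℝ).getD i 0)
  | node l r hl hr =>
    have hc := measurable_cosP p
    have hs := measurable_sinP p
    simp only [weights]
    by_cases h : i < l.leaves
    · have e : ∀ θ : ℕ → ℝ, (((weights p l (fun k => θ (k + 1))).map (fun b => cosP p (θ 0) * b) ++
          (weights p r (fun k => θ (k + leaves l))).map (fun b => sinP p (θ 0) * b))).getD i 0 =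
          cosP p (θ 0) * (weights p l (fun k => θ (k + 1))).getD i 0 := by
        intro θ
        rw [List.getD_append _ _ _ _ (by simpa [length_weights] using h),
          List.getD_eq_getElem _ _ (by simpa [length_weights] using h),
          List.getD_eq_getElem _ _ (by simpa [length_weights] using h), List.getElem_map]
      simp_rw [e]
      have h1 : Measurable fun θ : ℕ → ℝ => fun k => θ (k + 1) := by fun_prop
      have := (hl i).comp h1
      have h0 : Measurable fun θ : ℕ → ℝ => cosP p (θ 0) := by fun_prop
      exact h0.mul this
    · by_cases h' : i < l.leaves + r.leaves
      · have e : ∀ θ : ℕ → ℝ, (((weights p l (fun k => θ (k + 1))).map (fun b => cosP p (θ 0) * b) ++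
            (weights p r (fun k => θ (k + leaves l))).map (fun b => sinP p (θ 0) * b))).getD i 0 =
            sinP p (θ 0) * (weights p r (fun k => θ (k + leaves l))).getD (i - l.leaves) 0 := by
          intro θ
          rw [List.getD_append_right _ _ _ _ (by simpa [length_weights] using h),
            List.getD_eq_getElem _ _ (by simp [length_weights]; omega),
            List.getD_eq_getElem _ _ (by simp [length_weights]; omega), List.getElem_map]
          simp [length_weights]
        simp_rw [e]
        have h1 : Measurable fun θ : ℕ → ℝ => fun k => θ (k + leaves l) := by fun_prop
        have := (hr (i - l.leaves)).comp h1
        have h0 : Measurable fun θ : ℕ → ℝ => sinP p (θ 0) := by fun_prop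
        exact h0.mul this
      · have e : ∀ θ : ℕ → ℝ, (((weights p l (fun k => θ (k + 1))).map (fun b => cosP p (θ 0) * b) ++
            (weights p r (fun k => θ (k + leaves l))).map (fun b => sinP p (θ 0) * b))).getD i 0 =
            0 := by
          intro θ
          rw [List.getD_eq_default]
          simp [length_weights]
          omega
        simp_rw [e]
        exact measurable_const

/-- The weight of the `i`-th leaf. -/
noncomputable def leafWeight (p : ℝ) (g : BinTree) (θ : ℕ → ℝ) (i : Fin g.leaves) : ℝ :=
  (weights p g θ).getD i 0

lemma measurable_leafWeight (p : ℝ) (g : BinTree) : Measurable (leafWeight p g) :=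
  measurable_pi_iff.2 fun i => measurable_getD_weights p g i

lemma sum_map_weights (p : ℝ) (g : BinTree) (θ : ℕ → ℝ) (f : ℝ → ℝ) :
    ((weights p g θ).map f).sum = ∑ i, f (leafWeight p g θ i) := by
  have : ∀ (L : List ℝ) (n : ℕ), L.length = n → (L.map f).sum = ∑ i : Fin n, f (L.getD i 0) := by
    rintro L _ rfl
    rw [← Fin.sum_univ_fun_getElem]
    exact Finset.sum_congr rfl fun i _ => by rw [List.getD_eq_getElem _ _ i.2]
  exact this _ _ (length_weights p g θ)

lemma prod_map_weights (p : ℝ) (g : BinTree) (θ : ℕ → ℝ) (f : ℝ → ℝ) :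
    ((weights p g θ).map f).prod = ∏ i, f (leafWeight p g θ i) := by
  have : ∀ (L : List ℝ) (n : ℕ), L.length = n → (L.map f).prod = ∏ i : Fin n, f (L.getD i 0) := by
    rintro L _ rfl
    rw [← Fin.prod_univ_fun_getElem]
    exact Finset.prod_congr rfl fun i _ => by rw [List.getD_eq_getElem _ _ i.2]
  exact this _ _ (length_weights p g θ)

lemma leafWeight_mem (p : ℝ) (g : BinTree) (θ : ℕ → ℝ) (i : Fin g.leaves) :
    leafWeight p g θ i ∈ weights p g θ := by
  have h : (i : ℕ) < (weights p g θ).length := by rw [length_weights]; exact i.2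
  rw [leafWeight, List.getD_eq_getElem _ _ h]
  exact List.getElem_mem h

lemma measurable_foldr_max {Ω : Type*} [MeasurableSpace Ω] (n : ℕ) {L : Ω → List ℝ}
    (hL : ∀ ω, (L ω).length = n) (hm : ∀ i, Measurable fun ω => (L ω).getD i 0) :
    Measurable fun ω => ((L ω).map fun b => |b|).foldr max 0 := by
  induction n generalizing L with
  | zero =>
    have : ∀ ω, L ω = [] := fun ω => List.length_eq_zero_iff.1 (hL ω)
    simp [this]
  | succ n ih =>
    have e : ∀ ω, ((L ω).map fun b => |b|).foldr max 0 =
        max |(L ω).getD 0 0| (((L ω).tail.map fun b => |b|).foldr max 0) := by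
      intro ω
      have := hL ω
      cases h : L ω with
      | nil => simp [h] at this
      | cons a l => simp
    simp_rw [e]
    refine (hm 0).abs.max (ih (fun ω => by simp [hL]) fun i => ?_)
    have e2 : ∀ ω, (L ω).tail.getD i 0 = (L ω).getD (i + 1) 0 := by
      intro ω
      cases h : L ω with
      | nil => simp
      | cons a l => simp
    simp_rw [e2]
    exact hm (i + 1)

lemma measurable_maxWeight (p : ℝ) (g : BinTree) : Measurable fun θ => maxWeight p g θ :=
  measurable_foldr_max g.leaves (length_weights p g) (measurable_getD_weights p g)

lemma abs_le_foldr_max (L : List ℝ) {b : ℝ} (hb : b ∈ L) :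
    |b| ≤ (L.map fun b => |b|).foldr max 0 := by
  induction L with
  | nil => simp at hb
  | cons a l ih =>
    rcases List.mem_cons.1 hb with rfl | h
    · simp
    · simp only [List.map_cons, List.foldr_cons]
      exact le_max_of_le_right (ih h)

lemma foldr_max_le (L : List ℝ) {B : ℝ} (hB : 0 ≤ B) (h : ∀ b ∈ L, |b| ≤ B) :
    (L.map fun b => |b|).foldr max 0 ≤ B := by
  induction L with
  | nil => simpa
  | cons a l ih =>
    simp only [List.map_cons, List.foldr_cons]
    exact max_le (h a (by simp)) (ih fun b hb => h b (by simp [hb]))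

lemma foldr_max_nonneg (L : List ℝ) : 0 ≤ (L.map fun b => |b|).foldr max 0 := by
  induction L with
  | nil => simp
  | cons a l ih => simp only [List.map_cons, List.foldr_cons]; exact le_max_of_le_right ih

section Alpha

variable {α p : ℝ}

lemma abs_mul_abs_rpow {x q m : ℝ} (hp : 0 < 1 + p) (hm : q * (1 + p) = m) :
    |x * |x| ^ p| ^ q = |x| ^ m := by
  rw [abs_mul, abs_of_nonneg (Real.rpow_nonneg (abs_nonneg x) p)]
  rcases eq_or_ne x 0 with rfl | hx
  · rcases eq_or_ne q 0 with rfl | hq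
    · rw [← hm]; simp
    · rw [← hm]; simp [hq, hp.ne', Real.zero_rpow]
  · have : 0 < |x| := abs_pos.2 hx
    rw [← Real.rpow_one_add' this.le hp.ne', ← Real.rpow_mul this.le, ← hm, mul_comm]

lemma abs_cosP_rpow {θ q m : ℝ} (hp : 0 < 1 + p) (hm : q * (1 + p) = m) :
    |cosP p θ| ^ q = |Real.cos θ| ^ m := abs_mul_abs_rpow hp hm

lemma abs_sinP_rpow {θ q m : ℝ} (hp : 0 < 1 + p) (hm : q * (1 + p) = m) :
    |sinP p θ| ^ q = |Real.sin θ| ^ m := abs_mul_abs_rpow hp hm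

/-- At each node |c(θ)|^α + |s(θ)|^α = cos²θ + sin²θ = 1, so the sum is conserved down the tree. -/
lemma sum_rpow_weights (hp : 0 < 1 + p) (hα : α * (1 + p) = 2) (g : BinTree) (θ : ℕ → ℝ) :
    ((weights p g θ).map fun b => |b| ^ α).sum = 1 := by
  induction g generalizing θ with
  | leaf => simp [weights]
  | node l r hl hr =>
    have h1 : ∀ (L : List ℝ) (x : ℝ), ((L.map fun b => x * b).map fun b => |b| ^ α).sum =
        |x| ^ α * (L.map fun b => |b| ^ α).sum := by
      intro L x
      rw [← List.sum_map_mul_left, List.map_map]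
      congr 1
      refine List.map_congr_left fun b _ => ?_
      simp only [Function.comp, abs_mul]
      rw [Real.mul_rpow (abs_nonneg _) (abs_nonneg _)]
    simp only [weights, List.map_append, List.sum_append]
    rw [h1, h1, hl, hr, abs_cosP_rpow hp hα, abs_sinP_rpow hp hα]
    simp

lemma sum_rpow_leafWeight (hp : 0 < 1 + p) (hα : α * (1 + p) = 2) (g : BinTree) (θ : ℕ → ℝ) :
    ∑ i, |leafWeight p g θ i| ^ α = 1 := by
  rw [← sum_rpow_weights hp hα g θ, sum_map_weights p g θ fun b => |b| ^ α]

lemma abs_leafWeight_le_one (h0 : 0 < α) (hp : 0 < 1 + p) (hα : α * (1 + p) = 2) (g : BinTree)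
    (θ : ℕ → ℝ) (i : Fin g.leaves) : |leafWeight p g θ i| ≤ 1 := by
  have h1 : |leafWeight p g θ i| ^ α ≤ 1 := by
    rw [← sum_rpow_leafWeight hp hα g θ]
    exact Finset.single_le_sum (f := fun i => |leafWeight p g θ i| ^ α)
      (fun i _ => by positivity) (Finset.mem_univ i)
  by_contra h
  exact absurd h1 (not_le.2 (Real.one_lt_rpow (not_le.1 h) h0))

lemma abs_leafWeight_le_maxWeight (g : BinTree) (θ : ℕ → ℝ) (i : Fin g.leaves) :
    |leafWeight p g θ i| ≤ maxWeight p g θ :=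
  abs_le_foldr_max _ (leafWeight_mem p g θ i)

lemma maxWeight_nonneg (g : BinTree) (θ : ℕ → ℝ) : 0 ≤ maxWeight p g θ := foldr_max_nonneg _

lemma maxWeight_pos (h0 : 0 < α) (hp : 0 < 1 + p) (hα : α * (1 + p) = 2) (g : BinTree)
    (θ : ℕ → ℝ) : 0 < maxWeight p g θ := by
  refine (maxWeight_nonneg g θ).lt_of_ne fun h => ?_
  have h1 := sum_rpow_leafWeight hp hα g θ
  have h2 : ∀ i, |leafWeight p g θ i| ^ α = 0 := fun i => by
    have := abs_leafWeight_le_maxWeight (p := p) g θ i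
    rw [← h] at this
    rw [le_antisymm this (abs_nonneg _), Real.zero_rpow h0.ne']
  simp [h2] at h1

lemma maxWeight_le_one (h0 : 0 < α) (hp : 0 < 1 + p) (hα : α * (1 + p) = 2) (g : BinTree)
    (θ : ℕ → ℝ) : maxWeight p g θ ≤ 1 := by
  refine foldr_max_le _ zero_le_one fun b hb => ?_
  obtain ⟨i, hi, rfl⟩ := List.getElem_of_mem hb
  have := abs_leafWeight_le_one h0 hp hα g θ ⟨i, by rwa [length_weights] at hi⟩
  rwa [leafWeight, List.getD_eq_getElem _ _ hi] at this

end Alpha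

open BinTree

/-! ### Integration with respect to the random tree and its angles -/

lemma treeLaw_eq (t : ℝ) : treeLaw t = Measure.sum fun g : BinTree =>
    ENNReal.ofReal (treeWeight t g) • angleLaw.map (Prod.mk g) := by
  unfold treeLaw treeWeight angleLaw
  simp_rw [Measure.dirac_prod]

lemma measurable_treeLaw_of_measurable {f : BinTree × (ℕ → ℝ) → ℝ}
    (hf : ∀ g, Measurable fun θ => f (g, θ)) : Measurable f :=
  measurable_from_prod_countable_right hf

lemma isProbabilityMeasure_treeLaw {t : ℝ} (ht : 0 ≤ t) : IsProbabilityMeasure (treeLaw t) := by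
  constructor
  rw [treeLaw_eq, Measure.sum_apply _ MeasurableSet.univ, ← tsum_ofReal_treeWeight ht]
  refine tsum_congr fun g => ?_
  rw [Measure.smul_apply, Measure.map_apply measurable_prodMk_left MeasurableSet.univ,
    preimage_univ, measure_univ, smul_eq_mul, mul_one]

lemma integral_treeLaw {t : ℝ} (ht : 0 ≤ t) {f : BinTree × (ℕ → ℝ) → ℝ} {C : ℝ}
    (hf : ∀ g, Measurable fun θ => f (g, θ)) (hC : ∀ g θ, |f (g, θ)| ≤ C) :
    ∫ ω, f ω ∂(treeLaw t) = ∑' g, treeWeight t g * ∫ θ, f (g, θ) ∂angleLaw := by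
  have hp := isProbabilityMeasure_treeLaw ht
  have hm := measurable_treeLaw_of_measurable hf
  have hi : Integrable f (treeLaw t) :=
    Integrable.of_bound hm.aestronglyMeasurable C (Eventually.of_forall fun ω => hC ω.1 ω.2)
  rw [treeLaw_eq] at hi ⊢
  rw [integral_sum_measure hi]
  refine tsum_congr fun g => ?_
  rw [integral_smul_measure, ENNReal.toReal_ofReal (treeWeight_nonneg ht g), smul_eq_mul,
    integral_map measurable_prodMk_left.aemeasurable hm.aestronglyMeasurable]

lemma integral_uniformAngle {E : Type*} [NormedAddCommGroup E] [NormedSpace ℝ E] (f : ℝ → E) :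
    ∫ θ, f θ ∂uniformAngle = (1 / (2 * Real.pi)) • ∫ θ in (0 : ℝ)..(2 * Real.pi), f θ := by
  have hpi : 0 ≤ 2 * Real.pi := by positivity
  rw [uniformAngle, ProbabilityTheory.cond, integral_smul_measure,
    intervalIntegral.integral_of_le hpi, integral_Ico_eq_integral_Ioo, integral_Ioc_eq_integral_Ioo,
    Real.volume_Ico, sub_zero, ENNReal.toReal_inv, ENNReal.toReal_ofReal hpi, one_div]

lemma integral_uniformAngle_comp_sub {f : ℝ → ℝ} (hf : Function.Periodic f (2 * Real.pi)) (c : ℝ) :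
    ∫ θ, f (c - θ) ∂uniformAngle = ∫ θ, f θ ∂uniformAngle := by
  rw [integral_uniformAngle, integral_uniformAngle, intervalIntegral.integral_comp_sub_left]
  have := hf.intervalIntegral_add_eq (c - 2 * Real.pi) 0
  rw [sub_add_cancel, zero_add] at this
  rw [sub_zero, this]

/-- A periodic function that changes sign under a reflection of the circle has mean zero; the
reflections at c = 0 and c = π are the ones needed. -/
lemma integral_uniformAngle_eq_zero {f : ℝ → ℝ} (hf : Function.Periodic f (2 * Real.pi)) (c : ℝ)
    (hc : ∀ θ, f (c - θ) = -f θ) : ∫ θ, f θ ∂uniformAngle = 0 := by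
  have h := integral_uniformAngle_comp_sub hf c
  simp_rw [hc, integral_neg] at h
  linarith

lemma sinMoment_eq (m : ℝ) : sinMoment m = ∫ θ, |Real.sin θ| ^ m ∂uniformAngle := by
  rw [integral_uniformAngle, sinMoment, smul_eq_mul]

lemma integral_abs_cos_rpow (m : ℝ) : ∫ θ, |Real.cos θ| ^ m ∂uniformAngle = sinMoment m := by
  rw [sinMoment_eq, ← integral_uniformAngle_comp_sub (f := fun θ => |Real.sin θ| ^ m)
    (fun θ => by simp only [Real.sin_add_two_pi]) (Real.pi / 2)]
  simp_rw [Real.sin_pi_div_two_sub]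

/-- If `|u'| ≤ B'` on `(0, ∞)` and `u(0) = B(0) = 0` then `|u| ≤ B`. -/
lemma abs_le_of_abs_deriv_le {u u' B B' : ℝ → ℝ} (hu : ContinuousOn u (Ici 0)) (hu0 : u 0 = 0)
    (hd : ∀ t, 0 < t → HasDerivAt u (u' t) t) (hB : ContinuousOn B (Ici 0)) (hB0 : B 0 = 0)
    (hBd : ∀ t, 0 < t → HasDerivAt B (B' t) t) (hle : ∀ t, 0 < t → |u' t| ≤ B' t) {t : ℝ}
    (ht : 0 ≤ t) : |u t| ≤ B t := by
  -- For both signs σ, B - σu is increasing on [0,∞) and vanishes at 0.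
  have h : ∀ σ : ℝ, |σ| = 1 → σ * u t ≤ B t := by
    intro σ hσ
    have hder : ∀ s, 0 < s → HasDerivAt (fun s => B s - σ * u s) (B' s - σ * u' s) s :=
      fun s hs => (hBd s hs).sub ((hd s hs).const_mul σ)
    have hmono : MonotoneOn (fun s => B s - σ * u s) (Ici 0) := by
      refine monotoneOn_of_deriv_nonneg (convex_Ici 0) (hB.sub (hu.const_mul σ)) ?_ ?_
      · rw [interior_Ici]
        exact fun s hs => (hder s hs).differentiableAt.differentiableWithinAt
      · rw [interior_Ici]
        intro s hs
        rw [(hder s hs).deriv]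
        have h1 := hle s hs
        have h2 : σ * u' s ≤ |u' s| := by
          calc σ * u' s ≤ |σ * u' s| := le_abs_self _
            _ = |u' s| := by rw [abs_mul, hσ, one_mul]
        linarith
    have := hmono (mem_Ici.2 le_rfl) (mem_Ici.2 ht) ht
    simp only [hB0, hu0] at this
    linarith
  rw [abs_le]
  have h1 := h 1 (by simp)
  have h2 := h (-1) (by simp)
  constructor <;> linarith

/-! ### Moments of the weights -/

lemma measurable_sum_weights (p : ℝ) (g : BinTree) {f : ℝ → ℝ} (hf : Measurable f) :
    Measurable fun θ => ((weights p g θ).map f).sum := by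
  simp_rw [sum_map_weights]
  have h : ∀ i, Measurable fun θ => leafWeight p g θ i := measurable_pi_iff.1 (measurable_leafWeight p g)
  exact Finset.measurable_sum _ fun i _ => hf.comp (h i)

section Moments

variable {α p : ℝ}

lemma sum_rpow_weights_le (h0 : 0 < α) (hp : 0 < 1 + p) (hα : α * (1 + p) = 2) {q : ℝ} (hq : α ≤ q)
    (g : BinTree) (θ : ℕ → ℝ) : |((weights p g θ).map fun b => |b| ^ q).sum| ≤ 1 := by
  rw [sum_map_weights p g θ fun b => |b| ^ q,
    abs_of_nonneg (Finset.sum_nonneg fun i _ => by positivity), ← sum_rpow_leafWeight hp hα g θ]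
  refine Finset.sum_le_sum fun i _ => ?_
  rcases (abs_nonneg (leafWeight p g θ i)).eq_or_lt with h | h
  · rw [← h, Real.zero_rpow h0.ne', Real.zero_rpow (h0.trans_le hq).ne']
  · exact Real.rpow_le_rpow_of_exponent_ge h (abs_leafWeight_le_one h0 hp hα g θ i) hq

/-- `E[∑_j |β_j|^q]` for a given tree. -/
noncomputable def treeMoment (p q : ℝ) (g : BinTree) : ℝ :=
  ∫ θ, ((weights p g θ).map fun b => |b| ^ q).sum ∂angleLaw

lemma abs_treeMoment_le (h0 : 0 < α) (hp : 0 < 1 + p) (hα : α * (1 + p) = 2) {q : ℝ} (hq : α ≤ q)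
    (g : BinTree) : |treeMoment p q g| ≤ 1 := by
  have := norm_integral_le_of_norm_le_const (μ := angleLaw) (C := 1)
    (f := fun θ => ((weights p g θ).map fun b => |b| ^ q).sum)
    (Eventually.of_forall fun θ => sum_rpow_weights_le h0 hp hα hq g θ)
  simpa [treeMoment] using this

/-- The root angle is independent of the two subtrees, and |cos|^m and |sin|^m have the same mean
A_m. -/
lemma treeMoment_node (h0 : 0 < α) (hp : 0 < 1 + p) (hα : α * (1 + p) = 2) {q m : ℝ} (hq : α ≤ q)
    (hm : q * (1 + p) = m) (l r : BinTree) :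
    treeMoment p q (node l r) = sinMoment m * (treeMoment p q l + treeMoment p q r) := by
  have hf : Measurable fun b : ℝ => |b| ^ q := by fun_prop
  have hm0 : 0 ≤ m := by rw [← hm]; exact mul_nonneg (h0.le.trans hq) hp.le
  have e : ∀ z : ℝ × (ℕ → ℝ) × (ℕ → ℝ),
      ((weights p (node l r) (splice l.leaves z)).map fun b => |b| ^ q).sum =
      |Real.cos z.1| ^ m * ((weights p l z.2.1).map fun b => |b| ^ q).sum +
      |Real.sin z.1| ^ m * ((weights p r z.2.2).map fun b => |b| ^ q).sum := by
    rintro ⟨u, a, b⟩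
    have h1 : ∀ (L : List ℝ) (x : ℝ), ((L.map fun b => x * b).map fun b => |b| ^ q).sum =
        |x| ^ q * (L.map fun b => |b| ^ q).sum := by
      intro L x
      rw [← List.sum_map_mul_left, List.map_map]
      congr 1
      refine List.map_congr_left fun b _ => ?_
      simp only [Function.comp, abs_mul]
      rw [Real.mul_rpow (abs_nonneg _) (abs_nonneg _)]
    rw [weights_node_splice, List.map_append, List.sum_append, h1, h1, abs_cosP_rpow hp hm,
      abs_sinP_rpow hp hm]
  have hml := measurable_sum_weights p l hf
  have hmr := measurable_sum_weights p r hf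
  have hbd : ∀ (x y : ℝ), |x| ≤ 1 → |y| ≤ 1 → ‖|x| ^ m * y‖ ≤ 1 := by
    intro x y hx hy
    rw [norm_mul, Real.norm_of_nonneg (by positivity), Real.norm_eq_abs]
    exact mul_le_one₀ (Real.rpow_le_one (abs_nonneg _) hx hm0) (abs_nonneg _) hy
  have hi1 : Integrable (fun z : ℝ × (ℕ → ℝ) × (ℕ → ℝ) =>
      |Real.cos z.1| ^ m * ((weights p l z.2.1).map fun b => |b| ^ q).sum)
      (uniformAngle.prod (angleLaw.prod angleLaw)) :=
    Integrable.of_bound (Measurable.aestronglyMeasurable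
      (Measurable.mul (by fun_prop) (hml.comp (by fun_prop)))) 1
      (Eventually.of_forall fun z => hbd _ _ (Real.abs_cos_le_one _)
        (sum_rpow_weights_le h0 hp hα hq l _))
  have hi2 : Integrable (fun z : ℝ × (ℕ → ℝ) × (ℕ → ℝ) =>
      |Real.sin z.1| ^ m * ((weights p r z.2.2).map fun b => |b| ^ q).sum)
      (uniformAngle.prod (angleLaw.prod angleLaw)) :=
    Integrable.of_bound (Measurable.aestronglyMeasurable
      (Measurable.mul (by fun_prop) (hmr.comp (by fun_prop)))) 1
      (Eventually.of_forall fun z => hbd _ _ (Real.abs_sin_le_one _)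
        (sum_rpow_weights_le h0 hp hα hq r _))
  rw [treeMoment, integral_angleLaw l.leaves (one_le_leaves l) (measurable_sum_weights p _ hf)]
  simp_rw [e]
  rw [integral_add hi1 hi2,
    integral_prod_mul (fun u => |Real.cos u| ^ m)
      (fun w : (ℕ → ℝ) × (ℕ → ℝ) => ((weights p l w.1).map fun b => |b| ^ q).sum),
    integral_prod_mul (fun u => |Real.sin u| ^ m)
      (fun w : (ℕ → ℝ) × (ℕ → ℝ) => ((weights p r w.2).map fun b => |b| ^ q).sum),
    integral_fun_fst (fun a => ((weights p l a).map fun b => |b| ^ q).sum),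
    integral_fun_snd (fun a => ((weights p r a).map fun b => |b| ^ q).sum),
    integral_abs_cos_rpow, ← sinMoment_eq]
  simp only [probReal_univ, one_smul, treeMoment]
  ring

/-- `E_t[∑_j |β_j|^q] = exp(-t (1 - 2 A_m))` with `m = q (1 + p)`. -/
lemma tsum_treeWeight_mul_treeMoment (h0 : 0 < α) (hp : 0 < 1 + p) (hα : α * (1 + p) = 2)
    {q m : ℝ} (hq : α ≤ q) (hm : q * (1 + p) = m) {t : ℝ} (ht : 0 ≤ t) :
    ∑' g, treeWeight t g * treeMoment p q g = Real.exp (-t * (1 - 2 * sinMoment m)) := by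
  have hX := abs_treeMoment_le h0 hp hα hq
  set A := sinMoment m
  set f : ℝ → ℝ := fun t => ∑' g, treeWeight t g * treeMoment p q g with hf
  -- Splitting at the root makes the forward equation linear: each subtree contributes A f(t), the
  -- other weight summing to 1.
  have hd : ∀ t, 0 < t → HasDerivAt f ((2 * A - 1) * f t) t := by
    intro t ht
    have h := hasDerivAt_tsum_treeWeight_mul hX ht
    have e : ∑' z : BinTree × BinTree, treeWeight t z.1 * treeWeight t z.2 *
        treeMoment p q (node z.1 z.2) = 2 * A * f t := by
      have hw := (hasSum_treeWeight ht.le).summable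
      have hwX := summable_treeWeight_mul ht.le hX
      have e1 : ∀ z : BinTree × BinTree, treeWeight t z.1 * treeWeight t z.2 *
          treeMoment p q (node z.1 z.2) =
          A * ((treeWeight t z.1 * treeMoment p q z.1) * treeWeight t z.2) +
          A * (treeWeight t z.1 * (treeWeight t z.2 * treeMoment p q z.2)) := by
        intro z
        rw [treeMoment_node h0 hp hα hq hm]
        ring
      simp_rw [e1]
      have hs1 := summable_mul_of_summable_norm hwX.norm hw.norm
      have hs2 := summable_mul_of_summable_norm hw.norm hwX.norm
      rw [(hs1.mul_left A).tsum_add (hs2.mul_left A), tsum_mul_left, tsum_mul_left,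
        ← tsum_mul_tsum_of_summable_norm hwX.norm hw.norm,
        ← tsum_mul_tsum_of_summable_norm hw.norm hwX.norm, (hasSum_treeWeight ht.le).tsum_eq]
      ring
    rw [e] at h
    convert h using 1
    ring
  have hf0 : f 0 = 1 := by
    rw [hf]
    simp only [tsum_treeWeight_zero_mul, treeMoment, weights]
    simp
  have hexp : ∀ t : ℝ, HasDerivAt (fun t => Real.exp (t * (1 - 2 * A)))
      (Real.exp (t * (1 - 2 * A)) * (1 * (1 - 2 * A))) t := fun t =>
    ((hasDerivAt_id t).mul_const (1 - 2 * A)).exp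
  have hcont : ContinuousOn (fun t => Real.exp (t * (1 - 2 * A)) * f t - 1) (Ici 0) :=
    ((Continuous.continuousOn (by fun_prop)).mul (continuousOn_tsum_treeWeight_mul hX)).sub
      continuousOn_const
  -- With the integrating factor the derivative is 0, so the comparison lemma with majorant 0 gives
  -- constancy down to t = 0.
  have h := abs_le_of_abs_deriv_le (u := fun t => Real.exp (t * (1 - 2 * A)) * f t - 1)
    (u' := fun _ => 0) (B := fun _ => 0) (B' := fun _ => 0) hcont
    (by simp [hf0]) (fun t ht => by
      have := ((hexp t).mul (hd t ht)).sub_const 1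
      have e : (0 : ℝ) = Real.exp (t * (1 - 2 * A)) * (1 * (1 - 2 * A)) * f t +
          Real.exp (t * (1 - 2 * A)) * ((2 * A - 1) * f t) := by ring
      rw [e]
      exact this) continuousOn_const rfl (fun t _ => hasDerivAt_const t 0) (fun t _ => by simp) ht
  have h2 : Real.exp (t * (1 - 2 * A)) * f t = 1 := by
    have := abs_nonpos_iff.1 h
    linarith
  have h3 : Real.exp (-t * (1 - 2 * A)) * Real.exp (t * (1 - 2 * A)) = 1 := by
    rw [← Real.exp_add]; simp
  calc f t = Real.exp (-t * (1 - 2 * A)) * Real.exp (t * (1 - 2 * A)) * f t := by rw [h3, one_mul]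
    _ = _ := by rw [mul_assoc, h2, mul_one]

end Moments

open BinTree

/-! ### The Wild sum for the real part of the solution -/

lemma cosP_add_two_pi (p θ : ℝ) : cosP p (θ + 2 * Real.pi) = cosP p θ := by
  simp [cosP, Real.cos_add_two_pi]

lemma sinP_add_two_pi (p θ : ℝ) : sinP p (θ + 2 * Real.pi) = sinP p θ := by
  simp [sinP, Real.sin_add_two_pi]

lemma abs_re_charFun_le_one (μ : Measure ℝ) [IsProbabilityMeasure μ] (ξ : ℝ) :
    |(charFun μ ξ).re| ≤ 1 :=
  (Complex.abs_re_le_norm _).trans (norm_charFun_le_one ξ)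

lemma abs_im_charFun_le_one (μ : Measure ℝ) [IsProbabilityMeasure μ] (ξ : ℝ) :
    |(charFun μ ξ).im| ≤ 1 :=
  (Complex.abs_im_le_norm _).trans (norm_charFun_le_one ξ)

/-- The expectation of `∏_j Re φ₀(β_j ξ)` for a given tree. -/
noncomputable def charProd (μ₀ : Measure ℝ) (p ξ : ℝ) (g : BinTree) : ℝ :=
  ∫ θ, ((weights p g θ).map fun b => (charFun μ₀ (b * ξ)).re).prod ∂angleLaw

section CharProd

variable (μ₀ : Measure ℝ) [IsProbabilityMeasure μ₀] (p : ℝ)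

lemma measurable_prod_weights (g : BinTree) :
    Measurable fun z : ℝ × (ℕ → ℝ) =>
      ((weights p g z.2).map fun b => (charFun μ₀ (b * z.1)).re).prod := by
  have e : ∀ z : ℝ × (ℕ → ℝ), ((weights p g z.2).map fun b => (charFun μ₀ (b * z.1)).re).prod =
      ∏ i, (charFun μ₀ (leafWeight p g z.2 i * z.1)).re := fun z =>
    prod_map_weights p g z.2 fun b => (charFun μ₀ (b * z.1)).re
  simp_rw [e]
  have h : ∀ i, Measurable fun θ => leafWeight p g θ i := measurable_pi_iff.1 (measurable_leafWeight p g)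
  refine Finset.measurable_prod _ fun i _ => ?_
  have hc : Measurable fun x => (charFun μ₀ x).re := by fun_prop
  exact hc.comp (((h i).comp measurable_snd).mul measurable_fst)

lemma abs_prod_weights_le_one (g : BinTree) (ξ : ℝ) (θ : ℕ → ℝ) :
    |((weights p g θ).map fun b => (charFun μ₀ (b * ξ)).re).prod| ≤ 1 := by
  rw [prod_map_weights p g θ fun b => (charFun μ₀ (b * ξ)).re, Finset.abs_prod]
  exact Finset.prod_le_one (fun i _ => abs_nonneg _) fun i _ => abs_re_charFun_le_one _ _

lemma abs_charProd_le_one (ξ : ℝ) (g : BinTree) : |charProd μ₀ p ξ g| ≤ 1 := by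
  have := norm_integral_le_of_norm_le_const (μ := angleLaw) (C := 1)
    (f := fun θ => ((weights p g θ).map fun b => (charFun μ₀ (b * ξ)).re).prod)
    (Eventually.of_forall fun θ => abs_prod_weights_le_one μ₀ p g ξ θ)
  simpa [charProd] using this

lemma measurable_charProd (g : BinTree) : Measurable fun ξ => charProd μ₀ p ξ g :=
  (StronglyMeasurable.integral_prod_right' (ν := angleLaw)
    (measurable_prod_weights μ₀ p g).stronglyMeasurable).measurable

lemma charProd_leaf (μ₀ : Measure ℝ) (p ξ : ℝ) : charProd μ₀ p ξ leaf = (charFun μ₀ ξ).re := by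
  simp [charProd, weights]

lemma integral_angle_prod_mul {A B : ℝ → (ℕ → ℝ) → ℝ} (hA : Measurable fun z : ℝ × (ℕ → ℝ) => A z.1 z.2)
    (hB : Measurable fun z : ℝ × (ℕ → ℝ) => B z.1 z.2) (hA1 : ∀ u a, |A u a| ≤ 1)
    (hB1 : ∀ u b, |B u b| ≤ 1) :
    ∫ z : ℝ × (ℕ → ℝ) × (ℕ → ℝ), A z.1 z.2.1 * B z.1 z.2.2
      ∂(uniformAngle.prod (angleLaw.prod angleLaw)) =
      ∫ u, (∫ a, A u a ∂angleLaw) * ∫ b, B u b ∂angleLaw ∂uniformAngle := by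
  have k1 : Measurable fun z : ℝ × (ℕ → ℝ) × (ℕ → ℝ) => (z.1, z.2.1) := by fun_prop
  have k2 : Measurable fun z : ℝ × (ℕ → ℝ) × (ℕ → ℝ) => (z.1, z.2.2) := by fun_prop
  rw [integral_prod]
  · exact integral_congr_ae (Eventually.of_forall fun u => integral_prod_mul (A u) (B u))
  · refine Integrable.of_bound ((hA.comp k1).mul (hB.comp k2)).aestronglyMeasurable 1
      (Eventually.of_forall fun z => ?_)
    rw [norm_mul]
    exact mul_le_one₀ (hA1 _ _) (norm_nonneg _) (hB1 _ _)

lemma prod_weights_node_splice (μ₀ : Measure ℝ) (p ξ : ℝ) (l r : BinTree) (z : ℝ × (ℕ → ℝ) × (ℕ → ℝ)) :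
    ((weights p (node l r) (splice l.leaves z)).map fun b => (charFun μ₀ (b * ξ)).re).prod =
      ((weights p l z.2.1).map fun b => (charFun μ₀ (b * (ξ * cosP p z.1))).re).prod *
      ((weights p r z.2.2).map fun b => (charFun μ₀ (b * (ξ * sinP p z.1))).re).prod := by
  obtain ⟨u, a, b⟩ := z
  rw [weights_node_splice, List.map_append, List.prod_append, List.map_map, List.map_map]
  congr 1
  · congr 1
    refine List.map_congr_left fun b _ => ?_
    rw [Function.comp_apply, show cosP p u * b * ξ = b * (ξ * cosP p u) by ring]
  · congr 1
    refine List.map_congr_left fun b _ => ?_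
    rw [Function.comp_apply, show sinP p u * b * ξ = b * (ξ * sinP p u) by ring]

/-- Conditionally on the root angle, the two subtrees are independent and see the arguments ξc(θ)
and ξs(θ). This recursion is the gain term of the kinetic equation. -/
lemma charProd_node (ξ : ℝ) (l r : BinTree) :
    charProd μ₀ p ξ (node l r) =
      ∫ u, charProd μ₀ p (ξ * cosP p u) l * charProd μ₀ p (ξ * sinP p u) r ∂uniformAngle := by
  have hc := measurable_cosP p
  have hs := measurable_sinP p
  have k1 : Measurable fun z : ℝ × (ℕ → ℝ) => (ξ * cosP p z.1, z.2) := by fun_prop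
  have k2 : Measurable fun z : ℝ × (ℕ → ℝ) => (ξ * sinP p z.1, z.2) := by fun_prop
  have k3 : Measurable fun θ : ℕ → ℝ => (ξ, θ) := measurable_prodMk_left
  set A : ℝ → (ℕ → ℝ) → ℝ :=
    fun x a => ((weights p l a).map fun b => (charFun μ₀ (b * x)).re).prod with hA
  set B : ℝ → (ℕ → ℝ) → ℝ :=
    fun x a => ((weights p r a).map fun b => (charFun μ₀ (b * x)).re).prod with hB
  have hAm : Measurable fun z : ℝ × (ℕ → ℝ) => A z.1 z.2 := measurable_prod_weights μ₀ p l
  have hBm : Measurable fun z : ℝ × (ℕ → ℝ) => B z.1 z.2 := measurable_prod_weights μ₀ p r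
  have hA1 : ∀ x a, |A x a| ≤ 1 := fun x a => abs_prod_weights_le_one μ₀ p l x a
  have hB1 : ∀ x a, |B x a| ≤ 1 := fun x a => abs_prod_weights_le_one μ₀ p r x a
  have hm : Measurable fun θ => ((weights p (node l r) θ).map fun b => (charFun μ₀ (b * ξ)).re).prod :=
    (measurable_prod_weights μ₀ p (node l r)).comp k3
  have hsp : ∀ z, ((weights p (node l r) (splice l.leaves z)).map
      fun b => (charFun μ₀ (b * ξ)).re).prod = A (ξ * cosP p z.1) z.2.1 * B (ξ * sinP p z.1) z.2.2 :=
    prod_weights_node_splice μ₀ p ξ l r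
  have hl : ∀ x, charProd μ₀ p x l = ∫ a, A x a ∂angleLaw := fun x => rfl
  have hr : ∀ x, charProd μ₀ p x r = ∫ a, B x a ∂angleLaw := fun x => rfl
  clear_value A B
  simp_rw [hl, hr]
  rw [charProd, integral_angleLaw l.leaves (one_le_leaves l) hm]
  simp_rw [hsp]
  exact integral_angle_prod_mul (A := fun u a => A (ξ * cosP p u) a)
    (B := fun u a => B (ξ * sinP p u) a) (hAm.comp k1) (hBm.comp k2) (fun u a => hA1 _ a)
    (fun u a => hB1 _ a)

/-- The Wild sum `E_t[∏_j Re φ₀(β_{j,t} ξ)]`. -/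
noncomputable def wildSum (t ξ : ℝ) : ℝ := ∑' g, treeWeight t g * charProd μ₀ p ξ g

lemma measurable_wildSum (t : ℝ) : Measurable (wildSum μ₀ p t) := by
  have h : ∀ g, Measurable fun ξ => treeWeight t g * charProd μ₀ p ξ g := fun g =>
    (measurable_charProd μ₀ p g).const_mul _
  exact Measurable.tsum h

lemma abs_wildSum_le_one {t : ℝ} (ht : 0 ≤ t) (ξ : ℝ) : |wildSum μ₀ p t ξ| ≤ 1 :=
  abs_tsum_treeWeight_mul_le ht (abs_charProd_le_one μ₀ p ξ)

/-- The forward equation sums over pairs of subtrees; the root recursion turns each summand into an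
angular integral, and the double series factors into a product of two Wild sums. -/
lemma hasDerivAt_wildSum {t : ℝ} (ht : 0 < t) (ξ : ℝ) :
    HasDerivAt (fun t => wildSum μ₀ p t ξ)
      ((∫ u, wildSum μ₀ p t (ξ * sinP p u) * wildSum μ₀ p t (ξ * cosP p u) ∂uniformAngle)
        - wildSum μ₀ p t ξ) t := by
  have hc := measurable_cosP p
  have hs := measurable_sinP p
  have h := hasDerivAt_tsum_treeWeight_mul (abs_charProd_le_one μ₀ p ξ) ht
  have e : ∑' z : BinTree × BinTree, treeWeight t z.1 * treeWeight t z.2 *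
      charProd μ₀ p ξ (node z.1 z.2) =
      ∫ u, wildSum μ₀ p t (ξ * sinP p u) * wildSum μ₀ p t (ξ * cosP p u) ∂uniformAngle := by
    have hprod : ∀ u, wildSum μ₀ p t (ξ * sinP p u) * wildSum μ₀ p t (ξ * cosP p u) =
        ∑' z : BinTree × BinTree, treeWeight t z.1 * treeWeight t z.2 *
          (charProd μ₀ p (ξ * cosP p u) z.1 * charProd μ₀ p (ξ * sinP p u) z.2) := by
      intro u
      rw [mul_comm, wildSum, wildSum, tsum_mul_tsum_of_summable_norm
        (summable_treeWeight_mul ht.le (abs_charProd_le_one μ₀ p _)).norm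
        (summable_treeWeight_mul ht.le (abs_charProd_le_one μ₀ p _)).norm]
      exact tsum_congr fun z => by ring
    simp_rw [hprod]
    have hb : ∀ (z : BinTree × BinTree) (u : ℝ), ‖treeWeight t z.1 * treeWeight t z.2 *
        (charProd μ₀ p (ξ * cosP p u) z.1 * charProd μ₀ p (ξ * sinP p u) z.2)‖ ≤
        treeWeight t z.1 * treeWeight t z.2 := by
      intro z u
      have h0 := mul_nonneg (treeWeight_nonneg ht.le z.1) (treeWeight_nonneg ht.le z.2)
      rw [norm_mul, Real.norm_of_nonneg h0, norm_mul]
      exact mul_le_of_le_one_right h0 (mul_le_one₀ (abs_charProd_le_one μ₀ p _ _) (norm_nonneg _)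
        (abs_charProd_le_one μ₀ p _ _))
    have hint : ∀ z : BinTree × BinTree, Integrable (fun u => treeWeight t z.1 * treeWeight t z.2 *
        (charProd μ₀ p (ξ * cosP p u) z.1 * charProd μ₀ p (ξ * sinP p u) z.2)) uniformAngle := by
      intro z
      refine Integrable.of_bound (Measurable.aestronglyMeasurable ?_) _
        (Eventually.of_forall (hb z))
      exact Measurable.const_mul (((measurable_charProd μ₀ p z.1).comp (hc.const_mul ξ)).mul
        ((measurable_charProd μ₀ p z.2).comp (hs.const_mul ξ))) _
    -- Sum and integral commute because the products of tree weights form a summable majorant.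
    have hsum := (hasSum_integral_of_summable_integral_norm hint (by
      refine Summable.of_nonneg_of_le (fun z => integral_nonneg fun u => norm_nonneg _)
        (fun z => ?_) (summable_treeWeight_mul_treeWeight ht.le)
      have := integral_mono (hint z).norm (integrable_const (μ := uniformAngle)
        (treeWeight t z.1 * treeWeight t z.2)) (hb z)
      simpa using this)).tsum_eq
    rw [← hsum]
    refine tsum_congr fun z => ?_
    rw [integral_const_mul, charProd_node]
  rw [e] at h
  exact h

lemma continuousWithinAt_wildSum (ξ : ℝ) :
    ContinuousWithinAt (fun t => wildSum μ₀ p t ξ) (Ici 0) 0 :=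
  continuousOn_tsum_treeWeight_mul (abs_charProd_le_one μ₀ p ξ) 0 (mem_Ici.2 le_rfl)

end CharProd

/-! ### Uniqueness -/

lemma continuousOn_Ici_of_hasDerivAt {f f' : ℝ → ℝ} (h0 : ContinuousWithinAt f (Ici 0) 0)
    (hd : ∀ t, 0 < t → HasDerivAt f (f' t) t) : ContinuousOn f (Ici 0) := by
  intro t ht
  rcases (mem_Ici.1 ht).eq_or_lt with rfl | h
  · exact h0
  · exact (hd t h).continuousAt.continuousWithinAt

/-- Uniqueness of bounded solutions of the kinetic equation for real-valued functions. -/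
lemma eq_of_hasDerivAt_gain {p : ℝ} {r₁ r₂ : ℝ → ℝ → ℝ}
    (hm₁ : ∀ t, 0 ≤ t → Measurable (r₁ t)) (hm₂ : ∀ t, 0 ≤ t → Measurable (r₂ t))
    (hb₁ : ∀ t, 0 ≤ t → ∀ ξ, |r₁ t ξ| ≤ 1) (hb₂ : ∀ t, 0 ≤ t → ∀ ξ, |r₂ t ξ| ≤ 1)
    (hc₁ : ∀ ξ, ContinuousWithinAt (fun t => r₁ t ξ) (Ici 0) 0)
    (hc₂ : ∀ ξ, ContinuousWithinAt (fun t => r₂ t ξ) (Ici 0) 0)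
    (hd₁ : ∀ ξ t, 0 < t → HasDerivAt (fun t => r₁ t ξ)
      ((∫ u, r₁ t (ξ * sinP p u) * r₁ t (ξ * cosP p u) ∂uniformAngle) - r₁ t ξ) t)
    (hd₂ : ∀ ξ t, 0 < t → HasDerivAt (fun t => r₂ t ξ)
      ((∫ u, r₂ t (ξ * sinP p u) * r₂ t (ξ * cosP p u) ∂uniformAngle) - r₂ t ξ) t)
    (h0 : ∀ ξ, r₁ 0 ξ = r₂ 0 ξ) {t : ℝ} (ht : 0 ≤ t) (ξ : ℝ) : r₁ t ξ = r₂ t ξ := by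
  have hcm := measurable_cosP p
  have hsm := measurable_sinP p
  -- Picard iteration: the difference of the products contributes 2 and the loss term 1, hence 3t in
  -- the n-th bound.
  have key : ∀ n : ℕ, ∀ t, 0 ≤ t → ∀ ξ, |r₁ t ξ - r₂ t ξ| ≤ 2 * ((3 * t) ^ n / n.factorial) := by
    intro n
    induction n with
    | zero =>
      intro t ht ξ
      have := (abs_sub _ _).trans (add_le_add (hb₁ t ht ξ) (hb₂ t ht ξ))
      norm_num at this ⊢
      exact this
    | succ n ih =>
      intro t ht ξ
      have hB : ∀ t : ℝ, HasDerivAt (fun t : ℝ => 2 * ((3 * t) ^ (n + 1) / (n + 1).factorial))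
          (3 * (2 * ((3 * t) ^ n / n.factorial))) t := by
        intro t
        have hl : HasDerivAt (fun t : ℝ => 3 * t) 3 t := by
          simpa using (hasDerivAt_id t).const_mul 3
        have h := ((hl.pow (n + 1)).div_const ((n + 1).factorial : ℝ)).const_mul 2
        have e : 3 * (2 * ((3 * t) ^ n / n.factorial)) =
            2 * (((n + 1 : ℕ) : ℝ) * (3 * t) ^ (n + 1 - 1) * 3 / (n + 1).factorial) := by
          rw [Nat.factorial_succ, Nat.add_sub_cancel]
          have : (n.factorial : ℝ) ≠ 0 := by positivity
          push_cast
          field_simp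
        rw [e]
        exact h
      refine abs_le_of_abs_deriv_le (u := fun t => r₁ t ξ - r₂ t ξ)
        (B := fun t => 2 * ((3 * t) ^ (n + 1) / (n + 1).factorial))
        ((continuousOn_Ici_of_hasDerivAt (hc₁ ξ) (hd₁ ξ)).sub
          (continuousOn_Ici_of_hasDerivAt (hc₂ ξ) (hd₂ ξ))) (by simp [h0])
        (fun s hs => (hd₁ ξ s hs).sub (hd₂ ξ s hs)) (by fun_prop) (by simp) (fun s _ => hB s) ?_ ht
      intro s hs
      set δ := 2 * ((3 * s) ^ n / n.factorial) with hδ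
      have hi : ∀ r : ℝ → ℝ, Measurable r → (∀ ξ, |r ξ| ≤ 1) →
          Integrable (fun u => r (ξ * sinP p u) * r (ξ * cosP p u)) uniformAngle := by
        intro r hr hrb
        refine Integrable.of_bound (Measurable.aestronglyMeasurable ?_) 1
          (Eventually.of_forall fun u => ?_)
        · exact (hr.comp (hsm.const_mul ξ)).mul (hr.comp (hcm.const_mul ξ))
        · rw [norm_mul]
          exact mul_le_one₀ (hrb _) (norm_nonneg _) (hrb _)
      have h1 : |(∫ u, r₁ s (ξ * sinP p u) * r₁ s (ξ * cosP p u) ∂uniformAngle) -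
          ∫ u, r₂ s (ξ * sinP p u) * r₂ s (ξ * cosP p u) ∂uniformAngle| ≤ 2 * δ := by
        rw [← integral_sub (hi _ (hm₁ s hs.le) (hb₁ s hs.le)) (hi _ (hm₂ s hs.le) (hb₂ s hs.le))]
        have := norm_integral_le_of_norm_le_const (μ := uniformAngle) (C := 2 * δ)
          (f := fun u => r₁ s (ξ * sinP p u) * r₁ s (ξ * cosP p u) -
            r₂ s (ξ * sinP p u) * r₂ s (ξ * cosP p u)) (Eventually.of_forall fun u => by
            set x := ξ * sinP p u
            set y := ξ * cosP p u
            have e : r₁ s x * r₁ s y - r₂ s x * r₂ s y =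
                (r₁ s x - r₂ s x) * r₁ s y + r₂ s x * (r₁ s y - r₂ s y) := by ring
            rw [Real.norm_eq_abs, e]
            refine (abs_add_le _ _).trans ?_
            rw [abs_mul, abs_mul]
            have h2 := mul_le_mul (ih s hs.le x) (hb₁ s hs.le y) (abs_nonneg _)
              ((abs_nonneg _).trans (ih s hs.le x))
            have h3 := mul_le_mul (hb₂ s hs.le x) (ih s hs.le y) (abs_nonneg _) zero_le_one
            linarith)
        simpa using this
      have h2 := ih s hs.le ξ
      have e : (∫ u, r₁ s (ξ * sinP p u) * r₁ s (ξ * cosP p u) ∂uniformAngle) - r₁ s ξ -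
          ((∫ u, r₂ s (ξ * sinP p u) * r₂ s (ξ * cosP p u) ∂uniformAngle) - r₂ s ξ) =
          ((∫ u, r₁ s (ξ * sinP p u) * r₁ s (ξ * cosP p u) ∂uniformAngle) -
          ∫ u, r₂ s (ξ * sinP p u) * r₂ s (ξ * cosP p u) ∂uniformAngle) - (r₁ s ξ - r₂ s ξ) := by
        ring
      rw [e]
      refine (abs_sub _ _).trans ?_
      linarith
  have hlim : Tendsto (fun n : ℕ => 2 * ((3 * t) ^ n / n.factorial)) atTop (𝓝 (2 * 0)) :=
    (FloorSemiring.tendsto_pow_div_factorial_atTop (3 * t)).const_mul 2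
  rw [mul_zero] at hlim
  have h := ge_of_tendsto' hlim fun n => key n t ht ξ
  exact sub_eq_zero.1 (abs_nonpos_iff.1 h)

/-! ### The real and imaginary parts of the solution -/

section Solution

variable {p : ℝ} {μ₀ : Measure ℝ} {μ : ℝ → Measure ℝ}

lemma integrable_mul_comp_angle {a b : ℝ → ℝ} (ha : Measurable a) (hb : Measurable b)
    (ha1 : ∀ x, |a x| ≤ 1) (hb1 : ∀ x, |b x| ≤ 1) (ξ : ℝ) :
    Integrable (fun θ => a (ξ * sinP p θ) * b (ξ * cosP p θ)) uniformAngle := by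
  refine Integrable.of_bound (Measurable.aestronglyMeasurable ?_) 1
    (Eventually.of_forall fun u => ?_)
  · exact (ha.comp ((measurable_sinP p).const_mul ξ)).mul (hb.comp ((measurable_cosP p).const_mul ξ))
  · rw [norm_mul]
    exact mul_le_one₀ (ha1 _) (norm_nonneg _) (hb1 _)

lemma im_charFun_neg (μ : Measure ℝ) (ξ : ℝ) : (charFun μ (-ξ)).im = -(charFun μ ξ).im := by
  rw [charFun_neg]; simp

/-- The reflection θ ↦ -θ reverses s and preserves c. -/
lemma integral_comp_angle_eq_zero_of_odd_sin {a b : ℝ → ℝ} (ha : ∀ x, a (-x) = -a x) (ξ : ℝ) :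
    ∫ θ, a (ξ * sinP p θ) * b (ξ * cosP p θ) ∂uniformAngle = 0 := by
  refine integral_uniformAngle_eq_zero (fun θ => ?_) 0 fun θ => ?_
  · simp only [cosP_add_two_pi, sinP_add_two_pi]
  · have h1 : sinP p (0 - θ) = -sinP p θ := by simp [sinP]
    have h2 : cosP p (0 - θ) = cosP p θ := by simp [cosP]
    simp only [h1, h2, mul_neg, ha, neg_mul]

/-- The reflection θ ↦ π - θ reverses c and preserves s. -/
lemma integral_comp_angle_eq_zero_of_odd_cos {a b : ℝ → ℝ} (hb : ∀ x, b (-x) = -b x) (ξ : ℝ) :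
    ∫ θ, a (ξ * sinP p θ) * b (ξ * cosP p θ) ∂uniformAngle = 0 := by
  refine integral_uniformAngle_eq_zero (fun θ => ?_) Real.pi fun θ => ?_
  · simp only [cosP_add_two_pi, sinP_add_two_pi]
  · have h1 : sinP p (Real.pi - θ) = sinP p θ := by simp [sinP]
    have h2 : cosP p (Real.pi - θ) = -cosP p θ := by simp [cosP, Real.cos_pi_sub]
    simp only [h1, h2, mul_neg, hb]

/-- The right-hand side of the kinetic equation. -/
lemma gain_charFun_eq (ν : Measure ℝ) [IsProbabilityMeasure ν] (ξ : ℝ) :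
    ((1 / (2 * Real.pi) : ℝ) : ℂ) * (∫ θ in (0 : ℝ)..(2 * Real.pi),
        charFun ν (ξ * sinP p θ) * charFun ν (ξ * cosP p θ)) =
      ((∫ θ, (charFun ν (ξ * sinP p θ)).re * (charFun ν (ξ * cosP p θ)).re ∂uniformAngle : ℝ) : ℂ) := by
  have hre : Measurable fun x => (charFun ν x).re := by fun_prop
  have him : Measurable fun x => (charFun ν x).im := by fun_prop
  have hre1 := abs_re_charFun_le_one ν
  have him1 := abs_im_charFun_le_one ν
  have hre0 := re_charFun_neg ν
  have him0 := im_charFun_neg ν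
  have e : ((1 / (2 * Real.pi) : ℝ) : ℂ) * (∫ θ in (0 : ℝ)..(2 * Real.pi),
        charFun ν (ξ * sinP p θ) * charFun ν (ξ * cosP p θ)) =
      ∫ θ, charFun ν (ξ * sinP p θ) * charFun ν (ξ * cosP p θ) ∂uniformAngle := by
    rw [integral_uniformAngle, Complex.real_smul]
  have hpt : ∀ θ, charFun ν (ξ * sinP p θ) * charFun ν (ξ * cosP p θ) =
      (((charFun ν (ξ * sinP p θ)).re * (charFun ν (ξ * cosP p θ)).re -
        (charFun ν (ξ * sinP p θ)).im * (charFun ν (ξ * cosP p θ)).im : ℝ) : ℂ) +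
      (((charFun ν (ξ * sinP p θ)).re * (charFun ν (ξ * cosP p θ)).im +
        (charFun ν (ξ * sinP p θ)).im * (charFun ν (ξ * cosP p θ)).re : ℝ) : ℂ) * Complex.I := by
    intro θ
    apply Complex.ext <;> simp
  have i1 := integrable_mul_comp_angle (p := p) hre hre hre1 hre1 ξ
  have i2 := integrable_mul_comp_angle (p := p) him him him1 him1 ξ
  have i3 := integrable_mul_comp_angle (p := p) hre him hre1 him1 ξ
  have i4 := integrable_mul_comp_angle (p := p) him hre him1 hre1 ξ
  rw [e]
  simp_rw [hpt]
  -- The products with an imaginary part in the sine argument are odd in s(θ), and the remaining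
  -- mixed product is odd in c(θ); only the product of real parts survives.
  rw [integral_add (i1.sub i2).ofReal ((i3.add i4).ofReal.mul_const _), integral_mul_const,
    integral_complex_ofReal, integral_complex_ofReal, integral_sub i1 i2, integral_add i3 i4,
    integral_comp_angle_eq_zero_of_odd_sin (a := fun x => (charFun ν x).im)
      (b := fun x => (charFun ν x).im) him0,
    integral_comp_angle_eq_zero_of_odd_sin (a := fun x => (charFun ν x).im)
      (b := fun x => (charFun ν x).re) him0,
    integral_comp_angle_eq_zero_of_odd_cos (a := fun x => (charFun ν x).re)
      (b := fun x => (charFun ν x).im) him0]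
  simp

lemma IsKineticSolution.hasDerivAt_re (h : IsKineticSolution p μ₀ μ) (ξ : ℝ) {t : ℝ} (ht : 0 < t) :
    HasDerivAt (fun t => (charFun (μ t) ξ).re)
      ((∫ θ, (charFun (μ t) (ξ * sinP p θ)).re * (charFun (μ t) (ξ * cosP p θ)).re ∂uniformAngle)
        - (charFun (μ t) ξ).re) t := by
  have := h.prob t ht.le
  have hd := h.eqn ξ t ht
  rw [gain_charFun_eq] at hd
  have h2 := Complex.reCLM.hasFDerivAt.comp_hasDerivAt t hd
  simpa [Function.comp_def] using h2

lemma IsKineticSolution.hasDerivAt_im (h : IsKineticSolution p μ₀ μ) (ξ : ℝ) {t : ℝ} (ht : 0 < t) :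
    HasDerivAt (fun t => (charFun (μ t) ξ).im) (-(charFun (μ t) ξ).im) t := by
  have := h.prob t ht.le
  have hd := h.eqn ξ t ht
  rw [gain_charFun_eq] at hd
  have h2 := Complex.imCLM.hasFDerivAt.comp_hasDerivAt t hd
  simpa [Function.comp_def] using h2

lemma IsKineticSolution.re_eq_wildSum [IsProbabilityMeasure μ₀] (h : IsKineticSolution p μ₀ μ)
    {t : ℝ} (ht : 0 ≤ t) (ξ : ℝ) : (charFun (μ t) ξ).re = wildSum μ₀ p t ξ := by
  refine eq_of_hasDerivAt_gain (p := p) (r₁ := fun t ξ => (charFun (μ t) ξ).re)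
    (r₂ := wildSum μ₀ p) (fun t ht => ?_) (fun t _ => measurable_wildSum μ₀ p t)
    (fun t ht ξ => ?_) (fun t ht ξ => abs_wildSum_le_one μ₀ p ht ξ) (fun ξ => ?_)
    (continuousWithinAt_wildSum μ₀ p) (fun ξ t ht => h.hasDerivAt_re ξ ht)
    (fun ξ t ht => hasDerivAt_wildSum μ₀ p ht ξ) (fun ξ => ?_) ht ξ
  · have := h.prob t ht
    fun_prop
  · have := h.prob t ht
    exact abs_re_charFun_le_one _ _
  · exact Complex.continuous_re.continuousAt.comp_continuousWithinAt (h.cont_zero ξ)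
  · rw [wildSum, tsum_treeWeight_zero_mul, charProd_leaf, h.init]

/-- The gain term is real, so the imaginary part obeys u' = -u. -/
lemma IsKineticSolution.im_eq (h : IsKineticSolution p μ₀ μ)
    {t : ℝ} (ht : 0 ≤ t) (ξ : ℝ) :
    (charFun (μ t) ξ).im = Real.exp (-t) * (charFun μ₀ ξ).im := by
  have hc : ContinuousOn (fun t => (charFun (μ t) ξ).im) (Ici 0) :=
    continuousOn_Ici_of_hasDerivAt
      (Complex.continuous_im.continuousAt.comp_continuousWithinAt (h.cont_zero ξ))
      fun t ht => h.hasDerivAt_im ξ ht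
  have h1 := abs_le_of_abs_deriv_le (u := fun t => Real.exp t * (charFun (μ t) ξ).im -
      (charFun μ₀ ξ).im) (u' := fun _ => 0) (B := fun _ => 0) (B' := fun _ => 0)
    ((Continuous.continuousOn (by fun_prop)).mul hc |>.sub continuousOn_const)
    (by simp [h.init]) (fun t ht => by
      have := ((Real.hasDerivAt_exp t).mul (h.hasDerivAt_im ξ ht)).sub_const (charFun μ₀ ξ).im
      have e : (0 : ℝ) = Real.exp t * (charFun (μ t) ξ).im +
          Real.exp t * -(charFun (μ t) ξ).im := by ring
      rw [e]
      exact this) continuousOn_const rfl (fun t _ => hasDerivAt_const t 0) (fun t _ => by simp) ht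
  have h2 := sub_eq_zero.1 (abs_nonpos_iff.1 h1)
  have h3 : Real.exp (-t) * Real.exp t = 1 := by rw [← Real.exp_add]; simp
  rw [← h2, ← mul_assoc, h3, one_mul]

end Solution

open BinTree

/-! ### The probabilistic representation -/

/-- The law of `∑ βᵢ Xᵢ` for independent `Xᵢ` with the law `μ₀*`. -/
noncomputable def linLaw (μ₀ : Measure ℝ) {n : ℕ} (β : Fin n → ℝ) : Measure ℝ :=
  (Measure.pi fun _ : Fin n => evenPart μ₀).map fun x => ∑ i, β i * x i

lemma measurable_linear {n : ℕ} :
    Measurable fun z : (Fin n → ℝ) × (Fin n → ℝ) => ∑ i, z.1 i * z.2 i := by fun_prop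

section

variable (μ₀ : Measure ℝ) [IsProbabilityMeasure μ₀]

instance isProbabilityMeasure_linLaw {n : ℕ} (β : Fin n → ℝ) : IsProbabilityMeasure (linLaw μ₀ β) :=
  Measure.isProbabilityMeasure_map (Measurable.aemeasurable (by fun_prop))

lemma integral_linLaw {E : Type*} [NormedAddCommGroup E] [NormedSpace ℝ E] (μ₀ : Measure ℝ) {n : ℕ} (β : Fin n → ℝ)
    {f : ℝ → E} (hf : StronglyMeasurable f) :
    ∫ y, f y ∂(linLaw μ₀ β) = ∫ x, f (∑ i, β i * x i) ∂(Measure.pi fun _ : Fin n => evenPart μ₀) :=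
  integral_map (Measurable.aemeasurable (by fun_prop)) hf.aestronglyMeasurable

lemma charFun_linLaw {n : ℕ} (β : Fin n → ℝ) (ξ : ℝ) :
    charFun (linLaw μ₀ β) ξ = ((∏ i, (charFun μ₀ (β i * ξ)).re : ℝ) : ℂ) := by
  rw [charFun_apply_real, integral_linLaw μ₀ β (Continuous.stronglyMeasurable (by fun_prop))]
  have e : ∀ x : Fin n → ℝ, Complex.exp (ξ * ((∑ i, β i * x i : ℝ) : ℂ) * Complex.I) =
      ∏ i, Complex.exp (((β i * ξ : ℝ) : ℂ) * x i * Complex.I) := by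
    intro x
    rw [← Complex.exp_sum]
    congr 1
    push_cast
    rw [Finset.mul_sum, Finset.sum_mul]
    exact Finset.sum_congr rfl fun i _ => by ring
  simp_rw [e]
  rw [integral_fintype_prod_eq_prod (fun i (y : ℝ) => Complex.exp (((β i * ξ : ℝ) : ℂ) * y * Complex.I))]
  push_cast
  refine Finset.prod_congr rfl fun i _ => ?_
  rw [← charFun_evenPart, charFun_apply_real]
  push_cast
  rfl

variable (p : ℝ)

/-- The law of `∑_j β_{j,t} X_j`. -/
noncomputable def wildLaw (t : ℝ) : Measure ℝ :=
  Measure.sum fun g : BinTree => ENNReal.ofReal (treeWeight t g) •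
    (angleLaw.prod (Measure.pi fun _ : Fin g.leaves => evenPart μ₀)).map
      fun z => ∑ i, leafWeight p g z.1 i * z.2 i

lemma measurable_leafWeight_sum (g : BinTree) :
    Measurable fun z : (ℕ → ℝ) × (Fin g.leaves → ℝ) => ∑ i, leafWeight p g z.1 i * z.2 i :=
  measurable_linear.comp (((measurable_leafWeight p g).comp measurable_fst).prodMk measurable_snd)

lemma isProbabilityMeasure_wildLaw {t : ℝ} (ht : 0 ≤ t) : IsProbabilityMeasure (wildLaw μ₀ p t) := by
  constructor
  rw [wildLaw, Measure.sum_apply _ MeasurableSet.univ, ← tsum_ofReal_treeWeight ht]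
  refine tsum_congr fun g => ?_
  rw [Measure.smul_apply, Measure.map_apply (measurable_leafWeight_sum p g) MeasurableSet.univ,
    preimage_univ, measure_univ, smul_eq_mul, mul_one]

lemma integral_wildLaw {E : Type*} [NormedAddCommGroup E] [NormedSpace ℝ E] {t : ℝ} (ht : 0 ≤ t)
    {f : ℝ → E} (hf : StronglyMeasurable f) {C : ℝ} (hC : ∀ x, ‖f x‖ ≤ C) :
    ∫ y, f y ∂(wildLaw μ₀ p t) =
      ∑' g, treeWeight t g • ∫ θ, ∫ y, f y ∂(linLaw μ₀ (leafWeight p g θ)) ∂angleLaw := by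
  have hp := isProbabilityMeasure_wildLaw μ₀ p ht
  have hi : Integrable f (wildLaw μ₀ p t) :=
    Integrable.of_bound hf.aestronglyMeasurable C (Eventually.of_forall hC)
  rw [wildLaw] at hi ⊢
  rw [integral_sum_measure hi]
  refine tsum_congr fun g => ?_
  have hm := measurable_leafWeight_sum p g
  rw [integral_smul_measure, ENNReal.toReal_ofReal (treeWeight_nonneg ht g),
    integral_map hm.aemeasurable hf.aestronglyMeasurable, integral_prod]
  · simp_rw [integral_linLaw μ₀ _ hf]
  · exact Integrable.of_bound (hf.comp_measurable hm).aestronglyMeasurable C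
      (Eventually.of_forall fun z => hC _)

lemma charFun_wildLaw {t : ℝ} (ht : 0 ≤ t) (ξ : ℝ) :
    charFun (wildLaw μ₀ p t) ξ = (wildSum μ₀ p t ξ : ℂ) := by
  rw [charFun_apply_real, integral_wildLaw μ₀ p ht (C := 1)
    (Continuous.stronglyMeasurable (by fun_prop)) (fun x => by
      rw [← Complex.ofReal_mul, Complex.norm_exp_ofReal_mul_I]), wildSum, Complex.ofReal_tsum]
  refine tsum_congr fun g => ?_
  rw [Complex.real_smul, Complex.ofReal_mul, charProd, ← integral_complex_ofReal]
  congr 1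
  refine integral_congr_ae (Eventually.of_forall fun θ => ?_)
  simp only
  rw [← charFun_apply_real, charFun_linLaw,
    prod_map_weights p g θ fun b => (charFun μ₀ (b * ξ)).re]

lemma real_Iic_wildLaw {t : ℝ} (ht : 0 ≤ t) (x : ℝ) :
    (wildLaw μ₀ p t).real (Iic x) =
      ∑' g, treeWeight t g * ∫ θ, (linLaw μ₀ (leafWeight p g θ)).real (Iic x) ∂angleLaw := by
  have h := integral_wildLaw μ₀ p ht (f := (Iic x).indicator (1 : ℝ → ℝ)) (C := 1)
    (stronglyMeasurable_one.indicator measurableSet_Iic) (fun y => by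
      by_cases hy : y ∈ Iic x <;> simp [hy])
  simp_rw [integral_indicator_one measurableSet_Iic, smul_eq_mul] at h
  exact h

lemma measurable_real_Iic_linLaw (g : BinTree) (x : ℝ) :
    Measurable fun θ => (linLaw μ₀ (leafWeight p g θ)).real (Iic x) := by
  have h : Measurable fun θ => ∫ y, (Iic x).indicator (1 : ℝ → ℝ) (∑ i, leafWeight p g θ i * y i)
      ∂(Measure.pi fun _ : Fin g.leaves => evenPart μ₀) :=
    (StronglyMeasurable.integral_prod_right'
      (f := fun z : (ℕ → ℝ) × (Fin g.leaves → ℝ) =>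
        (Iic x).indicator (1 : ℝ → ℝ) (∑ i, leafWeight p g z.1 i * z.2 i))
      ((stronglyMeasurable_one.indicator measurableSet_Iic).comp_measurable
        (measurable_leafWeight_sum p g))).measurable
  have e : ∀ θ, (linLaw μ₀ (leafWeight p g θ)).real (Iic x) =
      ∫ y, (Iic x).indicator (1 : ℝ → ℝ) (∑ i, leafWeight p g θ i * y i)
      ∂(Measure.pi fun _ : Fin g.leaves => evenPart μ₀) := fun θ => by
    rw [← integral_linLaw μ₀ _ (stronglyMeasurable_one.indicator measurableSet_Iic),
      integral_indicator_one measurableSet_Iic]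
  simp_rw [e]
  exact h

/-- Reflection sends (-∞,x] to the closed half-line [-x,∞); this is why the left limit of F₀ at -x
enters. -/
lemma evenCdf_eq (x : ℝ) :
    evenCdf μ₀ x = (μ₀.real (Iic x) + 1 - μ₀.real (Iio (-x))) / 2 := by
  have h1 : (evenPart μ₀).real (Iic x) = 2⁻¹ * (μ₀.real (Iic x) + μ₀.real (Ici (-x))) := by
    have hm : (fun y : ℝ => -y) ⁻¹' Iic x = Ici (-x) := by
      ext y; simp
    rw [evenPart, measureReal_def, Measure.smul_apply, Measure.add_apply,
      Measure.map_apply measurable_neg measurableSet_Iic, hm, smul_eq_mul, ENNReal.toReal_mul,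
      ENNReal.toReal_add (measure_ne_top _ _) (measure_ne_top _ _)]
    simp [measureReal_def]
  have h2 : μ₀.real (Ici (-x)) = 1 - μ₀.real (Iio (-x)) := by
    rw [← compl_Iio, measureReal_compl measurableSet_Iio, probReal_univ]
  rw [evenCdf, h1, h2]
  ring

variable {μ₀ p}

/-- `F(x,t) = E_t[F_β(x)] + e^{-t} (F₀(x) - F₀*(x))`. -/
lemma IsKineticSolution.real_Iic_eq {μ : ℝ → Measure ℝ} (h : IsKineticSolution p μ₀ μ) {t : ℝ}
    (ht : 0 ≤ t) (x : ℝ) :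
    (μ t).real (Iic x) = (wildLaw μ₀ p t).real (Iic x) +
      Real.exp (-t) / 2 * (μ₀.real (Iic x) + μ₀.real (Iio (-x)) - 1) := by
  have hp := h.prob t ht
  have hw := isProbabilityMeasure_wildLaw μ₀ p ht
  set e : NNReal := ⟨Real.exp (-t), (Real.exp_pos _).le⟩ with he
  have hee : (e : ℝ) = Real.exp (-t) := rfl
  have hsum : ∀ (P Q : Measure ℝ) [IsProbabilityMeasure P] [IsProbabilityMeasure Q] (ξ : ℝ),
      charFun (P + e • Q) ξ = charFun P ξ + (Real.exp (-t) : ℂ) * charFun Q ξ := by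
    intro P Q _ _ ξ
    have hi : ∀ (ν : Measure ℝ) [IsFiniteMeasure ν],
        Integrable (fun x : ℝ => Complex.exp (ξ * x * Complex.I)) ν := fun ν _ =>
      Integrable.of_bound (Continuous.aestronglyMeasurable (by fun_prop)) 1
        (Eventually.of_forall fun x => by rw [← Complex.ofReal_mul, Complex.norm_exp_ofReal_mul_I])
    simp only [charFun_apply_real]
    rw [integral_add_measure (hi _) (hi _), integral_smul_nnreal_measure]
    rw [NNReal.smul_def, hee, Complex.real_smul]
  -- The relation φ = W + e^{-t}(φ₀ - Re φ₀), with W the Wild sum, is rearranged so that both sides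
  -- are positive finite measures, which are determined by their characteristic functions.
  have hm : μ t + e • evenPart μ₀ = wildLaw μ₀ p t + e • μ₀ := by
    refine Measure.ext_of_charFun (funext fun ξ => ?_)
    rw [hsum, hsum, charFun_wildLaw μ₀ p ht, charFun_evenPart, ← h.re_eq_wildSum ht]
    have h1 := h.im_eq ht ξ
    apply Complex.ext
    · simp [-Complex.ofReal_exp, -Complex.ofReal_neg]
    · simp [-Complex.ofReal_exp, -Complex.ofReal_neg, h1]
  have hreal : ∀ (P Q : Measure ℝ) [IsProbabilityMeasure P] [IsProbabilityMeasure Q],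
      (P + e • Q).real (Iic x) = P.real (Iic x) + Real.exp (-t) * Q.real (Iic x) := by
    intro P Q _ _
    rw [measureReal_add_apply, measureReal_nnreal_smul_apply, hee]
  have h2 := hreal (μ t) (evenPart μ₀)
  rw [hm, hreal] at h2
  have h3 := evenCdf_eq μ₀ x
  rw [evenCdf] at h3
  rw [h3] at h2
  linarith

end

/-! ### Averaging the pathwise bound -/

open BinTree

lemma kBarTwo_nonneg (μ₀ : Measure ℝ) (c₀ α D : ℝ) : 0 ≤ kBarTwo μ₀ c₀ α D := by
  refine Real.sSup_nonneg ?_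
  rintro _ ⟨x, hx, rfl⟩
  have : (0 : ℝ) < x := hx
  positivity

lemma zConst_nonneg (c₀ α η r : ℝ) : 0 ≤ zConst c₀ α η r :=
  le_max_of_le_left (integral_nonneg fun _ => abs_nonneg _)

lemma stableDensityNorm_nonneg (a α : ℝ) : 0 ≤ stableDensityNorm a α :=
  Real.iSup_nonneg fun _ => abs_nonneg _

lemma expMaxWeight_nonneg (p t : ℝ) : 0 ≤ expMaxWeight p t :=
  integral_nonneg fun ω => maxWeight_nonneg ω.1 ω.2

lemma expSumWeights_nonneg (p t : ℝ) {f : ℝ → ℝ} (hf : ∀ q, 0 ≤ q → 0 ≤ f q) :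
    0 ≤ expSumWeights p t f := by
  refine integral_nonneg fun ω => List.sum_nonneg fun y hy => ?_
  obtain ⟨b, -, rfl⟩ := List.mem_map.1 hy
  exact hf _ (abs_nonneg b)

lemma abs_le_asymmetry (μ₀ : Measure ℝ) [IsProbabilityMeasure μ₀] (x : ℝ) :
    |μ₀.real (Iic x) + μ₀.real (Iio (-x)) - 1| ≤ asymmetry μ₀ := by
  refine le_ciSup (f := fun x => |μ₀.real (Iic x) + μ₀.real (Iio (-x)) - 1|) ⟨1, ?_⟩ x
  rintro _ ⟨y, rfl⟩
  have h1 : μ₀.real (Iic y) ≤ 1 := measureReal_le_one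
  have h2 : μ₀.real (Iio (-y)) ≤ 1 := measureReal_le_one
  have h3 : 0 ≤ μ₀.real (Iic y) := measureReal_nonneg
  have h4 : 0 ≤ μ₀.real (Iio (-y)) := measureReal_nonneg
  rw [abs_le]
  constructor <;> linarith

lemma expSumWeights_rpow {α p q m t : ℝ} (h0 : 0 < α) (hp : 0 < 1 + p) (hα : α * (1 + p) = 2)
    (hq : α ≤ q) (hm : q * (1 + p) = m) (ht : 0 ≤ t) :
    expSumWeights p t (fun b => b ^ q) = Real.exp (-t * (1 - 2 * sinMoment m)) := by
  rw [expSumWeights, integral_treeLaw ht (C := 1)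
    (fun g => measurable_sum_weights p g (f := fun b => |b| ^ q) (by fun_prop))
    (sum_rpow_weights_le h0 hp hα hq), ← tsum_treeWeight_mul_treeMoment h0 hp hα hq hm ht]
  rfl

lemma integrable_treeLaw {t C : ℝ} (ht : 0 ≤ t) {f : BinTree × (ℕ → ℝ) → ℝ}
    (hf : ∀ g, Measurable fun θ => f (g, θ)) (hC : ∀ g θ, |f (g, θ)| ≤ C) :
    Integrable f (treeLaw t) := by
  have := isProbabilityMeasure_treeLaw ht
  exact Integrable.of_bound (measurable_treeLaw_of_measurable hf).aestronglyMeasurable C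
    (Eventually.of_forall fun ω => hC ω.1 ω.2)

/-- A bound for the conditional distribution function given the tree and the angles, averaged. -/
lemma abs_real_Iic_wildLaw_sub_le (μ₀ : Measure ℝ) [IsProbabilityMeasure μ₀] {α p t : ℝ}
    (h0 : 0 < α) (hp : 0 < 1 + p) (hα : α * (1 + p) = 2) (ht : 0 ≤ t) {f : ℝ → ℝ}
    (hf : Measurable f) {C : ℝ} (hC : ∀ g θ, |((weights p g θ).map fun b => f |b|).sum| ≤ C)
    {q r a b c e x y : ℝ} (hq : α ≤ q) (hr : α ≤ r)
    (h : ∀ g θ, |(linLaw μ₀ (leafWeight p g θ)).real (Iic x) - y| ≤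
      a * ((weights p g θ).map fun b => f |b|).sum + b * ((weights p g θ).map fun b => |b| ^ q).sum
        + c * ((weights p g θ).map fun b => |b| ^ r).sum + e * maxWeight p g θ) :
    |(wildLaw μ₀ p t).real (Iic x) - y| ≤
      a * expSumWeights p t f + b * expSumWeights p t (fun b => b ^ q)
        + c * expSumWeights p t (fun b => b ^ r) + e * expMaxWeight p t := by
  have := isProbabilityMeasure_treeLaw ht
  have hF1 := fun g => measurable_real_Iic_linLaw μ₀ p g x
  have hF2 : ∀ g θ, |(linLaw μ₀ (leafWeight p g θ)).real (Iic x)| ≤ 1 := fun g θ => by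
    rw [abs_of_nonneg measureReal_nonneg]
    exact measureReal_le_one
  have hF : Integrable (fun ω : BinTree × (ℕ → ℝ) =>
      (linLaw μ₀ (leafWeight p ω.1 ω.2)).real (Iic x)) (treeLaw t) := integrable_treeLaw ht hF1 hF2
  have hS : Integrable (fun ω : BinTree × (ℕ → ℝ) =>
      ((weights p ω.1 ω.2).map fun b => f |b|).sum) (treeLaw t) :=
    integrable_treeLaw ht (fun g => measurable_sum_weights p g (f := fun b => f |b|)
      (hf.comp measurable_id.abs)) hC
  have hM : ∀ {s : ℝ}, α ≤ s → Integrable (fun ω : BinTree × (ℕ → ℝ) =>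
      ((weights p ω.1 ω.2).map fun b => |b| ^ s).sum) (treeLaw t) := fun {s} hs =>
    integrable_treeLaw ht (fun g => measurable_sum_weights p g (f := fun b => |b| ^ s)
      (by fun_prop)) (sum_rpow_weights_le h0 hp hα hs)
  have hB : Integrable (fun ω : BinTree × (ℕ → ℝ) => maxWeight p ω.1 ω.2) (treeLaw t) :=
    integrable_treeLaw ht (measurable_maxWeight p) (C := 1) fun g θ => by
      rw [abs_of_nonneg (maxWeight_nonneg g θ)]
      exact maxWeight_le_one h0 hp hα g θ
  have hW : (wildLaw μ₀ p t).real (Iic x) - y =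
      ∫ ω, ((linLaw μ₀ (leafWeight p ω.1 ω.2)).real (Iic x) - y) ∂(treeLaw t) := by
    rw [integral_sub hF (integrable_const y), integral_const, probReal_univ, one_smul,
      real_Iic_wildLaw μ₀ p ht, integral_treeLaw ht hF1 hF2]
  have h1 := hS.const_mul a
  have h2 := (hM hq).const_mul b
  have h3 := (hM hr).const_mul c
  have h4 := hB.const_mul e
  rw [hW]
  refine abs_integral_le_integral_abs.trans ((integral_mono (hF.sub (integrable_const y)).abs
    (((h1.add h2).add h3).add h4) fun ω => h ω.1 ω.2).trans_eq ?_)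
  rw [integral_add' ((h1.add h2).add h3) h4, integral_add' (h1.add h2) h3, integral_add' h1 h2]
  simp only [expSumWeights, expMaxWeight, integral_const_mul]

end KacStable


/-! ### The final estimate -/

theorem theorem8 :
    ∃ c : ℝ, IsBerryEsseenConstant c ∧
      ∀ (α p : ℝ), 0 < α → α < 2 → α = 2 / (1 + p) →
      ∀ (μ₀ : Measure ℝ), IsProbabilityMeasure μ₀ →
      ∀ (c₀ : ℝ), 0 < c₀ →
        Tendsto (fun x : ℝ => x ^ α * (1 - evenCdf μ₀ x)) atTop (𝓝 c₀) →
      ∀ (D : ℝ), 0 < D →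
        (MonotoneOn (sStar μ₀ c₀ α) (Ici D) ∨ AntitoneOn (sStar μ₀ c₀ α) (Ici D)) →
      ∀ (η : ℝ), 0 < η → η < scaleA c₀ α →
      ∀ (d : ℝ), 0 < d → d < 1 →
        (∀ x : ℝ, |x| ≤ dTilde μ₀ c₀ α d →
          4 / 5 * bigM μ₀ c₀ α ^ 2 * |x| ^ α + vBar μ₀ c₀ α |x| ≤ η) →
      ∀ (μ : ℝ → Measure ℝ), IsKineticSolution p μ₀ μ →
      ∀ (t : ℝ), 0 ≤ t →
        kolmogorov (μ t) (stableLaw (scaleA c₀ α) α) ≤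
          2 / Real.pi * bBarThree μ₀ c₀ α η D *
              expSumWeights p t (fun q => q ^ α * (hOne μ₀ c₀ α q + hThree μ₀ c₀ α q))
            + c * stableDensityNorm (scaleA c₀ α) α / dTilde μ₀ c₀ α d * expMaxWeight p t
            + 2 / Real.pi *
              (bBarOne μ₀ c₀ α η D * Real.exp (-t * (1 - 2 * sinMoment (4 / α)))
                + bBarTwo μ₀ c₀ α η D *
                    Real.exp (-t * (1 - 2 * sinMoment ((8 - 2 * α) / α)))
                + bFive μ₀ c₀ α η * Real.exp (-t * (1 - 2 * sinMoment 4))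
                + bSix μ₀ c₀ α η * Real.exp (-t * (1 - 2 * sinMoment 6)))
            + Real.exp (-t) / 2 * asymmetry μ₀ := by
  -- The first constant yields the estimate and the second makes the classical inequality true;
  -- their maximum serves both purposes.
  obtain ⟨C₁, -, hC₁⟩ := exists_smoothing_constant (κ := 20 / 19) (by norm_num)
  obtain ⟨C₂, -, hC₂⟩ := exists_smoothing_constant (κ := 2) (by norm_num)
  refine ⟨max C₁ C₂, isBerryEsseenConstant_of_smoothing (le_max_right _ _) hC₂, ?_⟩
  intro α p h0 h2 hαp μ₀ hμ₀ c₀ hc hlim D hD hmono η hη0 hη d hd0 hd1 hdη μ hμ t ht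
  have hp : 0 < 1 + p := by
    rw [hαp] at h0
    exact (div_pos_iff_of_pos_left two_pos).1 h0
  have hα : α * (1 + p) = 2 := by rw [hαp, div_mul_cancel₀ _ hp.ne']
  have ha : 0 < scaleA c₀ α := hη0.trans hη
  have hG := (isStableLaw_stableLaw ha h0 h2).1
  have hdt := dTilde_pos (exists_abs_vStar_le h0 h2 hlim) ha hd0
  have hk1 := kBarOne_nonneg μ₀ c₀ α D
  have hk2 := kBarTwo_nonneg μ₀ c₀ α D
  have hzα := zConst_nonneg c₀ α η α
  have hN1 := (constN_pos h0 (l := 2 + α) (by linarith) hη).le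
  have hN4 := (constN_pos h0 (l := 4) (by norm_num) hη).le
  have hN6 := (constN_pos h0 (l := 4 * α) (by linarith) hη).le
  have hN2 := (constN_pos h0 (l := 2) (by norm_num) hη).le
  set f : ℝ → ℝ := fun q => q ^ α * (hOne μ₀ c₀ α q + hThree μ₀ c₀ α q) with hf
  have hf0 : ∀ q, 0 ≤ q → 0 ≤ f q := fun q hq =>
    mul_nonneg (Real.rpow_nonneg hq α) (add_nonneg (hOne_nonneg μ₀ c₀ α q) (hThree_nonneg μ₀ c₀ α q))
  have hfm : Measurable f := by
    have := measurable_hOne μ₀ c₀ α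
    have := measurable_hThree μ₀ c₀ α
    fun_prop
  obtain ⟨B, hB⟩ := exists_hOne_add_hThree_le hc h0 h2 hlim
  have hfB : ∀ g θ, |((BinTree.weights p g θ).map fun b => f |b|).sum| ≤ B := by
    intro g θ
    rw [sum_map_weights p g θ fun b => f |b|,
      abs_of_nonneg (Finset.sum_nonneg fun i _ => hf0 _ (abs_nonneg _)), ← one_mul B,
      ← sum_rpow_leafWeight hp hα g θ, Finset.sum_mul]
    exact Finset.sum_le_sum fun i _ =>
      mul_le_mul_of_nonneg_left (hB _ (abs_nonneg _)) (by positivity)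
  refine ciSup_le fun x => ?_
  set y := (stableLaw (scaleA c₀ α) α).real (Iic x) with hy
  have hW := abs_real_Iic_wildLaw_sub_le μ₀ h0 hp hα ht hfm hfB (q := 2) (r := 2 * α) (x := x) (y := y)
    (a := 2 / Real.pi * (2 * zConst c₀ α η 0))
    (b := 2 / Real.pi * (2 * kBarOne μ₀ c₀ α D * constN c₀ α η 2
            + |sStar μ₀ c₀ α D| * D ^ 2 * constN c₀ α η 2))
    (c := 2 / Real.pi * bFive μ₀ c₀ α η)
    (e := C₁ * stableDensityNorm (scaleA c₀ α) α / dTilde μ₀ c₀ α d)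
    h2.le (by linarith) fun g θ => by
      have hk := kolmogorov_prod_le hc h0 h2 hD hlim hmono hη0 hη hd0 hd1 hdη hC₁
        (sum_rpow_leafWeight hp hα g θ) (maxWeight_pos h0 hp hα g θ)
        (abs_leafWeight_le_maxWeight g θ) (charFun_linLaw μ₀ _)
      refine (abs_cdf_sub_le_kolmogorov _ _ x).trans (hk.trans_eq ?_)
      rw [sum_map_weights p g θ fun b => f |b|,
        sum_map_weights p g θ fun b => |b| ^ (2 : ℝ),
        sum_map_weights p g θ fun b => |b| ^ (2 * α)]
      ring
  -- The exponents 2 and 2α become 2(1+p) = 4/α and 2α(1+p) = 4.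
  rw [expSumWeights_rpow h0 hp hα h2.le (m := 4 / α) (by field_simp; linarith) ht,
    expSumWeights_rpow h0 hp hα (by linarith) (m := 4) (by linarith) ht] at hW
  have has := mul_le_mul_of_nonneg_left (abs_le_asymmetry μ₀ x)
    (by positivity : 0 ≤ Real.exp (-t) / 2)
  have hE0 := expSumWeights_nonneg p t hf0
  have hmax : C₁ * stableDensityNorm (scaleA c₀ α) α / dTilde μ₀ c₀ α d * expMaxWeight p t ≤
      max C₁ C₂ * stableDensityNorm (scaleA c₀ α) α / dTilde μ₀ c₀ α d * expMaxWeight p t := by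
    have h3 := stableDensityNorm_nonneg (scaleA c₀ α) α
    have h4 := expMaxWeight_nonneg p t
    gcongr
    exact le_max_left _ _
  -- From here on the sharper bound is enlarged by nonnegative terms: those with k̄₂ in B̄₃ and B̄₁,
  -- then B̄₂ and B₆ in full.
  have h3 : 2 / Real.pi * (2 * zConst c₀ α η 0) * expSumWeights p t f ≤
      2 / Real.pi * bBarThree μ₀ c₀ α η D * expSumWeights p t f := by
    have : 0 ≤ 4 * zConst c₀ α η α * kBarTwo μ₀ c₀ α D := by positivity
    rw [bBarThree]
    gcongr
    linarith
  have h1 : 2 / Real.pi * (2 * kBarOne μ₀ c₀ α D * constN c₀ α η 2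
        + |sStar μ₀ c₀ α D| * D ^ 2 * constN c₀ α η 2) *
        Real.exp (-t * (1 - 2 * sinMoment (4 / α))) ≤
      2 / Real.pi * bBarOne μ₀ c₀ α η D * Real.exp (-t * (1 - 2 * sinMoment (4 / α))) := by
    have h5 : 0 ≤ 8 * kBarOne μ₀ c₀ α D * kBarTwo μ₀ c₀ α D * constN c₀ α η (2 + α) := by positivity
    have h6 : 0 ≤ 2 * kBarTwo μ₀ c₀ α D * |sStar μ₀ c₀ α D| * D ^ 2 * constN c₀ α η (2 + α) := by
      positivity
    rw [bBarOne]
    refine mul_le_mul_of_nonneg_right (mul_le_mul_of_nonneg_left ?_ (by positivity)) (Real.exp_pos _).le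
    linarith
  have h5 : 0 ≤ 2 / Real.pi *
      (bBarTwo μ₀ c₀ α η D * Real.exp (-t * (1 - 2 * sinMoment ((8 - 2 * α) / α)))) := by
    rw [bBarTwo]
    positivity
  have h6 : 0 ≤ 2 / Real.pi *
      (bSix μ₀ c₀ α η * Real.exp (-t * (1 - 2 * sinMoment 6))) := by
    rw [bSix]
    positivity
  rw [hμ.real_Iic_eq ht x]
  have habs := abs_add_le ((wildLaw μ₀ p t).real (Iic x) - y)
    (Real.exp (-t) / 2 * (μ₀.real (Iic x) + μ₀.real (Iio (-x)) - 1))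
  rw [abs_mul (Real.exp (-t) / 2), abs_of_nonneg (by positivity : 0 ≤ Real.exp (-t) / 2)] at habs
  rw [add_sub_right_comm]
  refine habs.trans ((add_le_add hW has).trans ?_)
  linarith
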